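/- Let $a,b,c,d,q\in\mathbb{C}$ be non-zero with $|q|<1$. Write $(u;q)_n=\prod_{i=0}^{n-1}(1-q^iu)$ and $(u_1,\dots,u_r;q)_n=\prod_j (u_j;q)_n$. Let $$D=\frac{(1-ax)(1-bx)(1-cx)(1-dx)}{(1-x^2)(1-qx^2)}\,(T_{q,x}-1)+\frac{(1-a/x)(1-b/x)(1-c/x)(1-d/x)}{(1-1/x^2)(1-q/x^2)}\,(T_{q,x}^{-1}-1)$$ be the Askey–Wilson $q$-difference operator, where $T_{q,x}^{\pm1}g(x)=g(q^{\pm1}x)$. Let $s=q^{-\lambda}$ with $\lambda\in\mathbb{C}$ (principal power), and let $D$ act on formal series $x^{-\lambda}g(x)$, $g\in\mathbb{C}((x))$, by $T_{q,x}^{\pm1}x^{n-\lambda}=q^{\pm(n-\lambda)}x^{n-\lambda}$ and by expanding the rational coefficients at $x=0$. Put $$c_e(k,l;s)=\frac{(a^2,\,q^{4l}s^2;q^2)_k}{(q^2,\,q^{4l}q^2s^2/a^2;q^2)_k}\Big(\frac{q^2}{a^2}\Big)^k\,\frac{(c^2/q,\,s^2/a^2;q^2)_l}{(q^2,\,q^3s^2/a^2c^2;q^2)_l}\,\frac{(s;q)_{2l}\,(q^2s^2/a^4;q^2)_{2l}}{(qs/a^2;q)_{2l}\,(s^2/a^2;q^2)_{2l}}\Big(\frac{q^2}{c^2}\Big)^l,$$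 $$c_o(m,n;s)=\frac{(-b/a,\,s,\,qs/cd,\,qs^2/a^2c^2;q)_m}{(q,\,q^2s^2/abcd;q)_m\,(qs^2/a^2c^2;q^2)_m}\Big(\frac qb\Big)^m\,\frac{(-d/c,\,q^ms,\,qs/ab,\,-q^mqs/ac,\,q^mqs^2/a^2c^2;q)_n}{(q,\,q^mq^2s^2/abcd,\,-qs/ac;q)_n\,(q^{2m}qs^2/a^2c^2;q^2)_n}\Big(\frac qd\Big)^n.$$ Suppose that $s$ is generic, in the sense that no denominator in $c_e(k,l;q^{m+n}s)$, $c_o(m,n;s)$ vanishes; explicitly, $s\neq0$ and for all integers $j\ge0$ $$q^{2j}s^2\ne a^2,\quad q^{j+1}s\ne a^2,\quad q^{j+1}s\ne -ac,\quad q^{2j+1}s^2\ne a^2c^2,\quad q^{j+2}s^2\ne abcd .$$ Then there is exactly one formal series $f(x;s)=x^{-\lambda}\sum_{n\ge0}c_nx^n$ with $c_0=1$ and $$D f(x;s)=\Big(s+\frac{abcd}{qs}-1-\frac{abcd}{q}\Big)f(x;s),$$ and it is $$f(x;s)=x^{-\lambda}\sum_{k,l,m,n\ge0}c_e(k,l;q^{m+n}s)\,c_o(m,n;s)\,x^{2k+2l+m+n}.$$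 -/

import Mathlib

namespace AskeyWilson

noncomputable section

/-- The `q`-shifted factorial `(u; q)_n = ∏_{i=0}^{n-1} (1 - q^i u)`. -/
def qPoch (u q : ℂ) (n : ℕ) : ℂ :=
  ∏ i ∈ Finset.range n, (1 - q ^ i * u)

/-- The `q`-shift operator `T_{q,x}^ε` acting on the formal series `x^(-lam) * g(x)`, where `g` is a
formal Laurent series. The formal series `x^(-lam) * g(x)` is represented by `g`; the operator
multiplies the monomial `x^(n - lam)` by `q^(ε * (n - lam))`. -/
def qShift (q lam : ℂ) (ε : ℤ) (g : LaurentSeries ℂ) : LaurentSeries ℂ where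
  coeff n := q ^ ((ε : ℂ) * ((n : ℂ) - lam)) * g.coeff n
  isPWO_support' := g.isPWO_support.mono (fun n hn => by
    intro h
    apply hn
    simp [h])

/-- The indeterminate `x` of the field `ℂ((x))`. -/
def x : LaurentSeries ℂ := HahnSeries.single 1 1

/-- Constants in `ℂ((x))`. -/
def const (u : ℂ) : LaurentSeries ℂ := HahnSeries.C u

/-- The Askey-Wilson `q`-difference operator on `x^(-lam) * ℂ((x))`, an element
`x^(-lam) * g(x)` being represented by `g`. The rational functions of `x` in front of the shift
operators are read in the field `ℂ((x))`, that is, they are expanded at `x = 0`. -/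
def awOperator (a b c d q lam : ℂ) (g : LaurentSeries ℂ) : LaurentSeries ℂ :=
  ((1 - const a * x) * (1 - const b * x) * (1 - const c * x) * (1 - const d * x)
      / ((1 - x ^ 2) * (1 - const q * x ^ 2))) * (qShift q lam 1 g - g)
  + ((1 - const a / x) * (1 - const b / x) * (1 - const c / x) * (1 - const d / x)
      / ((1 - 1 / x ^ 2) * (1 - const q / x ^ 2))) * (qShift q lam (-1) g - g)

/-- `x^(-lam) * F(x)`, with `F = ∑ c_n x^n` a formal power series, is a normalised (`c_0 = 1`)
formal eigenseries of the Askey-Wilson operator with eigenvalue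
`s + abcd/(qs) - 1 - abcd/q`. -/
def IsNormalizedEigenseries (a b c d q s lam : ℂ) (F : PowerSeries ℂ) : Prop :=
  PowerSeries.coeff 0 F = 1 ∧
  awOperator a b c d q lam (F : LaurentSeries ℂ)
    = const (s + a * b * c * d / (q * s) - 1 - a * b * c * d / q) * (F : LaurentSeries ℂ)

/-- The even coefficients `c_e(k, l; s | a, c | q)`. -/
def cEven (a c q : ℂ) (k l : ℕ) (s : ℂ) : ℂ :=
  (qPoch (a ^ 2) (q ^ 2) k * qPoch (q ^ (4 * l) * s ^ 2) (q ^ 2) k)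
    / (qPoch (q ^ 2) (q ^ 2) k * qPoch (q ^ (4 * l) * q ^ 2 * s ^ 2 / a ^ 2) (q ^ 2) k)
    * (q ^ 2 / a ^ 2) ^ k
  * ((qPoch (c ^ 2 / q) (q ^ 2) l * qPoch (s ^ 2 / a ^ 2) (q ^ 2) l)
    / (qPoch (q ^ 2) (q ^ 2) l * qPoch (q ^ 3 * s ^ 2 / (a ^ 2 * c ^ 2)) (q ^ 2) l))
  * ((qPoch s q (2 * l) * qPoch (q ^ 2 * s ^ 2 / a ^ 4) (q ^ 2) (2 * l))
    / (qPoch (q * s / a ^ 2) q (2 * l) * qPoch (s ^ 2 / a ^ 2) (q ^ 2) (2 * l)))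
    * (q ^ 2 / c ^ 2) ^ l

/-- The odd coefficients `c_o(m, n; s | a, b, c, d | q)`. -/
def cOdd (a b c d q : ℂ) (m n : ℕ) (s : ℂ) : ℂ :=
  (qPoch (-b / a) q m * qPoch s q m * qPoch (q * s / (c * d)) q m
      * qPoch (q * s ^ 2 / (a ^ 2 * c ^ 2)) q m)
    / (qPoch q q m * qPoch (q ^ 2 * s ^ 2 / (a * b * c * d)) q m
      * qPoch (q * s ^ 2 / (a ^ 2 * c ^ 2)) (q ^ 2) m)
    * (q / b) ^ m
  * ((qPoch (-d / c) q n * qPoch (q ^ m * s) q n * qPoch (q * s / (a * b)) q n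
      * qPoch (-(q ^ m * q * s) / (a * c)) q n
      * qPoch (q ^ m * q * s ^ 2 / (a ^ 2 * c ^ 2)) q n)
    / (qPoch q q n * qPoch (q ^ m * q ^ 2 * s ^ 2 / (a * b * c * d)) q n
      * qPoch (-(q * s) / (a * c)) q n
      * qPoch (q ^ (2 * m) * q * s ^ 2 / (a ^ 2 * c ^ 2)) (q ^ 2) n))
    * (q / d) ^ n

/-- The formal power series
`∑_{k,l,m,n ≥ 0} c_e(k, l; q^(m+n) s) * c_o(m, n; s) * x^(2k+2l+m+n)`. Its coefficient at `x^N` is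
the sum over the finitely many quadruples with `2k+2l+m+n = N`, all of whose entries are `≤ N`. -/
def fourfoldSeries (a b c d q s : ℂ) : PowerSeries ℂ :=
  PowerSeries.mk fun N =>
    ∑ k ∈ Finset.range (N + 1), ∑ l ∈ Finset.range (N + 1),
      ∑ m ∈ Finset.range (N + 1), ∑ n ∈ Finset.range (N + 1),
        if 2 * k + 2 * l + m + n = N then
          cEven a c q k l (q ^ (m + n) * s) * cOdd a b c d q m n s
        else 0

/-- Genericity of `s`: no denominator in `c_e(k, l; q^(m+n) s)` and `c_o(m, n; s)` vanishes.
For fixed non-zero `a, b, c, d, q` with `|q| < 1` this excludes only a discrete (in particular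
countable) set of values of `s`. -/
structure IsGeneric (a b c d q s : ℂ) : Prop where
  ne_zero : s ≠ 0
  ne_a : ∀ j : ℕ, q ^ (2 * j) * s ^ 2 ≠ a ^ 2
  ne_aa : ∀ j : ℕ, q ^ (j + 1) * s ≠ a ^ 2
  ne_ac : ∀ j : ℕ, q ^ (j + 1) * s ≠ -(a * c)
  ne_aacc : ∀ j : ℕ, q ^ (2 * j + 1) * s ^ 2 ≠ a ^ 2 * c ^ 2
  ne_abcd : ∀ j : ℕ, q ^ (j + 2) * s ^ 2 ≠ a * b * c * d

end

end AskeyWilson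

/-!
In terms of `F`, where the eigenseries is `x^(-lam) * F`, the shift `T_{q,x}` is `F(x) ↦ s F(q x)`.
Clearing the denominators of the operator turns the eigenvalue equation into `awDefect F = 0`, an
equation between power series (`isNormalizedEigenseries_iff`).

*Uniqueness.* The leading term `x^n` contributes the eigenvalue at `q^n s`, which differs from the
eigenvalue at `s` for `n ≥ 1` unless `q^(n+1) s^2 = abcd` (`eq_of_awDefect_eq_zero`).

*The bidiagonal basis.* The series `awBasis a q s`, a quotient of infinite products with first-order
`q`-difference equation, is sent by the operator to a combination of itself and
`x * awBasis a q (q s)` (`awOp_awBasis`). A sum over this basis is therefore an eigenseries as soon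
as its coefficients satisfy a two-term recursion; this gives the eigenseries `basisSeries`
(`awDefect_basisSeries`). It remains to show that the fourfold series is `basisSeries`. As the basis
depends on `a`, `q` and `s` only, this can be done for the coefficients over the basis, in two
steps, which change the parameters from `a, -a, √q, -√q` to `a, -a, c, -c` and then to
`a, b, c, d`.

*The even coefficients.* For the parameters `a, -a, √q, -√q` the eigenvalue equation is a two-term
recursion in steps of `x^2`, so that the eigenseries is explicit; its coefficients are the
`k`-dependent part of `c_e` (`rogersSeries_eq_basisSeries`). The sum over `l`, which leads to
`a, -a, c, -c`, is a terminating sum that is evaluated by creative telescoping (`sum_evenTerm`).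

*The odd coefficients.* For `m + n = M` the numbers `c_o(m, n; s)` are the terms of a convolution of
two `₂φ₁` series, up to a factor that depends on `M`. By the generating function of the
Askey-Wilson polynomials, the convolution `oddConv` is such a polynomial of degree `M`. Its
three-term recurrence has `b + d` as the spectral variable (`oddConv_three_term`). On the other
side, the ratio of consecutive coefficients of `basisSeries` is linear in `b + d` for fixed `bd`.
Hence the expansion of these coefficients in the polynomials `oddConv` can be proved by induction,
the recurrence taking care of the factor `b + d` (`sum_oddConv_mul_expWeight`).

*Genericity.* These expansions need more denominators than the fourfold series itself. They hold
for all but countably many `s` (`fourfoldSeries_eq_basisSeries`), and the coefficients of the defect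
of the fourfold series are continuous in `s` at every generic point, so that the defect vanishes
there as well (`awDefect_fourfoldSeries`).
-/

namespace AskeyWilson

open PowerSeries

/-! ### Elementary facts on `q`-shifted factorials -/

theorem one_sub_pow_succ_ne_zero {q : ℂ} (hq1 : ‖q‖ < 1) (n : ℕ) : 1 - q ^ (n + 1) ≠ 0 := by
  intro h
  have h1 : q ^ (n + 1) = 1 := (sub_eq_zero.mp h).symm
  have h2 : ‖q‖ ^ (n + 1) = 1 := by rw [← norm_pow, h1, norm_one]
  exact absurd h2 (pow_lt_one₀ (norm_nonneg q) hq1 (Nat.succ_ne_zero n)).ne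

@[simp]
theorem qPoch_zero (u q : ℂ) : qPoch u q 0 = 1 := by simp [qPoch]

theorem qPoch_succ (u q : ℂ) (n : ℕ) : qPoch u q (n + 1) = qPoch u q n * (1 - q ^ n * u) := by
  simp [qPoch, Finset.prod_range_succ]

theorem qPoch_ne_zero {u q : ℂ} (h : ∀ i : ℕ, 1 - q ^ i * u ≠ 0) (n : ℕ) : qPoch u q n ≠ 0 :=
  Finset.prod_ne_zero_iff.mpr fun i _ => h i

theorem qPoch_self_ne_zero {q : ℂ} (hq1 : ‖q‖ < 1) (n : ℕ) : qPoch q q n ≠ 0 :=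
  qPoch_ne_zero (fun i => by rw [← pow_succ]; exact one_sub_pow_succ_ne_zero hq1 i) n

theorem qPoch_add (u q : ℂ) (m n : ℕ) :
    qPoch u q (m + n) = qPoch u q m * qPoch (q ^ m * u) q n := by
  unfold qPoch
  rw [Finset.prod_range_add]
  congr 1
  exact Finset.prod_congr rfl fun i _ => by ring

/-! ### The Askey-Wilson operator on power series -/

theorem rescale_C (t u : ℂ) : rescale t (C u : PowerSeries ℂ) = C u := by
  ext n
  rcases n with _ | n <;> simp [coeff_rescale, coeff_C]

theorem rescale_X (t : ℂ) : rescale t (X : PowerSeries ℂ) = C t * X := by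
  ext n
  rcases n with _ | _ | n <;> simp [coeff_X]

/-- The Askey-Wilson operator with its denominators cleared: `x^(-lam) * F` is represented by `F`,
the shift `T_{q,x}` becomes `F(x) ↦ s * F(q x)` with `s = q^(-lam)`, and the whole operator is
multiplied by `awDen q`. -/
noncomputable def awOp (a b c d q s : ℂ) (F : PowerSeries ℂ) : PowerSeries ℂ :=
  (1 - C a * X) * (1 - C b * X) * (1 - C c * X) * (1 - C d * X) * (C q - X ^ 2)
      * (C s * rescale q F - F)
    + (1 - C q * X ^ 2) * ((X - C a) * (X - C b) * (X - C c) * (X - C d))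
      * (C s⁻¹ * rescale q⁻¹ F - F)

/-- The common denominator `(1 - x^2) (1 - q x^2) (q - x^2)` of the Askey-Wilson operator. -/
noncomputable def awDen (q : ℂ) : PowerSeries ℂ :=
  (1 - X ^ 2) * (1 - C q * X ^ 2) * (C q - X ^ 2)

/-- The eigenvalue of the Askey-Wilson operator on series with leading term `x^(-lam)`. -/
noncomputable def awEig (a b c d q s : ℂ) : ℂ :=
  s + a * b * c * d / (q * s) - 1 - a * b * c * d / q

/-- The defect of the eigenvalue equation for `F`, denominators cleared. -/
noncomputable def awDefect (a b c d q s : ℂ) (F : PowerSeries ℂ) : PowerSeries ℂ :=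
  awOp a b c d q s F - C (awEig a b c d q s) * awDen q * F

theorem awDefect_add (a b c d q s : ℂ) (F G : PowerSeries ℂ) :
    awDefect a b c d q s (F + G) = awDefect a b c d q s F + awDefect a b c d q s G := by
  simp only [awDefect, awOp, map_add]; ring

theorem awDefect_sub (a b c d q s : ℂ) (F G : PowerSeries ℂ) :
    awDefect a b c d q s (F - G) = awDefect a b c d q s F - awDefect a b c d q s G := by
  simp only [awDefect, awOp, map_sub]; ring

theorem awDefect_C_mul (a b c d q s u : ℂ) (F : PowerSeries ℂ) :
    awDefect a b c d q s (C u * F) = C u * awDefect a b c d q s F := by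
  simp only [awDefect, awOp, map_mul, rescale_C]; ring

theorem awOp_X_pow_mul (q a b c d s : ℂ) (n : ℕ) (F : PowerSeries ℂ) :
    awOp a b c d q s (X ^ n * F) = X ^ n * awOp a b c d q (q ^ n * s) F := by
  simp only [awOp, map_mul, map_pow, rescale_X, mul_inv, mul_pow, ← inv_pow]; ring

theorem X_pow_dvd_awDefect (q a b c d s : ℂ) {n : ℕ} {F : PowerSeries ℂ}
    (h : X ^ n ∣ F) : X ^ n ∣ awDefect a b c d q s F := by
  obtain ⟨G, rfl⟩ := h
  unfold awDefect
  rw [awOp_X_pow_mul]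
  exact ⟨awOp a b c d q (q ^ n * s) G - C (awEig a b c d q s) * awDen q * G, by ring⟩

/-- The difference between the eigenvalues at `s` and at `q^n s`. -/
theorem awEig_sub {q s : ℂ} (hq0 : q ≠ 0) (hs : s ≠ 0) (a b c d : ℂ) (n : ℕ) :
    awEig a b c d q s - awEig a b c d q (q ^ n * s)
      = (1 - q ^ n) * (q ^ (n + 1) * s ^ 2 - a * b * c * d) / (q ^ (n + 1) * s) := by
  have : q ^ n ≠ 0 := pow_ne_zero _ hq0
  unfold awEig
  rw [pow_succ]
  field_simp
  ring

theorem constantCoeff_awOp {q s : ℂ} (hq0 : q ≠ 0) (hs : s ≠ 0) (a b c d : ℂ)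
    (F : PowerSeries ℂ) :
    constantCoeff (awOp a b c d q s F) = q * awEig a b c d q s * constantCoeff F := by
  have h (t : ℂ) : constantCoeff (rescale t F) = constantCoeff F := by
    rw [← coeff_zero_eq_constantCoeff_apply, coeff_rescale]; simp
  simp [awOp, h, awEig]
  field_simp
  ring

/-- A series that solves the eigenvalue equation and has no constant term vanishes, as the
eigenvalues at `s` and at `q^n s` differ for every `n ≥ 1`. -/
theorem eq_zero_of_awDefect_eq_zero {a b c d q s : ℂ} (hq0 : q ≠ 0) (hq1 : ‖q‖ < 1)
    (hs : s ≠ 0) (hne : ∀ j : ℕ, q ^ (j + 2) * s ^ 2 ≠ a * b * c * d) {H : PowerSeries ℂ}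
    (h0 : constantCoeff H = 0) (hH : awDefect a b c d q s H = 0) : H = 0 := by
  have key : ∀ n : ℕ, (X : PowerSeries ℂ) ^ n ∣ H := by
    intro n
    induction n with
    | zero => simp
    | succ n ih =>
      rcases Nat.eq_zero_or_pos n with rfl | hn
      · simpa [X_dvd_iff] using h0
      obtain ⟨G, rfl⟩ := ih
      rw [pow_succ]
      refine mul_dvd_mul_left _ (X_dvd_iff.mpr ?_)
      unfold awDefect at hH
      rw [awOp_X_pow_mul] at hH
      have h1 : (X : PowerSeries ℂ) ^ n
          * (awOp a b c d q (q ^ n * s) G - C (awEig a b c d q s) * awDen q * G) = 0 := by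
        rw [← hH]; ring
      have h2 := (mul_eq_zero.mp h1).resolve_left (pow_ne_zero _ X_ne_zero)
      have h3 := congrArg constantCoeff h2
      rw [map_sub, constantCoeff_awOp hq0 (mul_ne_zero (pow_ne_zero _ hq0) hs)] at h3
      simp only [awDen, map_mul, map_sub, constantCoeff_C, map_pow, constantCoeff_X,
        map_one, map_zero] at h3
      have h4 : (awEig a b c d q s - awEig a b c d q (q ^ n * s)) * (q * constantCoeff G) = 0 := by
        linear_combination -h3
      rw [awEig_sub hq0 hs] at h4
      obtain ⟨k, rfl⟩ : ∃ k, n = k + 1 := ⟨n - 1, by omega⟩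
      have h5 := sub_ne_zero.mpr (hne k)
      have h6 := one_sub_pow_succ_ne_zero hq1 k
      simpa [hq0, hs, h5, h6] using h4
  ext n
  exact X_pow_dvd_iff.mp (key (n + 1)) n (Nat.lt_succ_self n)

theorem eq_of_awDefect_eq_zero {a b c d q s : ℂ} (hq0 : q ≠ 0) (hq1 : ‖q‖ < 1)
    (hs : s ≠ 0) (hne : ∀ j : ℕ, q ^ (j + 2) * s ^ 2 ≠ a * b * c * d) {F G : PowerSeries ℂ}
    (h0 : constantCoeff F = constantCoeff G) (hF : awDefect a b c d q s F = 0)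
    (hG : awDefect a b c d q s G = 0) : F = G :=
  sub_eq_zero.mp <| eq_zero_of_awDefect_eq_zero hq0 hq1 hs hne (by simp [h0])
    (by rw [awDefect_sub, hF, hG, sub_zero])

/-! ### Series on which the operator is bidiagonal -/

/-- The `q`-binomial series `(α x; q)_∞ / (β x; q)_∞ = ∑ₙ ∏_{i<n} (β - α q^i) / (q; q)_n * x^n`. -/
noncomputable def binomialSeries (α β q : ℂ) : PowerSeries ℂ :=
  mk fun n => (∏ i ∈ Finset.range n, (β - α * q ^ i)) / qPoch q q n

theorem rescale_binomialSeries (α β q : ℂ) :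
    rescale q (binomialSeries α β q) = binomialSeries (q * α) (q * β) q := by
  ext n
  simp only [binomialSeries, coeff_rescale, coeff_mk]
  have : ∏ i ∈ Finset.range n, (q * β - q * α * q ^ i)
      = q ^ n * ∏ i ∈ Finset.range n, (β - α * q ^ i) := by
    rw [← Finset.card_range n, ← Finset.prod_const, Finset.card_range, ← Finset.prod_mul_distrib]
    exact Finset.prod_congr rfl fun i _ => by ring
  rw [this]; ring

theorem one_sub_mul_binomialSeries {q : ℂ} (hq1 : ‖q‖ < 1) (α β : ℂ) :
    (1 - C β * X) * binomialSeries α β q = binomialSeries α (q * β) q := by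
  ext n
  rcases n with _ | n
  · simp [binomialSeries, sub_mul, mul_assoc]
  rw [sub_mul, one_mul, map_sub, mul_assoc, coeff_C_mul, coeff_succ_X_mul]
  simp only [binomialSeries, coeff_mk]
  have h1 : ∏ i ∈ Finset.range (n + 1), (q * β - α * q ^ i)
      = (q * β - α) * q ^ n * ∏ i ∈ Finset.range n, (β - α * q ^ i) := by
    rw [Finset.prod_range_succ']
    have : ∀ i, q * β - α * q ^ (i + 1) = q * (β - α * q ^ i) := fun i => by ring
    simp only [this, Finset.prod_mul_distrib, Finset.prod_const, Finset.card_range]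
    ring
  rw [h1, Finset.prod_range_succ, qPoch_succ]
  have h2 := qPoch_self_ne_zero hq1 n
  have h3 := one_sub_pow_succ_ne_zero hq1 n
  rw [← pow_succ]
  field_simp
  ring

theorem one_sub_mul_binomialSeries_left {q : ℂ} (hq1 : ‖q‖ < 1) (α β : ℂ) :
    (1 - C α * X) * binomialSeries (q * α) β q = binomialSeries α β q := by
  ext n
  rcases n with _ | n
  · simp [binomialSeries, sub_mul, mul_assoc]
  rw [sub_mul, one_mul, map_sub, mul_assoc, coeff_C_mul, coeff_succ_X_mul]
  simp only [binomialSeries, coeff_mk]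
  have h1 : ∏ i ∈ Finset.range (n + 1), (β - α * q ^ i)
      = (β - α) * ∏ i ∈ Finset.range n, (β - q * α * q ^ i) := by
    rw [Finset.prod_range_succ', pow_zero, mul_one, mul_comm]
    congr 1
    exact Finset.prod_congr rfl fun i _ => by ring
  rw [h1, Finset.prod_range_succ, qPoch_succ]
  have h2 := qPoch_self_ne_zero hq1 n
  have h3 := one_sub_pow_succ_ne_zero hq1 n
  rw [← pow_succ]
  field_simp
  ring

/-- The power series
`(a x, q s x / a; q)_∞ / (a x / s, q x / a; q)_∞`. For `s = q^(-n)` and up to a constant,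
`x^(-n)` times it is the factor `(a x, a / x; q)_n` of the usual expansion of Askey-Wilson
polynomials. -/
noncomputable def awBasis (a q s : ℂ) : PowerSeries ℂ :=
  binomialSeries a (a / s) q * binomialSeries (q * s / a) (q / a) q

theorem constantCoeff_awBasis (a q s : ℂ) : constantCoeff (awBasis a q s) = 1 := by
  simp [awBasis, binomialSeries, ← coeff_zero_eq_constantCoeff_apply, coeff_mul]

/-- The first-order `q`-difference equation of `awBasis`. -/
theorem rescale_awBasis {a q s : ℂ} (ha : a ≠ 0) (hq1 : ‖q‖ < 1) (hs : s ≠ 0) :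
    (1 - C a * X) * (C a - C (q * s) * X) * (C s * rescale q (awBasis a q s))
      = (C s - C a * X) * (C a - C q * X) * awBasis a q s := by
  have e1 : (1 - C a * X) * binomialSeries (q * a) (q * (a / s)) q
      = (1 - C (a / s) * X) * binomialSeries a (a / s) q := by
    rw [one_sub_mul_binomialSeries_left hq1, one_sub_mul_binomialSeries hq1]
  have e2 : (1 - C (q * s / a) * X) * binomialSeries (q * (q * s / a)) (q * (q / a)) q
      = (1 - C (q / a) * X) * binomialSeries (q * s / a) (q / a) q := by
    rw [one_sub_mul_binomialSeries_left hq1, one_sub_mul_binomialSeries hq1]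
  have f1 : (C a - C (q * s) * X : PowerSeries ℂ) = C a * (1 - C (q * s / a) * X) := by
    rw [mul_sub, ← mul_assoc, ← map_mul, mul_div_cancel₀ _ ha, mul_one]
  have f2 : (C s - C a * X : PowerSeries ℂ) = C s * (1 - C (a / s) * X) := by
    rw [mul_sub, ← mul_assoc, ← map_mul, mul_div_cancel₀ _ hs, mul_one]
  have f3 : (C a - C q * X : PowerSeries ℂ) = C a * (1 - C (q / a) * X) := by
    rw [mul_sub, ← mul_assoc, ← map_mul, mul_div_cancel₀ _ ha, mul_one]
  rw [f1, f2, f3, awBasis, map_mul, rescale_binomialSeries, rescale_binomialSeries]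
  linear_combination (C a * C s * (1 - C (q * s / a) * X)
      * binomialSeries (q * (q * s / a)) (q * (q / a)) q) * e1
    + (C a * C s * (1 - C (a / s) * X) * binomialSeries a (a / s) q) * e2

/-- The contiguous relation between `awBasis` at `s` and at `q s`. -/
theorem awBasis_mul_q {a q s : ℂ} (ha : a ≠ 0) (hq0 : q ≠ 0) (hq1 : ‖q‖ < 1) (hs : s ≠ 0) :
    (C a - C (q * s) * X) * (C (q * s) - C a * X) * awBasis a q (q * s)
      = C (a * q * s) * awBasis a q s := by
  have hqs : q * s ≠ 0 := mul_ne_zero hq0 hs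
  have e1 := one_sub_mul_binomialSeries hq1 a (a / (q * s))
  have e2 := one_sub_mul_binomialSeries_left hq1 (q * s / a) (q / a)
  rw [show q * (a / (q * s)) = a / s by field_simp] at e1
  rw [show q * (q * s / a) = q * (q * s) / a by ring] at e2
  have f1 : (C a - C (q * s) * X : PowerSeries ℂ) = C a * (1 - C (q * s / a) * X) := by
    rw [mul_sub, ← mul_assoc, ← map_mul, mul_div_cancel₀ _ ha, mul_one]
  have f2 : (C (q * s) - C a * X : PowerSeries ℂ) = C (q * s) * (1 - C (a / (q * s)) * X) := by
    rw [mul_sub, ← mul_assoc, ← map_mul, mul_div_cancel₀ _ hqs, mul_one]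
  rw [f1, f2, awBasis, awBasis, ← e1, ← e2, mul_assoc a q s, map_mul C a]
  ring

/-- The coefficient of the subdiagonal term in the action on the series `awBasis`. -/
noncomputable def awSub (a b c d q s : ℂ) : ℂ :=
  (s - 1) * (q * s - a * b) * (q * s - a * c) * (q * s - a * d) / (a * q ^ 2 * s ^ 2)

/-- The polynomial identity behind the bidiagonal action, in a commutative ring. -/
theorem bidiagonal_identity {R : Type*} [CommRing R] {a b c d q s si E μ X e te tie e1 : R}
    (hE : q * s * E = (s - 1) * (q * s - a * b * c * d))
    (hμ : a * q ^ 2 * s ^ 2 * μ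
      = (s - 1) * (q * s - a * b) * (q * s - a * c) * (q * s - a * d))
    (h1 : (1 - a * X) * (a - q * s * X) * (s * te) = (s - a * X) * (a - q * X) * e)
    (h2 : (q * s - a * X) * (a - X) * (si * tie) = (q - a * X) * (a - s * X) * e)
    (h3 : (a - q * s * X) * (q * s - a * X) * e1 = a * q * s * e) :
    (a * q ^ 2 * s ^ 2) * ((a - q * s * X) * (q * s - a * X)
      * ((1 - a * X) * (1 - b * X) * (1 - c * X) * (1 - d * X) * (q - X ^ 2) * (s * te - e)
        + (1 - q * X ^ 2) * ((X - a) * (X - b) * (X - c) * (X - d)) * (si * tie - e)))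
      = (a * q ^ 2 * s ^ 2) * ((a - q * s * X) * (q * s - a * X)
      * ((1 - X ^ 2) * (1 - q * X ^ 2) * (q - X ^ 2) * (E * e + μ * X * e1))) := by
  linear_combination
    (a * q ^ 2 * s ^ 2 * (q * s - a * X) * (1 - b * X) * (1 - c * X) * (1 - d * X) * (q - X ^ 2))
      * h1
    - (a * q ^ 2 * s ^ 2 * (a - q * s * X) * (1 - q * X ^ 2) * (X - b) * (X - c) * (X - d)) * h2
    - (a * q ^ 2 * s ^ 2 * (1 - X ^ 2) * (1 - q * X ^ 2) * (q - X ^ 2) * μ * X) * h3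
    - (a * q * s * (a - q * s * X) * (q * s - a * X)
        * (1 - X ^ 2) * (1 - q * X ^ 2) * (q - X ^ 2) * e) * hE
    - (a * q * s * (1 - X ^ 2) * (1 - q * X ^ 2) * (q - X ^ 2) * X * e) * hμ

theorem C_sub_C_mul_X_ne_zero {u v : ℂ} (hu : u ≠ 0) : (C u - C v * X : PowerSeries ℂ) ≠ 0 := by
  intro h
  have := congrArg constantCoeff h
  simp [hu] at this

/-- The bidiagonal action: `awBasis a q s` is sent to a combination of itself and of
`x * awBasis a q (q * s)`. -/
theorem awOp_awBasis {a q s : ℂ} (ha : a ≠ 0) (hq0 : q ≠ 0) (hq1 : ‖q‖ < 1) (hs : s ≠ 0)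
    (b c d : ℂ) :
    awOp a b c d q s (awBasis a q s)
      = awDen q * (C (awEig a b c d q s) * awBasis a q s
        + C (awSub a b c d q s) * X * awBasis a q (q * s)) := by
  have hCne {u : ℂ} (hu : u ≠ 0) : (C u : PowerSeries ℂ) ≠ 0 := by simpa using hu
  have hsi : (C s * C s⁻¹ : PowerSeries ℂ) = 1 := by rw [← map_mul, mul_inv_cancel₀ hs, map_one]
  have h1 := rescale_awBasis ha hq1 hs
  have h2 : (C q * C s - C a * X) * (C a - X) * (C s⁻¹ * rescale q⁻¹ (awBasis a q s))
      = (C q - C a * X) * (C a - C s * X) * awBasis a q s := by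
    have h := congrArg (rescale q⁻¹) h1
    simp only [map_mul, map_sub, map_one, rescale_X, rescale_C] at h
    rw [show rescale q⁻¹ (rescale q (awBasis a q s)) = awBasis a q s by
      ext n; simp [coeff_rescale, hq0]] at h
    generalize hZ : (C q⁻¹ * X : PowerSeries ℂ) = Z at h
    have hXZ : (X : PowerSeries ℂ) = C q * Z := by
      rw [← hZ, ← mul_assoc, ← map_mul, mul_inv_cancel₀ hq0, map_one, one_mul]
    rw [hXZ]
    linear_combination (-(C q * C s⁻¹)) * h
      + C q * (1 - C a * Z) * (C a - C q * C s * Z) * awBasis a q s * hsi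
  have h3 := awBasis_mul_q ha hq0 hq1 hs
  simp only [map_mul] at h1 h3
  have hE : (C q * C s * C (awEig a b c d q s) : PowerSeries ℂ)
      = (C s - 1) * (C q * C s - C a * C b * C c * C d) := by
    simp only [← map_mul, ← map_sub, ← map_one C]
    congr 1
    unfold awEig
    field_simp
    ring
  have hμ : (C a * C q ^ 2 * C s ^ 2 * C (awSub a b c d q s) : PowerSeries ℂ)
      = (C s - 1) * (C q * C s - C a * C b) * (C q * C s - C a * C c)
        * (C q * C s - C a * C d) := by
    simp only [← map_mul, ← map_sub, ← map_one C, ← map_pow]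
    congr 1
    unfold awSub
    field_simp
  have key := bidiagonal_identity hE hμ h1 h2 h3
  have n1 : (C a * C q ^ 2 * C s ^ 2 : PowerSeries ℂ) ≠ 0 :=
    mul_ne_zero (mul_ne_zero (hCne ha) (pow_ne_zero _ (hCne hq0))) (pow_ne_zero _ (hCne hs))
  have n2 : (C a - C q * C s * X : PowerSeries ℂ) ≠ 0 := by
    rw [← map_mul]; exact C_sub_C_mul_X_ne_zero ha
  have n3 : (C q * C s - C a * X : PowerSeries ℂ) ≠ 0 := by
    rw [← map_mul]; exact C_sub_C_mul_X_ne_zero (mul_ne_zero hq0 hs)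
  have key2 := mul_left_cancel₀ (mul_ne_zero n2 n3) (mul_left_cancel₀ n1 key)
  unfold awOp awDen
  exact key2

/-! ### Eigenseries as sums over the bidiagonal basis -/

/-- The series `∑_N φ_N x^N Y_N(x)`. -/
noncomputable def shiftedSum (φ : ℕ → ℂ) (Y : ℕ → PowerSeries ℂ) : PowerSeries ℂ :=
  mk fun j => ∑ N ∈ Finset.range (j + 1), φ N * coeff (j - N) (Y N)

theorem X_pow_dvd_shiftedSum_sub (φ : ℕ → ℂ) (Y : ℕ → PowerSeries ℂ) (K : ℕ) :
    X ^ K ∣ shiftedSum φ Y - ∑ N ∈ Finset.range K, C (φ N) * (X ^ N * Y N) := by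
  rw [X_pow_dvd_iff]
  intro m hm
  rw [map_sub, map_sum, sub_eq_zero, shiftedSum, coeff_mk]
  simp only [coeff_C_mul, coeff_X_pow_mul']
  rw [← Finset.sum_subset (Finset.range_subset_range.mpr (Nat.succ_le_of_lt hm))]
  · refine Finset.sum_congr rfl fun N hN => ?_
    rw [if_pos (Nat.lt_succ_iff.mp (Finset.mem_range.mp hN))]
  · intro N _ hN
    rw [if_neg (by simpa [Nat.lt_succ_iff] using hN), mul_zero]

/-- The defect of a partial sum: when the coefficients satisfy the two-term recursion `hφ`, all
contributions but the last one cancel. -/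
theorem awDefect_sum_awBasis {a q s : ℂ} (ha : a ≠ 0) (hq0 : q ≠ 0) (hq1 : ‖q‖ < 1) (hs : s ≠ 0)
    (b c d : ℂ) {φ : ℕ → ℂ}
    (hφ : ∀ N, φ (N + 1) * (awEig a b c d q s - awEig a b c d q (q ^ (N + 1) * s))
      = φ N * awSub a b c d q (q ^ N * s)) (K : ℕ) :
    awDefect a b c d q s (∑ N ∈ Finset.range K, C (φ N) * (X ^ N * awBasis a q (q ^ N * s)))
      = X ^ K * (awDen q * C (φ K * (awEig a b c d q s - awEig a b c d q (q ^ K * s)))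
          * awBasis a q (q ^ K * s)) := by
  induction K with
  | zero => simp [awDefect, awOp]
  | succ K ih =>
    rw [Finset.sum_range_succ, awDefect_add, ih, awDefect_C_mul, hφ]
    have h : awDefect a b c d q s (X ^ K * awBasis a q (q ^ K * s))
        = X ^ K * (awOp a b c d q (q ^ K * s) (awBasis a q (q ^ K * s))
          - C (awEig a b c d q s) * awDen q * awBasis a q (q ^ K * s)) := by
      rw [awDefect, awOp_X_pow_mul]; ring
    rw [h, awOp_awBasis ha hq0 hq1 (mul_ne_zero (pow_ne_zero _ hq0) hs), ← mul_assoc q,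
      ← pow_succ' q]
    simp only [map_mul, map_sub]
    ring

theorem awDefect_shiftedSum_awBasis {a q s : ℂ} (ha : a ≠ 0) (hq0 : q ≠ 0) (hq1 : ‖q‖ < 1)
    (hs : s ≠ 0) (b c d : ℂ) {φ : ℕ → ℂ}
    (hφ : ∀ N, φ (N + 1) * (awEig a b c d q s - awEig a b c d q (q ^ (N + 1) * s))
      = φ N * awSub a b c d q (q ^ N * s)) :
    awDefect a b c d q s (shiftedSum φ fun N => awBasis a q (q ^ N * s)) = 0 := by
  ext K
  have h1 := X_pow_dvd_awDefect q a b c d s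
    (X_pow_dvd_shiftedSum_sub φ (fun N => awBasis a q (q ^ N * s)) (K + 1))
  rw [awDefect_sub, awDefect_sum_awBasis ha hq0 hq1 hs b c d hφ] at h1
  have h2 := (dvd_sub_left (Dvd.intro _ rfl)).mp h1
  exact X_pow_dvd_iff.mp h2 K (Nat.lt_succ_self K)

/-- The ratio of consecutive coefficients of an eigenseries over the bidiagonal basis. -/
noncomputable def basisRatio (a b c d q s : ℂ) (n : ℕ) : ℂ :=
  (q ^ n * s - 1) * (q ^ (n + 1) * s - a * b) * (q ^ (n + 1) * s - a * c)
      * (q ^ (n + 1) * s - a * d)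
    / (a * (q ^ n * s) * (1 - q ^ (n + 1)) * (q ^ (n + 2) * s ^ 2 - a * b * c * d))

/-- The coefficients of the normalised eigenseries over the bidiagonal basis:
`(s, q s / ab, q s / ac, q s / ad; q)_n / (q, q^2 s^2 / abcd; q)_n` times
`(-a / s)^n * q^(-n (n - 1) / 2)`, written as a product of ratios. -/
noncomputable def basisCoeff (a b c d q s : ℂ) (n : ℕ) : ℂ :=
  ∏ i ∈ Finset.range n, basisRatio a b c d q s i

@[simp]
theorem basisCoeff_zero (a b c d q s : ℂ) : basisCoeff a b c d q s 0 = 1 := by simp [basisCoeff]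

theorem basisCoeff_succ (a b c d q s : ℂ) (n : ℕ) :
    basisCoeff a b c d q s (n + 1) = basisCoeff a b c d q s n * basisRatio a b c d q s n :=
  Finset.prod_range_succ _ _

/-- The normalised eigenseries, expanded over the bidiagonal basis. -/
noncomputable def basisSeries (a b c d q s : ℂ) : PowerSeries ℂ :=
  shiftedSum (basisCoeff a b c d q s) fun N => awBasis a q (q ^ N * s)

theorem coeff_basisSeries (a b c d q s : ℂ) (j : ℕ) :
    coeff j (basisSeries a b c d q s) = ∑ N ∈ Finset.range (j + 1),
      basisCoeff a b c d q s N * coeff (j - N) (awBasis a q (q ^ N * s)) := by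
  rw [basisSeries, shiftedSum, coeff_mk]

theorem constantCoeff_basisSeries (a b c d q s : ℂ) :
    constantCoeff (basisSeries a b c d q s) = 1 := by
  rw [← coeff_zero_eq_constantCoeff_apply, coeff_basisSeries]
  simp [constantCoeff_awBasis]

theorem awDefect_basisSeries {a q s : ℂ} (ha : a ≠ 0) (hq0 : q ≠ 0) (hq1 : ‖q‖ < 1)
    (hs : s ≠ 0) (b c d : ℂ) (hne : ∀ j : ℕ, q ^ (j + 2) * s ^ 2 ≠ a * b * c * d) :
    awDefect a b c d q s (basisSeries a b c d q s) = 0 := by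
  refine awDefect_shiftedSum_awBasis ha hq0 hq1 hs b c d fun N => ?_
  have h1 := one_sub_pow_succ_ne_zero hq1 N
  have h2 := sub_ne_zero.mpr (hne N)
  have h3 : q ^ N ≠ 0 := pow_ne_zero _ hq0
  rw [basisCoeff_succ, awEig_sub hq0 hs, basisRatio, awSub, mul_assoc]
  congr 1
  rw [pow_succ q (N + 1), pow_succ q N] at *
  generalize q ^ N * q * q * s ^ 2 - a * b * c * d = D at *
  generalize 1 - q ^ N * q = D' at *
  field_simp

/-! ### The two-term case -/

/-- The coefficients of the eigenseries of the operator with parameters `a, -a, √q, -√q`. -/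
noncomputable def rogersCoeff (a q s : ℂ) (k : ℕ) : ℂ :=
  (qPoch (a ^ 2) (q ^ 2) k * qPoch (s ^ 2) (q ^ 2) k)
    / (qPoch (q ^ 2) (q ^ 2) k * qPoch (q ^ 2 * s ^ 2 / a ^ 2) (q ^ 2) k)
    * (q ^ 2 / a ^ 2) ^ k

/-- The series `₂φ₁(a^2, s^2; q^2 s^2 / a^2; q^2; q^2 x^2 / a^2)`. -/
noncomputable def rogersSeries (a q s : ℂ) : PowerSeries ℂ :=
  mk fun n => if Even n then rogersCoeff a q s (n / 2) else 0

theorem rogersCoeff_succ {a q s : ℂ} (ha : a ≠ 0) (hq1 : ‖q‖ < 1)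
    (hne : ∀ j : ℕ, q ^ (2 * j) * s ^ 2 ≠ a ^ 2) (k : ℕ) :
    (1 - q ^ (2 * k + 2)) * (a ^ 2 - q ^ (2 * k + 2) * s ^ 2) * rogersCoeff a q s (k + 1)
      = (1 - q ^ (2 * k) * a ^ 2) * (1 - q ^ (2 * k) * s ^ 2) * q ^ 2 * rogersCoeff a q s k := by
  have h1 := one_sub_pow_succ_ne_zero hq1 (2 * k + 1)
  have h2 : a ^ 2 - q ^ (2 * k + 2) * s ^ 2 ≠ 0 := sub_ne_zero.mpr (hne (k + 1)).symm
  have h4 (i : ℕ) : 1 - (q ^ 2) ^ i * q ^ 2 ≠ 0 := by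
    have := one_sub_pow_succ_ne_zero hq1 (2 * i + 1)
    rwa [← pow_mul, ← pow_add]
  have h5 (i : ℕ) : 1 - (q ^ 2) ^ i * (q ^ 2 * s ^ 2 / a ^ 2) ≠ 0 := by
    intro h
    apply hne (i + 1)
    field_simp at h
    rw [← pow_mul] at h
    linear_combination -h
  have h6 := qPoch_ne_zero h4 k
  have h7 := qPoch_ne_zero h5 k
  have h8 := h4 k
  have h9 := h5 k
  unfold rogersCoeff
  rw [qPoch_succ, qPoch_succ, qPoch_succ, qPoch_succ, pow_succ (q ^ 2 / a ^ 2)]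
  rw [show a ^ 2 - q ^ (2 * k + 2) * s ^ 2 = a ^ 2 * (1 - (q ^ 2) ^ k * (q ^ 2 * s ^ 2 / a ^ 2)) by
    field_simp; ring, show q ^ (2 * k + 2) = (q ^ 2) ^ k * q ^ 2 by ring, pow_mul]
  generalize 1 - (q ^ 2) ^ k * (q ^ 2 * s ^ 2 / a ^ 2) = D1 at *
  generalize 1 - (q ^ 2) ^ k * q ^ 2 = D2 at *
  generalize (q ^ 2 / a ^ 2) ^ k = Z
  field_simp

theorem coeff_quadratic_mul (u v : ℂ) (G : PowerSeries ℂ) (n : ℕ) :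
    coeff (n + 2) ((C u + C v * X ^ 2) * G) = u * coeff (n + 2) G + v * coeff n G := by
  rw [add_mul, map_add, coeff_C_mul, mul_assoc, coeff_C_mul, coeff_X_pow_mul]

theorem coeff_quadratic_mul_of_lt (u v : ℂ) (G : PowerSeries ℂ) {n : ℕ} (hn : n < 2) :
    coeff n ((C u + C v * X ^ 2) * G) = u * coeff n G := by
  rw [add_mul, map_add, coeff_C_mul, mul_assoc, coeff_C_mul, coeff_X_pow_mul',
    if_neg (by omega), mul_zero, add_zero]

/-- For the parameters `a, -a, √q, -√q` a common factor cancels from the eigenvalue equation, which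
leaves an equation that relates the coefficients at `n` and `n + 2` only. -/
theorem rogersSeries_equation {a q s : ℂ} (ha : a ≠ 0) (hq0 : q ≠ 0) (hq1 : ‖q‖ < 1) (hs : s ≠ 0)
    (hne : ∀ j : ℕ, q ^ (2 * j) * s ^ 2 ≠ a ^ 2) :
    (C 1 + C (-a ^ 2) * X ^ 2) * (C s * rescale q (rogersSeries a q s) - rogersSeries a q s)
      + (C (a ^ 2) + C (-1) * X ^ 2)
        * (C s⁻¹ * rescale q⁻¹ (rogersSeries a q s) - rogersSeries a q s)
      = C (s + a ^ 2 / s - 1 - a ^ 2) * ((C 1 + C (-1) * X ^ 2) * rogersSeries a q s) := by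
  have e0 (n : ℕ) : coeff n (rogersSeries a q s)
      = if Even n then rogersCoeff a q s (n / 2) else 0 := by rw [rogersSeries, coeff_mk]
  ext n
  rw [map_add, coeff_C_mul]
  by_cases hn : n < 2
  · simp only [coeff_quadratic_mul_of_lt _ _ _ hn, map_sub, coeff_C_mul, coeff_rescale, e0]
    interval_cases n
    · simp only [pow_zero]
      field_simp
      ring
    · simp
  · obtain ⟨n, rfl⟩ : ∃ k, n = k + 2 := ⟨n - 2, by omega⟩
    simp only [coeff_quadratic_mul, map_sub, coeff_C_mul, coeff_rescale, e0]
    by_cases he : Even n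
    · obtain ⟨k, rfl⟩ := even_iff_two_dvd.mp he
      rw [if_pos (by simp [Nat.even_add]), if_pos (by simp),
        show (2 * k + 2) / 2 = k + 1 by omega, show 2 * k / 2 = k by omega]
      have h := rogersCoeff_succ ha hq1 hne k
      have hQ : q ^ (2 * k) ≠ 0 := pow_ne_zero _ hq0
      rw [pow_add] at h
      rw [pow_add, inv_pow, inv_pow, pow_add]
      generalize q ^ (2 * k) = Q at *
      field_simp
      linear_combination h
    · rw [if_neg (by simpa [Nat.even_add] using he), if_neg he]
      simp

theorem awDefect_rogersSeries {a q r s : ℂ} (ha : a ≠ 0) (hq0 : q ≠ 0) (hq1 : ‖q‖ < 1)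
    (hs : s ≠ 0) (hr : r ^ 2 = q) (hne : ∀ j : ℕ, q ^ (2 * j) * s ^ 2 ≠ a ^ 2) :
    awDefect a (-a) r (-r) q s (rogersSeries a q s) = 0 := by
  have h := rogersSeries_equation ha hq0 hq1 hs hne
  have hE : awEig a (-a) r (-r) q s = s + a ^ 2 / s - 1 - a ^ 2 := by
    unfold awEig
    field_simp
    rw [← hr]
    ring
  have hr' : (C r : PowerSeries ℂ) ^ 2 = C q := by rw [← map_pow, hr]
  unfold awDefect awOp awDen
  rw [hE]
  simp only [map_neg, map_one, map_pow] at h ⊢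
  rw [← hr']
  linear_combination (1 - C r ^ 2 * X ^ 2) * (C r ^ 2 - X ^ 2) * h

/-- The eigenseries of the two-term case is the sum over the bidiagonal basis. -/
theorem rogersSeries_eq_basisSeries {a q r s : ℂ} (ha : a ≠ 0) (hq0 : q ≠ 0) (hq1 : ‖q‖ < 1)
    (hs : s ≠ 0) (hr : r ^ 2 = q) (hne : ∀ j : ℕ, q ^ j * s ^ 2 ≠ a ^ 2) :
    rogersSeries a q s = basisSeries a (-a) r (-r) q s := by
  have hne' : ∀ j : ℕ, q ^ (j + 2) * s ^ 2 ≠ a * (-a) * r * (-r) := by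
    intro j h
    apply hne (j + 1)
    have : q * (q ^ (j + 1) * s ^ 2) = q * a ^ 2 := by
      linear_combination h + a ^ 2 * hr
    exact mul_left_cancel₀ hq0 this
  refine eq_of_awDefect_eq_zero hq0 hq1 hs hne' ?_
    (awDefect_rogersSeries ha hq0 hq1 hs hr fun j => hne (2 * j))
    (awDefect_basisSeries ha hq0 hq1 hs _ _ _ hne')
  rw [constantCoeff_basisSeries, ← coeff_zero_eq_constantCoeff_apply, rogersSeries, coeff_mk]
  simp [rogersCoeff]

/-! ### A three-term recurrence for the odd coefficients -/

/-- The coefficient of the next term in the three-term recurrence, with `Q = q^M`. -/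
noncomputable def recUp (ρ σ q Q : ℂ) : ℂ :=
  ρ / q * (1 + q * σ * Q) * (1 - q * Q * σ ^ 2) * (1 - q * Q)
    / ((1 - q * Q ^ 2 * σ ^ 2) * (1 - q * σ * Q))

/-- The coefficient of the middle term in the three-term recurrence, with `Q = q^M`. -/
noncomputable def recMid (a c ρ σ q Q : ℂ) : ℂ :=
  -ρ / a - a + a * (1 - ρ * Q / (a * c)) * (1 + q * Q * σ * c / a) * (1 - q * Q * σ ^ 2)
      / ((1 - q * Q ^ 2 * σ ^ 2) * (1 - q * σ * Q))
    + (ρ / a) * (1 - Q) * (1 + Q * σ * a / c) * (1 - q * Q * σ ^ 2 * (a * c) / ρ)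
      / ((1 - σ * Q) * (1 - q * Q ^ 2 * σ ^ 2))

/-- The coefficient of the previous term in the three-term recurrence, with `Q = q^M`. -/
noncomputable def recDown (a c ρ σ q Q : ℂ) : ℂ :=
  q * (1 + Q * σ * a / c) * (1 - q * Q * σ ^ 2 * (a * c) / ρ) * (1 - ρ * Q / (q * (a * c)))
      * (1 + Q * σ * c / a)
    / ((1 - σ * Q) * (1 + σ * Q) * (1 - q * Q ^ 2 * σ ^ 2))

/-- Creative telescoping for the convolution of two `₂φ₁`-type sequences `g` and `h`, whose
consecutive values are related by `hg`, `h1`, `h2` (with `h_N = (1 + q^(N+1) σ) f_N`). Here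
`P = q^m` and `q y = q^N`, `m + N = M + 1`. -/
theorem telescoping_identity {a b c d q σ P y κ lam l0 l1 k : ℂ} {g0 g1 f0 f1 f2 : ℂ}
    (ha : a ≠ 0) (hb : b ≠ 0) (hc : c ≠ 0) (hd : d ≠ 0) (hq : q ≠ 0) (hσ : σ ≠ 0)
    (hP : P ≠ 0) (hy : y ≠ 0)
    (n1 : 1 - q * (P * y) ^ 2 * σ ^ 2 ≠ 0) (n2 : 1 - q * σ * (P * y) ≠ 0)
    (n4 : 1 - σ * (P * y) ≠ 0) (n5 : 1 + σ * (P * y) ≠ 0)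
    (hg : (1 - q * P) * (1 + q * σ * P) * g1
      = q / b * (1 - -b / a * P) * (1 - q * σ * a / d * P) * g0)
    (h1 : (1 - q * y) * (1 + q ^ 2 * σ * y) * f0
      = q / d * (1 - -d / c * y) * (1 - q * σ * c / b * y) * f1)
    (h2 : (1 - y) * (1 + q * σ * y) * f1
      = q / d * (1 - -d / c * (y / q)) * (1 - q * σ * c / b * (y / q)) * f2)
    (hk : k = ((-d / c + q * σ * c / b) * σ ^ 2 * (P * y) ^ 2
        - (-b / a + q * σ * a / d) * (-d / c) * (q * σ * c / b) * (P * y) / q)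
      / ((1 - σ * (P * y)) * (1 + σ * (P * y))))
    (hl0 : l0 = q * σ + -d / c + q * σ * c / b + k)
    (hl1 : l1 = -(-d / c) * (q * σ * c / b) + q * σ * k)
    (hlam : lam = b * d * (P * y) / (q * (1 - q * (P * y) ^ 2 * σ ^ 2)))
    (hκ : κ = -(b * d) * (P * y) * (1 - q * (P * y) * σ ^ 2)
      / ((1 - q * (P * y) ^ 2 * σ ^ 2) * (1 - q * σ * (P * y)))) :
    recUp (b * d) σ q (P * y) * (g0 * ((1 + q ^ 2 * σ * y) * f0))
      + (recMid a c (b * d) σ q (P * y) - (b + d)) * (g0 * ((1 + q * σ * y) * f1))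
      + recDown a c (b * d) σ q (P * y) * (g0 * ((1 + σ * y) * f2))
    = (1 - q * P) * (1 + q * σ * P) / (q * P) * g1
        * (κ * (1 + q * σ * y) * f1 + q / d * lam * (l0 + l1 * (y / q)) * f2)
      - (1 - P) * (1 + σ * P) / P * g0
        * (κ * (1 + q ^ 2 * σ * y) * f0 + q / d * lam * (l0 + l1 * y) * f1) := by
  -- denominators are replaced by atoms here and in similar proofs: `field_simp` then clears them
  -- without expanding them
  generalize e1 : 1 - q * (P * y) ^ 2 * σ ^ 2 = D1 at *
  generalize e2 : 1 - q * σ * (P * y) = D2 at *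
  generalize e4 : 1 - σ * (P * y) = D4 at *
  generalize e5 : 1 + σ * (P * y) = D5 at *
  -- `X` and `Y` are the multiples of the relations `h1` and `h2` that the identity consumes, and
  -- `c0`, `c1`, `c2` compare the coefficients of `f0`, `f1`, `f2`
  obtain ⟨X, hX⟩ : ∃ X, X = κ * (-σ * P - 1 / (q * (P * y))) := ⟨_, rfl⟩
  obtain ⟨Y, hY⟩ : ∃ Y, Y = q / d * lam * (-l1 / ((P * y) * q * σ) - σ * P * l0) := ⟨_, rfl⟩
  have c0 : recUp (b * d) σ q (P * y) * (1 + q ^ 2 * σ * y)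
      + (1 - P) * (1 + σ * P) / P * κ * (1 + q ^ 2 * σ * y)
      = X * (1 - q * y) * (1 + q ^ 2 * σ * y) := by
    rw [recUp, e1, e2, hX, hκ]
    field_simp
    ring
  have c1 : (recMid a c (b * d) σ q (P * y) - (b + d)) * (1 + q * σ * y)
      - (q / b * (1 - -b / a * P) * (1 - q * σ * a / d * P) / (q * P) * κ * (1 + q * σ * y)
        - (1 - P) * (1 + σ * P) / P * (q / d) * lam * (l0 + l1 * y))
      = -X * (q / d) * (1 - -d / c * y) * (1 - q * σ * c / b * y)
        + Y * (1 - y) * (1 + q * σ * y) := by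
    rw [recMid, e1, e2, e4, hX, hY, hl0, hl1, hκ, hlam, hk]
    field_simp
    subst e1 e2 e4 e5
    ring
  have c2 : recDown a c (b * d) σ q (P * y) * (1 + σ * y)
      - q / b * (1 - -b / a * P) * (1 - q * σ * a / d * P) / (q * P) * (q / d) * lam
        * (l0 + l1 * (y / q))
      = -Y * (q / d) * (1 - -d / c * (y / q)) * (1 - q * σ * c / b * (y / q)) := by
    rw [recDown, e1, e4, e5, hY, hl0, hl1, hlam, hk]
    field_simp
    subst e1 e2 e4 e5
    ring
  linear_combination (g0 * f0) * c0 + (g0 * f1) * c1 + (g0 * f2) * c2 + (g0 * X) * h1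
    + (g0 * Y) * h2
    - (1 / (q * P)) * (κ * (1 + q * σ * y) * f1 + q / d * lam * (l0 + l1 * (y / q)) * f2) * hg

/-- The general term of a `₂φ₁` series with numerator parameters `u`, `v`, denominator
parameter `w` and argument `z`. -/
noncomputable def phiTerm (u v w z q : ℂ) (n : ℕ) : ℂ :=
  qPoch u q n * qPoch v q n / (qPoch q q n * qPoch w q n) * z ^ n

theorem phiTerm_succ {q w : ℂ} (hq1 : ‖q‖ < 1) (hw : ∀ j : ℕ, 1 - q ^ j * w ≠ 0) (u v z : ℂ)
    (n : ℕ) :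
    (1 - q ^ (n + 1)) * (1 - q ^ n * w) * phiTerm u v w z q (n + 1)
      = z * (1 - q ^ n * u) * (1 - q ^ n * v) * phiTerm u v w z q n := by
  have h1 := qPoch_self_ne_zero hq1 n
  have h2 := qPoch_ne_zero hw n
  have h3 := hw n
  have h4 := one_sub_pow_succ_ne_zero hq1 n
  unfold phiTerm
  simp only [qPoch_succ]
  rw [← pow_succ q n, pow_succ z]
  field_simp

/-- The convolution `∑_{m+n=M}` of the terms of two `₂φ₁` series. Up to a factor that depends on
`m + n` only, its summands are the odd coefficients. Up to normalisation it is an Askey-Wilson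
polynomial of degree `M` at `cos θ` with `exp (2iθ) = b / d`, read off from the generating function
of these polynomials. -/
noncomputable def oddConv (a b c d q σ : ℂ) (M : ℕ) : ℂ :=
  ∑ m ∈ Finset.range (M + 1), phiTerm (-b / a) (q * σ * a / d) (-(q * σ)) (q / b) q m
    * phiTerm (-d / c) (q * σ * c / b) (-(q * σ)) (q / d) q (M - m)

/-- The value of `oddConv` at `M - 1`, with the value `0` for `M = 0`. -/
noncomputable def oddConvPred (a b c d q σ : ℂ) : ℕ → ℂ
  | 0 => 0
  | M + 1 => oddConv a b c d q σ M

theorem oddConv_zero (a b c d q σ : ℂ) : oddConv a b c d q σ 0 = 1 := by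
  simp [oddConv, phiTerm]

/-- A sequence continued by zero to the indices `-2` and `-1`, and shifted by two. -/
def padTwo (f : ℕ → ℂ) : ℕ → ℂ
  | 0 => 0
  | 1 => 0
  | n + 2 => f n

/-- The three-term recurrence of the Askey-Wilson polynomials `oddConv`. Its coefficients involve
`b` and `d` through the product `b * d` only, the sum `b + d` being the spectral variable. -/
theorem oddConv_three_term {a b c d q σ : ℂ} (ha : a ≠ 0) (hb : b ≠ 0) (hc : c ≠ 0) (hd : d ≠ 0)
    (hq0 : q ≠ 0) (hq1 : ‖q‖ < 1) (hσ0 : σ ≠ 0) (hσ : ∀ j : ℕ, q ^ j * σ ^ 2 ≠ 1) (M : ℕ) :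
    (b + d) * oddConv a b c d q σ M
      = recUp (b * d) σ q (q ^ M) * oddConv a b c d q σ (M + 1)
        + recMid a c (b * d) σ q (q ^ M) * oddConv a b c d q σ M
        + recDown a c (b * d) σ q (q ^ M) * oddConvPred a b c d q σ M := by
  have n1 : 1 - q * (q ^ M) ^ 2 * σ ^ 2 ≠ 0 := by
    intro h; apply hσ (2 * M + 1); linear_combination -h
  have n2 : 1 - q * σ * q ^ M ≠ 0 := by
    intro h; apply hσ (2 * M + 2); linear_combination -(1 + q * σ * q ^ M) * h
  have n4 : 1 - σ * q ^ M ≠ 0 := by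
    intro h; apply hσ (2 * M); linear_combination -(1 + σ * q ^ M) * h
  have n5 : 1 + σ * q ^ M ≠ 0 := by
    intro h; apply hσ (2 * M); linear_combination -(1 - σ * q ^ M) * h
  have nw (j : ℕ) : 1 - q ^ j * -(q * σ) ≠ 0 := by
    intro h; apply hσ (2 * j + 2); linear_combination -(1 - q ^ (j + 1) * σ) * h
  have nw' (j : ℕ) : 1 + q ^ (j + 1) * σ ≠ 0 := by
    intro h; apply nw j; linear_combination h
  set g : ℕ → ℂ := phiTerm (-b / a) (q * σ * a / d) (-(q * σ)) (q / b) q with hg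
  set h : ℕ → ℂ := phiTerm (-d / c) (q * σ * c / b) (-(q * σ)) (q / d) q with hh
  -- With `h n = (1 + q^(n+1) σ) * f (n + 2)` and `f 0 = f 1 = 0`, the three neighbouring values of
  -- `h` in the recurrence become multiples of values of `f`, without case distinctions at the ends
  -- of the range of summation.
  set f : ℕ → ℂ := padTwo fun n => h n / (1 + q ^ (n + 1) * σ) with hf
  have hfh (n : ℕ) : (1 + q ^ (n + 1) * σ) * f (n + 2) = h n := by
    rw [hf]; exact mul_div_cancel₀ _ (nw' n)
  have f0 : f 0 = 0 := rfl
  have f1 : f 1 = 0 := rfl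
  have frec (n : ℕ) : (1 - q ^ n) * (1 + q ^ (n + 1) * σ) * f (n + 2)
      = q / d * (1 - -d / c * (q ^ n / q)) * (1 - q * σ * c / b * (q ^ n / q)) * f (n + 1) := by
    rcases n with _ | n
    · simp [f1]
    · rw [mul_assoc, hfh, pow_succ, mul_div_cancel_right₀ _ hq0]
      have e := phiTerm_succ hq1 nw (-d / c) (q * σ * c / b) (q / d) n
      rw [← hh] at e
      have e2 := hfh n
      apply mul_left_cancel₀ (nw n)
      rw [pow_succ] at e e2
      linear_combination e
        - (q / d * (1 - q ^ n * (-d / c)) * (1 - q ^ n * (q * σ * c / b))) * e2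
  obtain ⟨k, hk⟩ : ∃ k, k = ((-d / c + q * σ * c / b) * σ ^ 2 * (q ^ M) ^ 2
        - (-b / a + q * σ * a / d) * (-d / c) * (q * σ * c / b) * (q ^ M) / q)
      / ((1 - σ * (q ^ M)) * (1 + σ * (q ^ M))) := ⟨_, rfl⟩
  obtain ⟨l0, hl0⟩ : ∃ l0, l0 = q * σ + -d / c + q * σ * c / b + k := ⟨_, rfl⟩
  obtain ⟨l1, hl1⟩ : ∃ l1, l1 = -(-d / c) * (q * σ * c / b) + q * σ * k := ⟨_, rfl⟩
  obtain ⟨lam, hlam⟩ : ∃ lam, lam = b * d * (q ^ M) / (q * (1 - q * (q ^ M) ^ 2 * σ ^ 2)) :=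
    ⟨_, rfl⟩
  obtain ⟨κ, hκ⟩ : ∃ κ, κ = -(b * d) * (q ^ M) * (1 - q * (q ^ M) * σ ^ 2)
      / ((1 - q * (q ^ M) ^ 2 * σ ^ 2) * (1 - q * σ * (q ^ M))) := ⟨_, rfl⟩
  -- the certificate: the summand of the recurrence is `G (m + 1) - G m`, and `G` vanishes at both
  -- ends of the range
  set G : ℕ → ℂ := fun m => (1 - q ^ m) * (1 + σ * q ^ m) / q ^ m * g m
    * (κ * (1 + q ^ 2 * σ * (q ^ M / q ^ m)) * f (M + 3 - m)
      + q / d * lam * (l0 + l1 * (q ^ M / q ^ m)) * f (M + 2 - m)) with hG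
  have key : ∀ m ∈ Finset.range (M + 2),
      recUp (b * d) σ q (q ^ M) * (g m * h (M + 1 - m))
        + (recMid a c (b * d) σ q (q ^ M) - (b + d))
          * (g m * ((1 + q * σ * (q ^ M / q ^ m)) * f (M + 2 - m)))
        + recDown a c (b * d) σ q (q ^ M) * (g m * ((1 + σ * (q ^ M / q ^ m)) * f (M + 1 - m)))
      = G (m + 1) - G m := by
    intro m hm
    obtain ⟨N, hN⟩ : ∃ N, M + 1 = m + N :=
      Nat.exists_eq_add_of_le (Nat.lt_succ_iff.mp (Finset.mem_range.mp hm))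
    have hP : q ^ m ≠ 0 := pow_ne_zero _ hq0
    have hy : q ^ M / q ^ m = q ^ N / q := by
      rw [div_eq_div_iff hP hq0, ← pow_succ, hN, pow_add, mul_comm]
    have hy0 : q ^ N / q ≠ 0 := div_ne_zero (pow_ne_zero _ hq0) hq0
    have hQ : q ^ M = q ^ m * (q ^ N / q) := by rw [← hy, mul_div_cancel₀ _ hP]
    have hy1 : q ^ M / q ^ (m + 1) = q ^ N / q / q := by rw [pow_succ, ← div_div, hy]
    have hgrec := phiTerm_succ hq1 nw (-b / a) (q * σ * a / d) (q / b) m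
    rw [← hg] at hgrec
    have i1 : M + 3 - m = N + 2 := by omega
    have i2 : M + 2 - m = N + 1 := by omega
    have i3 : M + 1 - m = N := by omega
    have i4 : M + 3 - (m + 1) = N + 1 := by omega
    have i5 : M + 2 - (m + 1) = N := by omega
    simp only [hG]
    rw [i1, i2, i3, i4, i5, hy, hy1, ← hfh N]
    rw [hQ] at n1 n2 n4 n5 hk hlam hκ
    have h1 := frec N
    have h2 : (1 - q ^ N / q) * (1 + q * σ * (q ^ N / q)) * f (N + 1)
      = q / d * (1 - -d / c * (q ^ N / q / q)) * (1 - q * σ * c / b * (q ^ N / q / q)) * f N := by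
      rcases N with _ | _ | N
      · rw [f1, f0]; ring
      · rw [f1]; simp [hq0]
      · have e := frec (N + 1)
        have t : q ^ (N + 1 + 1) / q = q ^ (N + 1) := by rw [pow_succ, mul_div_cancel_right₀ _ hq0]
        rw [t]
        linear_combination e
    have hqy : q * (q ^ N / q) = q ^ N := mul_div_cancel₀ _ hq0
    have e := telescoping_identity (g0 := g m) (g1 := g (m + 1)) (f0 := f (N + 2))
      (f1 := f (N + 1)) (f2 := f N) ha hb hc hd hq0 hσ0 hP hy0 n1 n2 n4 n5
      (by linear_combination hgrec)
      (by rw [hqy]; linear_combination h1 + (1 - q ^ N) * q * σ * f (N + 2) * hqy) h2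
      hk hl0 hl1 hlam hκ
    rw [← hQ] at e
    have r1 : (1 + q ^ (N + 1) * σ) = 1 + q ^ 2 * σ * (q ^ N / q) := by
      linear_combination -(q * σ) * hqy
    have r2 : q ^ 2 * σ * (q ^ N / q / q) = q * σ * (q ^ N / q) := by
      field_simp
    rw [r1, r2, e, pow_succ q m]
    ring
  have hsum := Finset.sum_congr rfl key
  rw [Finset.sum_range_sub, Finset.sum_add_distrib, Finset.sum_add_distrib, ← Finset.mul_sum,
    ← Finset.mul_sum, ← Finset.mul_sum] at hsum
  have G0 : G 0 = 0 := by simp [hG]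
  have GM : G (M + 2) = 0 := by
    simp only [hG]
    rw [show M + 3 - (M + 2) = 1 by omega, Nat.sub_self, f1, f0]
    ring
  have hy (m : ℕ) (N : ℕ) (hmN : M = m + N) : q ^ M / q ^ m = q ^ N := by
    rw [hmN, pow_add, mul_div_cancel_left₀ _ (pow_ne_zero _ hq0)]
  have s1 : ∑ m ∈ Finset.range (M + 2), g m * ((1 + q * σ * (q ^ M / q ^ m)) * f (M + 2 - m))
      = oddConv a b c d q σ M := by
    rw [Finset.sum_range_succ, show M + 2 - (M + 1) = 1 by omega, f1, mul_zero, mul_zero,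
      add_zero, oddConv]
    refine Finset.sum_congr rfl fun m hm => ?_
    obtain ⟨N, hN⟩ : ∃ N, M = m + N :=
      Nat.exists_eq_add_of_le (Nat.lt_succ_iff.mp (Finset.mem_range.mp hm))
    rw [hy m N hN, show M + 2 - m = N + 2 by omega, show M - m = N by omega,
      show q * σ * q ^ N = q ^ (N + 1) * σ by ring, hfh]
  have s2 : ∑ m ∈ Finset.range (M + 2), g m * ((1 + σ * (q ^ M / q ^ m)) * f (M + 1 - m))
      = oddConvPred a b c d q σ M := by
    rw [Finset.sum_range_succ, Finset.sum_range_succ, Nat.sub_self,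
      show M + 1 - M = 1 by omega, f1, f0]
    simp only [mul_zero, add_zero]
    rcases M with _ | M
    · simp [oddConvPred]
    rw [oddConvPred, oddConv]
    refine Finset.sum_congr rfl fun m hm => ?_
    obtain ⟨N, hN⟩ : ∃ N, M = m + N :=
      Nat.exists_eq_add_of_le (Nat.lt_succ_iff.mp (Finset.mem_range.mp hm))
    rw [hy m (N + 1) (by omega), show M + 1 + 1 - m = N + 2 by omega, show M - m = N by omega,
      mul_comm σ, hfh]
  have s0 : ∑ m ∈ Finset.range (M + 2), g m * h (M + 1 - m) = oddConv a b c d q σ (M + 1) := rfl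
  rw [s0, s1, s2, G0, GM] at hsum
  linear_combination -hsum

/-! ### Summation over the odd coefficients -/

/-- Raising `s` to `q s` in the coefficients over the bidiagonal basis. -/
theorem basisCoeff_mul_q {a b c d q s : ℂ} (ha : a ≠ 0) (hq0 : q ≠ 0) (hq1 : ‖q‖ < 1)
    (hs : s ≠ 0) (hne : ∀ j : ℕ, q ^ (j + 2) * s ^ 2 ≠ a * b * c * d) (n : ℕ) :
    basisCoeff a b c d q (q * s) n * ((s - 1) * (q * s - a * b) * (q * s - a * c) * (q * s - a * d))
        * ((q ^ (n + 2) * s ^ 2 - a * b * c * d) * (q ^ (n + 3) * s ^ 2 - a * b * c * d) * q ^ n)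
      = basisCoeff a b c d q s n
        * ((q ^ n * s - 1) * (q ^ (n + 1) * s - a * b) * (q ^ (n + 1) * s - a * c)
          * (q ^ (n + 1) * s - a * d))
        * ((q ^ 2 * s ^ 2 - a * b * c * d) * (q ^ 3 * s ^ 2 - a * b * c * d)) := by
  induction n with
  | zero => simp only [basisCoeff_zero]; ring
  | succ n ih =>
    have h1 := one_sub_pow_succ_ne_zero hq1 n
    have h2 := sub_ne_zero.mpr (hne n)
    have h4 := sub_ne_zero.mpr (hne (n + 2))
    have hQ : q ^ n ≠ 0 := pow_ne_zero _ hq0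
    rw [basisCoeff_succ, basisCoeff_succ, basisRatio, basisRatio]
    have e4 : q ^ (n + 2) * (q * s) ^ 2 - a * b * c * d
      = q ^ (n + 2 + 2) * s ^ 2 - a * b * c * d := by ring
    have e5 : q ^ (n + 1 + 3) * s ^ 2 - a * b * c * d
      = q ^ (n + 2 + 2) * s ^ 2 - a * b * c * d := by ring
    have e6 : q ^ (n + 1 + 2) * s ^ 2 - a * b * c * d
      = q ^ (n + 3) * s ^ 2 - a * b * c * d := by ring
    rw [e4, e5, e6]
    have e1 : q ^ n * (q * s) = q ^ (n + 1) * s := by ring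
    have e2 : q ^ (n + 1) * (q * s) = q ^ (n + 1 + 1) * s := by ring
    rw [e1, e2]
    have e3 : q ^ (n + 1) = q ^ n * q := pow_succ _ _
    generalize q ^ (n + 2 + 2) * s ^ 2 - a * b * c * d = D4 at *
    generalize q ^ (n + 3) * s ^ 2 - a * b * c * d = D3 at *
    generalize q ^ (n + 2) * s ^ 2 - a * b * c * d = D2 at *
    generalize 1 - q ^ (n + 1) = D1 at *
    generalize (q ^ (n + 1) * s - 1) = Y1 at *
    generalize (q ^ (n + 1 + 1) * s - a * b) = Y2 at *
    generalize (q ^ (n + 1 + 1) * s - a * c) = Y3 at *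
    generalize (q ^ (n + 1 + 1) * s - a * d) = Y4 at *
    generalize (q ^ n * s - 1) * (q ^ (n + 1) * s - a * b) * (q ^ (n + 1) * s - a * c)
          * (q ^ (n + 1) * s - a * d) = Y at *
    generalize (s - 1) * (q * s - a * b) * (q * s - a * c) * (q * s - a * d) = Z at *
    rw [e3]
    field_simp
    linear_combination (Y1 * Y2 * Y3 * Y4) * ih

/-- The factor of the odd coefficients that depends on `m + n` only, with `σ = s / ac`. -/
noncomputable def oddWeight (ρ a c q σ : ℂ) (M : ℕ) : ℂ :=
  qPoch (σ * (a * c)) q M * qPoch (-(q * σ)) q M * qPoch (q * σ ^ 2) q M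
    / (qPoch (q ^ 2 * (σ ^ 2 * (a * c) / ρ)) q M * qPoch (q * σ ^ 2) (q ^ 2) M)

/-- The rational identity behind the recursion in `N` of the expansion, with `Q = q^M` and
`R = q^(N + 1 - M)`. -/
theorem expansion_identity {a c ρ σ q Q R : ℂ} (ha : a ≠ 0) (hc : c ≠ 0) (hρ : ρ ≠ 0)
    (n1 : 1 - q * Q ^ 2 * σ ^ 2 ≠ 0) (n2 : 1 - q * σ * Q ≠ 0) (n4 : 1 - σ * Q ≠ 0) :
    (1 - Q * R) * (1 - q * (Q * R) * (σ ^ 2 * (a * c) / ρ)) * (1 + Q * R * (σ * c / a))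
        * (1 + R * Q * σ)
      = (1 - R) * (1 - q * R * Q ^ 2 * σ ^ 2) * (1 + (Q * R) ^ 2 * (σ ^ 2 * c ^ 2 / ρ)
          - Q * R * (σ * c / ρ) * recMid a c ρ σ q Q)
        + (1 - Q) * R * (1 - q * Q * (σ ^ 2 * (a * c) / ρ)) * (1 + Q * (σ * c / a))
          * (1 - R * Q ^ 2 * σ ^ 2) * (1 - q * R * Q ^ 2 * σ ^ 2)
          / ((1 - σ * Q) * (1 - q * Q ^ 2 * σ ^ 2))
        + (1 + q * Q * (σ * a / c)) * (1 - ρ * Q / (a * c)) * (1 - q * Q * σ ^ 2) * (1 - R)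
          * (q - R) * (Q ^ 2 * R * (σ ^ 2 * c ^ 2 / ρ))
          / ((1 - q * σ * Q) * (1 - q * Q ^ 2 * σ ^ 2)) := by
  rw [recMid]
  generalize e1 : 1 - q * Q ^ 2 * σ ^ 2 = D1 at *
  generalize e2 : 1 - q * σ * Q = D2 at *
  generalize e4 : 1 - σ * Q = D4 at *
  field_simp
  subst e1 e2 e4
  ring

/-- The part of the expansion coefficient of index `(M, n)` that does not involve `oddConv`. -/
noncomputable def expWeight (ρ a c q σ : ℂ) (M n : ℕ) : ℂ :=
  oddWeight ρ a c q σ M * basisCoeff a (-a) c (-c) q (q ^ M * (σ * (a * c))) n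

/-- The common denominator in the recursion for `expWeight`, with `Z = q^(M + n)`. -/
noncomputable def expDen (ρ a c q σ Z : ℂ) : ℂ :=
  (1 - Z) * (1 - q * Z * (σ ^ 2 * (a * c) / ρ)) * (1 + Z * (σ * c / a)) * (1 + Z * σ)

/-- The part of `basisRatio a b c d q s N` that depends on `b` and `d` only through `ρ = b d`,
with `Z = q^N`. -/
noncomputable def stepRatio (ρ a c q σ Z : ℂ) : ℂ :=
  -((1 - Z * (σ * (a * c))) * (1 - q * Z * σ))
    / ((1 - q * Z) * (1 - q ^ 2 * Z * (σ ^ 2 * (a * c) / ρ)) * (Z * (σ * c)))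

theorem basisRatio_eq_stepRatio {a b c d q σ : ℂ} (ha : a ≠ 0) (hb : b ≠ 0) (hc : c ≠ 0)
    (hd : d ≠ 0) (hq0 : q ≠ 0) (hq1 : ‖q‖ < 1) (hσ0 : σ ≠ 0)
    (hne : ∀ j : ℕ, 1 - q ^ j * (σ ^ 2 * (a * c) / (b * d)) ≠ 0) (N : ℕ) :
    basisRatio a b c d q (σ * (a * c)) N
      = stepRatio (b * d) a c q σ (q ^ N)
        * (1 + (q * q ^ N) ^ 2 * (σ ^ 2 * c ^ 2 / (b * d))
          - q * q ^ N * (σ * c / (b * d)) * (b + d)) := by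
  have h1 := one_sub_pow_succ_ne_zero hq1 N
  have h2 := hne (N + 2)
  have e2 : q ^ (N + 2) * (σ * (a * c)) ^ 2 - a * b * c * d
      = -(a * b * c * d) * (1 - q ^ (N + 2) * (σ ^ 2 * (a * c) / (b * d))) := by
    field_simp; ring
  have e3 : q ^ 2 * q ^ N = q ^ (N + 2) := by ring
  have e4 : q * q ^ N = q ^ (N + 1) := by ring
  have hQ : q ^ N ≠ 0 := pow_ne_zero _ hq0
  unfold basisRatio stepRatio
  rw [e2, e3, e4]
  generalize 1 - q ^ (N + 2) * (σ ^ 2 * (a * c) / (b * d)) = D2 at *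
  generalize 1 - q ^ (N + 1) = D1 at *
  generalize q ^ N = Z at *
  generalize q ^ (N + 1) = Z1 at *
  field_simp
  ring

theorem basisRatio_even {a c q σ : ℂ} (ha : a ≠ 0) (hc : c ≠ 0)
    (hq0 : q ≠ 0) (hq1 : ‖q‖ < 1) (hσ0 : σ ≠ 0) (hσ : ∀ j : ℕ, 1 - q ^ j * σ ^ 2 ≠ 0)
    (M n : ℕ) :
    basisRatio a (-a) c (-c) q (q ^ M * (σ * (a * c))) n
      = -((1 - q ^ n * q ^ M * (σ * (a * c))) * (1 + q * q ^ n * q ^ M * (σ * c / a))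
          * (1 - (q * q ^ n * q ^ M * σ) ^ 2))
        / (q ^ n * q ^ M * (σ * c) * (1 - q * q ^ n)
          * (1 - q ^ 2 * q ^ n * (q ^ M) ^ 2 * σ ^ 2)) := by
  have h1 := one_sub_pow_succ_ne_zero hq1 n
  have h2 := hσ (n + 2 + 2 * M)
  have e2 : q ^ (n + 2) * (q ^ M * (σ * (a * c))) ^ 2 - a * (-a) * c * (-c)
      = -(a ^ 2 * c ^ 2) * (1 - q ^ (n + 2 + 2 * M) * σ ^ 2) := by ring
  have e3 : 1 - q ^ 2 * q ^ n * (q ^ M) ^ 2 * σ ^ 2 = 1 - q ^ (n + 2 + 2 * M) * σ ^ 2 := by ring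
  have e4 : q * q ^ n = q ^ (n + 1) := by ring
  have hQ : q ^ n ≠ 0 := pow_ne_zero _ hq0
  have hQ' : q ^ M ≠ 0 := pow_ne_zero _ hq0
  unfold basisRatio
  rw [e2, e3, e4]
  generalize 1 - q ^ (n + 2 + 2 * M) * σ ^ 2 = D2 at *
  generalize 1 - q ^ (n + 1) = D1 at *
  generalize q ^ n = Z at *
  generalize q ^ M = Z' at *
  generalize q ^ (n + 1) = Z1 at *
  field_simp
  ring

/-- Raising `s` to `q s` in `basisCoeff a (-a) c (-c)`. -/
theorem basisCoeff_even_mul_q {a c q σ : ℂ} (ha : a ≠ 0) (hc : c ≠ 0)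
    (hq0 : q ≠ 0) (hq1 : ‖q‖ < 1) (hσ0 : σ ≠ 0) (hσ : ∀ j : ℕ, 1 - q ^ j * σ ^ 2 ≠ 0)
    (hs1 : ∀ j : ℕ, 1 - q ^ j * (σ * (a * c)) ≠ 0)
    (hca : ∀ j : ℕ, 1 + q ^ j * (σ * c / a) ≠ 0) (M n : ℕ) :
    basisCoeff a (-a) c (-c) q (q ^ (M + 1) * (σ * (a * c))) n
      = basisCoeff a (-a) c (-c) q (q ^ M * (σ * (a * c))) n
        * ((1 - q ^ n * q ^ M * (σ * (a * c))) * (1 + q * q ^ n * q ^ M * (σ * c / a))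
          * (1 - (q * q ^ n * q ^ M * σ) ^ 2)
          * (1 - q ^ 3 * (q ^ M) ^ 2 * σ ^ 2))
        / ((1 - q ^ M * (σ * (a * c))) * (1 + q * q ^ M * (σ * c / a))
          * (1 - q ^ 2 * q ^ n * (q ^ M) ^ 2 * σ ^ 2)
          * (1 - q ^ 3 * q ^ n * (q ^ M) ^ 2 * σ ^ 2) * q ^ n) := by
  have hQ : q ^ n ≠ 0 := pow_ne_zero _ hq0
  have hQ' : q ^ M ≠ 0 := pow_ne_zero _ hq0
  have hne (j : ℕ) : q ^ (j + 2) * (q ^ M * (σ * (a * c))) ^ 2 ≠ a * -a * c * -c := by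
    intro h
    apply hσ (j + 2 + 2 * M)
    apply mul_left_cancel₀ (mul_ne_zero (pow_ne_zero 2 ha) (pow_ne_zero 2 hc))
    linear_combination -h
  have h := basisCoeff_mul_q (b := -a) (c := c) (d := -c) ha hq0 hq1
    (s := q ^ M * (σ * (a * c))) (mul_ne_zero hQ' (mul_ne_zero hσ0 (mul_ne_zero ha hc))) hne n
  have fac (Z : ℂ) : Z * (q ^ M * (σ * (a * c))) - a * -a
      = a ^ 2 * (1 + Z * q ^ M * (σ * c / a)) := by field_simp; ring
  have d2 : q ^ (n + 2) * (q ^ M * (σ * (a * c))) ^ 2 - a * -a * c * -c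
      = -(a ^ 2 * c ^ 2) * (1 - q ^ 2 * q ^ n * (q ^ M) ^ 2 * σ ^ 2) := by ring
  have d3 : q ^ (n + 3) * (q ^ M * (σ * (a * c))) ^ 2 - a * -a * c * -c
      = -(a ^ 2 * c ^ 2) * (1 - q ^ 3 * q ^ n * (q ^ M) ^ 2 * σ ^ 2) := by ring
  have n0 := hs1 M
  have n1 : 1 + q * q ^ M * (σ * c / a) ≠ 0 := by rw [← pow_succ']; exact hca (M + 1)
  have n2 : 1 - q ^ 2 * q ^ n * (q ^ M) ^ 2 * σ ^ 2 ≠ 0 := by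
    have := hσ (2 + n + 2 * M); rwa [pow_add, pow_add, mul_comm 2 M, pow_mul] at this
  have n3 : 1 - q ^ 3 * q ^ n * (q ^ M) ^ 2 * σ ^ 2 ≠ 0 := by
    have := hσ (3 + n + 2 * M); rwa [pow_add, pow_add, mul_comm 2 M, pow_mul] at this
  have n4 : 1 - q ^ 2 * (q ^ M) ^ 2 * σ ^ 2 ≠ 0 := by
    have := hσ (2 + 2 * M); rwa [pow_add, mul_comm 2 M, pow_mul] at this
  rw [d2, d3, fac, fac, pow_succ' q n, ← mul_assoc q, ← pow_succ' q M] at h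
  rw [eq_div_iff (mul_ne_zero (mul_ne_zero (mul_ne_zero (mul_ne_zero n0 n1) n2) n3) hQ)]
  generalize basisCoeff a (-a) c (-c) q (q ^ (M + 1) * (σ * (a * c))) n = B1 at *
  generalize basisCoeff a (-a) c (-c) q (q ^ M * (σ * (a * c))) n = B0 at *
  rw [pow_succ' q M] at h
  generalize 1 + q * q ^ M * (σ * c / a) = Y0 at *
  generalize 1 + q * q ^ n * q ^ M * (σ * c / a) = Y1 at *
  refine mul_left_cancel₀ (mul_ne_zero (mul_ne_zero (pow_ne_zero 8 ha) (pow_ne_zero 6 hc)) n4) ?_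
  linear_combination h

/-- The ratio of `expWeight` at `M + 1` and at `M`. -/
theorem expWeight_up {a c ρ q σ : ℂ} (ha : a ≠ 0) (hc : c ≠ 0)
    (hq0 : q ≠ 0) (hq1 : ‖q‖ < 1) (hσ0 : σ ≠ 0) (hσ : ∀ j : ℕ, 1 - q ^ j * σ ^ 2 ≠ 0)
    (hs1 : ∀ j : ℕ, 1 - q ^ j * (σ * (a * c)) ≠ 0)
    (hca : ∀ j : ℕ, 1 + q ^ j * (σ * c / a) ≠ 0)
    (hne : ∀ j : ℕ, 1 - q ^ j * (σ ^ 2 * (a * c) / ρ) ≠ 0) (M n : ℕ) :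
    expWeight ρ a c q σ (M + 1) n
      = expWeight ρ a c q σ M n
        * ((1 + q * q ^ M * σ) * (1 - q * q ^ M * σ ^ 2)
          * (1 - q ^ n * q ^ M * (σ * (a * c))) * (1 + q * q ^ n * q ^ M * (σ * c / a))
          * (1 - (q * q ^ n * q ^ M * σ) ^ 2)
          * (1 - q ^ 3 * (q ^ M) ^ 2 * σ ^ 2))
        / ((1 - q ^ 2 * q ^ M * (σ ^ 2 * (a * c) / ρ)) * (1 - q * (q ^ M) ^ 2 * σ ^ 2)
          * (1 + q * q ^ M * (σ * c / a))
          * (1 - q ^ 2 * q ^ n * (q ^ M) ^ 2 * σ ^ 2)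
          * (1 - q ^ 3 * q ^ n * (q ^ M) ^ 2 * σ ^ 2) * q ^ n) := by
  have p1 (i : ℕ) : 1 - q ^ i * (q ^ 2 * (σ ^ 2 * (a * c) / ρ)) ≠ 0 := by
    have := hne (i + 2); rwa [pow_add, mul_assoc] at this
  have p2 (i : ℕ) : 1 - (q ^ 2) ^ i * (q * σ ^ 2) ≠ 0 := by
    have := hσ (2 * i + 1); rwa [pow_add, pow_mul, pow_one, mul_assoc] at this
  have m1 := qPoch_ne_zero p1 M
  have m2 := qPoch_ne_zero p2 M
  have m3 := p1 M
  have m4 := p2 M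
  have n0 := hs1 M
  have n1 : 1 + q * q ^ M * (σ * c / a) ≠ 0 := by rw [← pow_succ']; exact hca (M + 1)
  have n2 : 1 - q ^ 2 * q ^ n * (q ^ M) ^ 2 * σ ^ 2 ≠ 0 := by
    have := hσ (2 + n + 2 * M); rwa [pow_add, pow_add, mul_comm 2 M, pow_mul] at this
  have n3 : 1 - q ^ 3 * q ^ n * (q ^ M) ^ 2 * σ ^ 2 ≠ 0 := by
    have := hσ (3 + n + 2 * M); rwa [pow_add, pow_add, mul_comm 2 M, pow_mul] at this
  have hQ : q ^ n ≠ 0 := pow_ne_zero _ hq0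
  unfold expWeight oddWeight
  rw [basisCoeff_even_mul_q ha hc hq0 hq1 hσ0 hσ hs1 hca]
  simp only [qPoch_succ]
  rw [show q ^ 2 * q ^ M * (σ ^ 2 * (a * c) / ρ) = q ^ M * (q ^ 2 * (σ ^ 2 * (a * c) / ρ)) by ring,
    show q * (q ^ M) ^ 2 * σ ^ 2 = (q ^ 2) ^ M * (q * σ ^ 2) by ring,
    show q ^ M * -(q * σ) = -(q * q ^ M * σ) by ring, sub_neg_eq_add,
    show q * q ^ M * σ ^ 2 = q ^ M * (q * σ ^ 2) by ring]
  generalize 1 - q ^ M * (q ^ 2 * (σ ^ 2 * (a * c) / ρ)) = D1 at *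
  generalize 1 - (q ^ 2) ^ M * (q * σ ^ 2) = D2 at *
  generalize 1 + q * q ^ M * (σ * c / a) = D3 at *
  generalize 1 - q ^ 2 * q ^ n * (q ^ M) ^ 2 * σ ^ 2 = D4 at *
  generalize 1 - q ^ 3 * q ^ n * (q ^ M) ^ 2 * σ ^ 2 = D5 at *
  generalize 1 - q ^ M * (σ * (a * c)) = D6 at *
  generalize 1 + q * q ^ n * q ^ M * (σ * c / a) = Y1 at *
  generalize 1 - (q * q ^ n * q ^ M * σ) ^ 2 = Y2 at *
  generalize 1 - q ^ 3 * (q ^ M) ^ 2 * σ ^ 2 = Y3 at *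
  generalize 1 - q ^ n * q ^ M * (σ * (a * c)) = Y4 at *
  generalize 1 - q ^ M * (q * σ ^ 2) = Y5 at *
  generalize 1 + q * q ^ M * σ = Y6 at *
  generalize basisCoeff a (-a) c (-c) q (q ^ M * (σ * (a * c))) n = B at *
  generalize q ^ n = T at *
  generalize qPoch (q ^ 2 * (σ ^ 2 * (a * c) / ρ)) q M = K1 at *
  generalize qPoch (q * σ ^ 2) (q ^ 2) M = K2 at *
  generalize qPoch (σ * (a * c)) q M = K3 at *
  generalize qPoch (-(q * σ)) q M = K4 at *
  generalize qPoch (q * σ ^ 2) q M = K5 at *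
  clear hca hs1 hσ p1 p2 hne
  field_simp

/-- The ratio of `expWeight` at `n + 1` and at `n`. -/
theorem expWeight_succ {a c ρ q σ : ℂ} (ha : a ≠ 0) (hc : c ≠ 0)
    (hq0 : q ≠ 0) (hq1 : ‖q‖ < 1) (hσ0 : σ ≠ 0) (hσ : ∀ j : ℕ, 1 - q ^ j * σ ^ 2 ≠ 0) (M n : ℕ) :
    expWeight ρ a c q σ M (n + 1)
      = expWeight ρ a c q σ M n
        * (-((1 - q ^ n * q ^ M * (σ * (a * c))) * (1 + q * q ^ n * q ^ M * (σ * c / a))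
          * (1 - (q * q ^ n * q ^ M * σ) ^ 2))
        / (q ^ n * q ^ M * (σ * c) * (1 - q * q ^ n)
          * (1 - q ^ 2 * q ^ n * (q ^ M) ^ 2 * σ ^ 2))) := by
  rw [expWeight, expWeight, basisCoeff_succ, basisRatio_even ha hc hq0 hq1 hσ0 hσ, ← mul_assoc]

/-- The diagonal part of the recursion for `expWeight`: at `(M, n + 1)` it is a multiple of
`expWeight` at `(M, n)`, with `recMid` as a factor. -/
noncomputable def stepMid (ρ a c q σ : ℂ) (M n : ℕ) : ℂ :=
  (1 - q ^ n) * (1 - q * q ^ n * (q ^ M) ^ 2 * σ ^ 2)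
    * (1 + (q ^ M * q ^ n) ^ 2 * (σ ^ 2 * c ^ 2 / ρ)
      - q ^ M * q ^ n * (σ * c / ρ) * recMid a c ρ σ q (q ^ M))
    / expDen ρ a c q σ (q ^ M * q ^ n) * expWeight ρ a c q σ M n

/-- The part of the recursion for `expWeight` that comes from the index `M - 1`: at `(M + 1, n)` it
is a multiple of `expWeight` at `(M, n)`, with `recUp` as a factor. -/
noncomputable def stepUp (ρ a c q σ : ℂ) (M n : ℕ) : ℂ :=
  (1 - q ^ M) * q ^ n * (1 - q * q ^ M * (σ ^ 2 * (a * c) / ρ)) * (1 + q ^ M * (σ * c / a))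
    * (1 - q ^ n * (q ^ M) ^ 2 * σ ^ 2) * (1 - q * q ^ n * (q ^ M) ^ 2 * σ ^ 2)
    / ((1 - σ * q ^ M) * (1 - q * (q ^ M) ^ 2 * σ ^ 2))
    / expDen ρ a c q σ (q ^ M * q ^ n) * expWeight ρ a c q σ M n

/-- The part of the recursion for `expWeight` that comes from the index `M + 1`: at `(M, n + 2)` it
is a multiple of `expWeight` at `(M + 1, n)`, with `recDown` as a factor. -/
noncomputable def stepDown (ρ a c q σ : ℂ) (M n : ℕ) : ℂ :=
  (1 + q * q ^ M * (σ * a / c)) * (1 - ρ * q ^ M / (a * c)) * (1 - q * q ^ M * σ ^ 2)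
    * (1 - q ^ n) * (q - q ^ n) * ((q ^ M) ^ 2 * q ^ n * (σ ^ 2 * c ^ 2 / ρ))
    / ((1 - q * σ * q ^ M) * (1 - q * (q ^ M) ^ 2 * σ ^ 2))
    / expDen ρ a c q σ (q ^ M * q ^ n) * expWeight ρ a c q σ M n

theorem stepMid_succ {a c ρ q σ : ℂ} (ha : a ≠ 0) (hc : c ≠ 0)
    (hq0 : q ≠ 0) (hq1 : ‖q‖ < 1) (hσ0 : σ ≠ 0) (hσ : ∀ j : ℕ, 1 - q ^ j * σ ^ 2 ≠ 0)
    (hca : ∀ j : ℕ, 1 + q ^ j * (σ * c / a) ≠ 0)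
    (hne : ∀ j : ℕ, 1 - q ^ j * (σ ^ 2 * (a * c) / ρ) ≠ 0) (M n : ℕ) :
    stepMid ρ a c q σ M (n + 1)
      = stepRatio ρ a c q σ (q ^ (M + n))
        * (1 + (q * q ^ (M + n)) ^ 2 * (σ ^ 2 * c ^ 2 / ρ)
          - q * q ^ (M + n) * (σ * c / ρ) * recMid a c ρ σ q (q ^ M))
        * expWeight ρ a c q σ M n := by
  have n1 := one_sub_pow_succ_ne_zero hq1 n
  have n2 := one_sub_pow_succ_ne_zero hq1 (M + n)
  have n3 := hne (M + n + 2)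
  have n4 := hca (M + n + 1)
  have n5 := hσ (2 + n + 2 * M)
  have n6 : 1 + q ^ (M + n + 1) * σ ≠ 0 := by
    intro h; apply hσ (2 * (M + n + 1)); linear_combination (1 - q ^ (M + n + 1) * σ) * h
  have hQ : q ^ n ≠ 0 := pow_ne_zero _ hq0
  have hQ' : q ^ M ≠ 0 := pow_ne_zero _ hq0
  rw [stepMid, expWeight_succ ha hc hq0 hq1 hσ0 hσ, stepRatio, expDen]
  rw [show q ^ M * q ^ (n + 1) = q * q ^ (M + n) by ring]
  generalize 1 + (q * q ^ (M + n)) ^ 2 * (σ ^ 2 * c ^ 2 / ρ)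
          - q * q ^ (M + n) * (σ * c / ρ) * recMid a c ρ σ q (q ^ M) = B
  rw [show q * (q * q ^ (M + n)) = q ^ 2 * q ^ (M + n) by ring]
  rw [show 1 - q ^ (M + n + 2) * (σ ^ 2 * (a * c) / ρ)
    = 1 - q ^ 2 * q ^ (M + n) * (σ ^ 2 * (a * c) / ρ) by ring] at n3
  rw [show 1 + q ^ (M + n + 1) * (σ * c / a) = 1 + q * q ^ (M + n) * (σ * c / a) by ring] at n4
  rw [show 1 - q ^ (2 + n + 2 * M) * σ ^ 2 = 1 - q ^ 2 * q ^ n * (q ^ M) ^ 2 * σ ^ 2 by ring] at n5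
  rw [show 1 - q ^ (M + n + 1) = 1 - q * q ^ (M + n) by ring] at n2
  rw [show 1 + q ^ (M + n + 1) * σ = 1 + q * q ^ (M + n) * σ by ring] at n6
  rw [show 1 - q * q ^ (n + 1) * (q ^ M) ^ 2 * σ ^ 2
    = 1 - q ^ 2 * q ^ n * (q ^ M) ^ 2 * σ ^ 2 by ring]
  rw [show q * q ^ n * q ^ M * (σ * c / a) = q * q ^ (M + n) * (σ * c / a) by ring,
    show 1 - (q * q ^ n * q ^ M * σ) ^ 2
      = (1 - q * q ^ (M + n) * σ) * (1 + q * q ^ (M + n) * σ) by ring,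
    show q ^ n * q ^ M = q ^ (M + n) by ring, show q * q ^ n = q ^ (n + 1) by ring]
  have hQ'' : q ^ (M + n) ≠ 0 := pow_ne_zero _ hq0
  generalize q ^ (M + n) = Z at *
  generalize 1 - q ^ 2 * Z * (σ ^ 2 * (a * c) / ρ) = D3 at *
  generalize 1 + q * Z * (σ * c / a) = D4 at *
  generalize 1 - q ^ 2 * q ^ n * (q ^ M) ^ 2 * σ ^ 2 = D5 at *
  generalize 1 - q * Z = D2 at *
  generalize 1 + q * Z * σ = D6 at *
  generalize 1 - q ^ (n + 1) = D1 at *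
  field_simp

theorem stepMid_zero (ρ a c q σ : ℂ) (M : ℕ) : stepMid ρ a c q σ M 0 = 0 := by simp [stepMid]

theorem stepUp_zero (ρ a c q σ : ℂ) (n : ℕ) : stepUp ρ a c q σ 0 n = 0 := by simp [stepUp]

theorem stepDown_zero (ρ a c q σ : ℂ) (M : ℕ) : stepDown ρ a c q σ M 0 = 0 := by simp [stepDown]

theorem stepDown_one (ρ a c q σ : ℂ) (M : ℕ) : stepDown ρ a c q σ M 1 = 0 := by simp [stepDown]

theorem stepUp_succ {a c ρ q σ : ℂ} (ha : a ≠ 0) (hc : c ≠ 0) (hρ : ρ ≠ 0)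
    (hq0 : q ≠ 0) (hq1 : ‖q‖ < 1) (hσ0 : σ ≠ 0) (hσ : ∀ j : ℕ, 1 - q ^ j * σ ^ 2 ≠ 0)
    (hs1 : ∀ j : ℕ, 1 - q ^ j * (σ * (a * c)) ≠ 0)
    (hca : ∀ j : ℕ, 1 + q ^ j * (σ * c / a) ≠ 0)
    (hne : ∀ j : ℕ, 1 - q ^ j * (σ ^ 2 * (a * c) / ρ) ≠ 0) (M n : ℕ) :
    stepUp ρ a c q σ (M + 1) n
      = -(stepRatio ρ a c q σ (q ^ (M + n)) * (q * q ^ (M + n) * (σ * c / ρ))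
          * recUp ρ σ q (q ^ M) * expWeight ρ a c q σ M n) := by
  have n2 := one_sub_pow_succ_ne_zero hq1 (M + n)
  have n3 := hne (M + n + 2)
  have n4 := hca (M + n + 1)
  have n5 := hσ (2 + n + 2 * M)
  have n6 : 1 + q ^ (M + n + 1) * σ ≠ 0 := by
    intro h; apply hσ (2 * (M + n + 1)); linear_combination (1 - q ^ (M + n + 1) * σ) * h
  have n7 : 1 - q * σ * q ^ M ≠ 0 := by
    intro h; apply hσ (2 * M + 2); linear_combination (1 + q * σ * q ^ M) * h
  have n8 := hσ (2 * M + 1)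
  have n9 := hσ (2 * M + 3)
  have n10 := hne (M + 2)
  have n11 := hca (M + 1)
  have n12 := hσ (2 * M + 3 + n)
  have hQ : q ^ n ≠ 0 := pow_ne_zero _ hq0
  have hQ' : q ^ M ≠ 0 := pow_ne_zero _ hq0
  have hZ : q ^ (M + n) ≠ 0 := pow_ne_zero _ hq0
  rw [stepUp, expWeight_up ha hc hq0 hq1 hσ0 hσ hs1 hca hne, stepRatio, expDen, recUp]
  rw [show q ^ (M + 1) * q ^ n = q * q ^ (M + n) by ring,
    show q * (q * q ^ (M + n)) = q ^ 2 * q ^ (M + n) by ring,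
    show q * q ^ (M + 1) = q ^ 2 * q ^ M by ring,
    show q ^ (M + 1) * (σ * c / a) = q * q ^ M * (σ * c / a) by ring,
    show 1 - q ^ n * (q ^ (M + 1)) ^ 2 * σ ^ 2
      = 1 - q ^ 2 * q ^ n * (q ^ M) ^ 2 * σ ^ 2 by ring,
    show 1 - q * q ^ n * (q ^ (M + 1)) ^ 2 * σ ^ 2
      = 1 - q ^ 3 * q ^ n * (q ^ M) ^ 2 * σ ^ 2 by ring,
    show σ * q ^ (M + 1) = q * σ * q ^ M by ring,
    show 1 - q * (q ^ (M + 1)) ^ 2 * σ ^ 2 = 1 - q ^ 3 * (q ^ M) ^ 2 * σ ^ 2 by ring,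
    show 1 - q ^ (M + 1) = 1 - q * q ^ M by ring,
    show q * q ^ n * q ^ M = q * q ^ (M + n) by ring,
    show 1 - (q * q ^ (M + n) * σ) ^ 2
      = (1 - q * q ^ (M + n) * σ) * (1 + q * q ^ (M + n) * σ) by ring,
    show q ^ n * q ^ M = q ^ (M + n) by ring,
    show q * σ * q ^ M = q * q ^ M * σ by ring]
  rw [show 1 - q ^ (M + n + 2) * (σ ^ 2 * (a * c) / ρ)
    = 1 - q ^ 2 * q ^ (M + n) * (σ ^ 2 * (a * c) / ρ) by ring] at n3
  rw [show 1 + q ^ (M + n + 1) * (σ * c / a) = 1 + q * q ^ (M + n) * (σ * c / a) by ring] at n4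
  rw [show 1 - q ^ (2 + n + 2 * M) * σ ^ 2 = 1 - q ^ 2 * q ^ n * (q ^ M) ^ 2 * σ ^ 2 by ring] at n5
  rw [show 1 - q ^ (M + n + 1) = 1 - q * q ^ (M + n) by ring] at n2
  rw [show 1 + q ^ (M + n + 1) * σ = 1 + q * q ^ (M + n) * σ by ring] at n6
  rw [show q * σ * q ^ M = q * q ^ M * σ by ring] at n7
  rw [show 1 - q ^ (2 * M + 1) * σ ^ 2 = 1 - q * (q ^ M) ^ 2 * σ ^ 2 by ring] at n8
  rw [show 1 - q ^ (2 * M + 3) * σ ^ 2 = 1 - q ^ 3 * (q ^ M) ^ 2 * σ ^ 2 by ring] at n9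
  rw [show 1 - q ^ (M + 2) * (σ ^ 2 * (a * c) / ρ)
    = 1 - q ^ 2 * q ^ M * (σ ^ 2 * (a * c) / ρ) by ring] at n10
  rw [show 1 + q ^ (M + 1) * (σ * c / a) = 1 + q * q ^ M * (σ * c / a) by ring] at n11
  rw [show 1 - q ^ (2 * M + 3 + n) * σ ^ 2
    = 1 - q ^ 3 * q ^ n * (q ^ M) ^ 2 * σ ^ 2 by ring] at n12
  clear hσ hs1 hca hne
  generalize q ^ (M + n) = Z at *
  generalize 1 - q ^ 2 * Z * (σ ^ 2 * (a * c) / ρ) = D3 at *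
  generalize 1 + q * Z * (σ * c / a) = D4 at *
  generalize 1 - q ^ 2 * q ^ n * (q ^ M) ^ 2 * σ ^ 2 = D5 at *
  generalize 1 - q * Z * σ = Y1 at *
  generalize 1 - Z * (σ * (a * c)) = Y2 at *
  generalize 1 - q * Z = D2 at *
  generalize 1 + q * Z * σ = D6 at *
  generalize 1 - q * q ^ M * σ = D7 at *
  generalize 1 - q * (q ^ M) ^ 2 * σ ^ 2 = D8 at *
  generalize 1 - q ^ 3 * (q ^ M) ^ 2 * σ ^ 2 = D9 at *
  generalize 1 - q ^ 2 * q ^ M * (σ ^ 2 * (a * c) / ρ) = D10 at *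
  generalize 1 + q * q ^ M * (σ * c / a) = D11 at *
  generalize 1 - q ^ 3 * q ^ n * (q ^ M) ^ 2 * σ ^ 2 = D12 at *
  generalize q ^ n = T at *
  generalize q ^ M = Q at *
  generalize 1 - q * Q * σ ^ 2 = Y3 at *
  generalize expWeight ρ a c q σ M n = W at *
  generalize 1 - q * Q = Y4 at *
  generalize 1 + q * Q * σ = Y5 at *
  field_simp

theorem stepDown_succ {a c ρ q σ : ℂ} (ha : a ≠ 0) (hc : c ≠ 0) (hρ : ρ ≠ 0)
    (hq0 : q ≠ 0) (hq1 : ‖q‖ < 1) (hσ0 : σ ≠ 0) (hσ : ∀ j : ℕ, 1 - q ^ j * σ ^ 2 ≠ 0)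
    (hs1 : ∀ j : ℕ, 1 - q ^ j * (σ * (a * c)) ≠ 0)
    (hca : ∀ j : ℕ, 1 + q ^ j * (σ * c / a) ≠ 0)
    (hne : ∀ j : ℕ, 1 - q ^ j * (σ ^ 2 * (a * c) / ρ) ≠ 0) (M n : ℕ) :
    stepDown ρ a c q σ M (n + 2)
      = -(stepRatio ρ a c q σ (q ^ (M + 1 + n)) * (q * q ^ (M + 1 + n) * (σ * c / ρ))
          * recDown a c ρ σ q (q ^ (M + 1)) * expWeight ρ a c q σ (M + 1) n) := by
  have n1 := one_sub_pow_succ_ne_zero hq1 n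
  have n1' := one_sub_pow_succ_ne_zero hq1 (n + 1)
  have n2 := one_sub_pow_succ_ne_zero hq1 (M + n + 1)
  have n3 := hne (M + n + 3)
  have n4 := hca (M + n + 2)
  have n5 := hσ (2 + n + 2 * M)
  have n6 : 1 + q ^ (M + n + 2) * σ ≠ 0 := by
    intro h; apply hσ (2 * (M + n + 2)); linear_combination (1 - q ^ (M + n + 2) * σ) * h
  have n7 : 1 - q * q ^ M * σ ≠ 0 := by
    intro h; apply hσ (2 * M + 2); linear_combination (1 + q * σ * q ^ M) * h
  have n7' : 1 + q * q ^ M * σ ≠ 0 := by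
    intro h; apply hσ (2 * M + 2); linear_combination (1 - q * σ * q ^ M) * h
  have n8 := hσ (2 * M + 1)
  have n9 := hσ (2 * M + 3)
  have n10 := hne (M + 2)
  have n11 := hca (M + 1)
  have n12 := hσ (2 * M + 3 + n)
  have hQ : q ^ n ≠ 0 := pow_ne_zero _ hq0
  have hQ' : q ^ M ≠ 0 := pow_ne_zero _ hq0
  have hZ : q ^ (M + n) ≠ 0 := pow_ne_zero _ hq0
  rw [stepDown, expWeight_up ha hc hq0 hq1 hσ0 hσ hs1 hca hne,
    expWeight_succ ha hc hq0 hq1 hσ0 hσ, expWeight_succ ha hc hq0 hq1 hσ0 hσ, stepRatio, expDen,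
    recDown]
  rw [show q ^ M * q ^ (n + 2) = q ^ 2 * q ^ (M + n) by ring,
    show q * (q ^ 2 * q ^ (M + n)) = q ^ 3 * q ^ (M + n) by ring,
    show q * q ^ (n + 1) * q ^ M = q ^ 2 * q ^ (M + n) by ring,
    show q ^ (n + 1) * q ^ M = q * q ^ (M + n) by ring,
    show q ^ (M + 1 + n) = q * q ^ (M + n) by ring,
    show q * (q * q ^ (M + n)) = q ^ 2 * q ^ (M + n) by ring,
    show q ^ 2 * (q * q ^ (M + n)) = q ^ 3 * q ^ (M + n) by ring,
    show q * q ^ n * q ^ M = q * q ^ (M + n) by ring,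
    show q ^ n * q ^ M = q ^ (M + n) by ring,
    show q * q ^ (M + 1) * σ ^ 2 * (a * c) / ρ
      = q ^ 2 * q ^ M * (σ ^ 2 * (a * c) / ρ) by ring,
    show q ^ (M + 1) * σ * c / a = q * q ^ M * (σ * c / a) by ring,
    show q ^ (M + 1) * σ * a / c = q * q ^ M * (σ * a / c) by ring,
    show ρ * q ^ (M + 1) / (q * (a * c)) = ρ * q ^ M / (a * c) by rw [pow_succ]; field_simp,
    show 1 - σ * q ^ (M + 1) = 1 - q * q ^ M * σ by ring,
    show 1 + σ * q ^ (M + 1) = 1 + q * q ^ M * σ by ring,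
    show 1 - q * (q ^ (M + 1)) ^ 2 * σ ^ 2 = 1 - q ^ 3 * (q ^ M) ^ 2 * σ ^ 2 by ring,
    show q * σ * q ^ M = q * q ^ M * σ by ring,
    show 1 - (q ^ 2 * q ^ (M + n) * σ) ^ 2
      = (1 - q ^ 2 * q ^ (M + n) * σ) * (1 + q ^ 2 * q ^ (M + n) * σ) by ring,
    show 1 - q ^ 2 * q ^ (n + 1) * (q ^ M) ^ 2 * σ ^ 2
      = 1 - q ^ 3 * q ^ n * (q ^ M) ^ 2 * σ ^ 2 by ring,
    show q * q ^ (n + 1) = q ^ (n + 1 + 1) by ring,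
    show q - q ^ (n + 2) = q * (1 - q ^ (n + 1)) by ring,
    show q * q ^ n = q ^ (n + 1) by ring,
    show q ^ (n + 2) = q ^ (n + 1 + 1) by ring]
  rw [show 1 - q ^ (M + n + 3) * (σ ^ 2 * (a * c) / ρ)
    = 1 - q ^ 3 * q ^ (M + n) * (σ ^ 2 * (a * c) / ρ) by ring] at n3
  rw [show 1 + q ^ (M + n + 2) * (σ * c / a) = 1 + q ^ 2 * q ^ (M + n) * (σ * c / a) by ring] at n4
  rw [show 1 - q ^ (2 + n + 2 * M) * σ ^ 2 = 1 - q ^ 2 * q ^ n * (q ^ M) ^ 2 * σ ^ 2 by ring] at n5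
  rw [show 1 - q ^ (M + n + 1 + 1) = 1 - q ^ 2 * q ^ (M + n) by ring] at n2
  rw [show 1 + q ^ (M + n + 2) * σ = 1 + q ^ 2 * q ^ (M + n) * σ by ring] at n6
  rw [show 1 - q ^ (2 * M + 1) * σ ^ 2 = 1 - q * (q ^ M) ^ 2 * σ ^ 2 by ring] at n8
  rw [show 1 - q ^ (2 * M + 3) * σ ^ 2 = 1 - q ^ 3 * (q ^ M) ^ 2 * σ ^ 2 by ring] at n9
  rw [show 1 - q ^ (M + 2) * (σ ^ 2 * (a * c) / ρ)
    = 1 - q ^ 2 * q ^ M * (σ ^ 2 * (a * c) / ρ) by ring] at n10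
  rw [show 1 + q ^ (M + 1) * (σ * c / a) = 1 + q * q ^ M * (σ * c / a) by ring] at n11
  rw [show 1 - q ^ (2 * M + 3 + n) * σ ^ 2
    = 1 - q ^ 3 * q ^ n * (q ^ M) ^ 2 * σ ^ 2 by ring] at n12
  clear hσ hs1 hca hne
  have hT : q ^ (n + 1 + 1) = q ^ 2 * q ^ n := by ring
  have hZT : q ^ (M + n) = q ^ M * q ^ n := by ring
  generalize hD1 : 1 - q ^ (n + 1 + 1) = D1 at *
  rw [hT] at *
  generalize q ^ (M + n) = Z at *
  generalize 1 - q ^ 3 * Z * (σ ^ 2 * (a * c) / ρ) = D3 at *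
  generalize 1 + q ^ 2 * Z * (σ * c / a) = D4 at *
  generalize 1 + q * Z * (σ * c / a) = Y7 at *
  generalize 1 - q ^ 2 * q ^ n * (q ^ M) ^ 2 * σ ^ 2 = D5 at *
  generalize 1 - q ^ 2 * Z * σ = Y1 at *
  generalize 1 - Z * (σ * (a * c)) = Y2 at *
  generalize 1 - q * Z * (σ * (a * c)) = Y8 at *
  generalize 1 - q ^ 2 * Z = D2 at *
  generalize 1 + q ^ 2 * Z * σ = D6 at *
  generalize 1 - (q * Z * σ) ^ 2 = Y9 at *
  generalize 1 - q * q ^ M * σ = D7 at *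
  generalize 1 - q * (q ^ M) ^ 2 * σ ^ 2 = D8 at *
  generalize 1 - q ^ 3 * (q ^ M) ^ 2 * σ ^ 2 = D9 at *
  generalize 1 - q ^ 2 * q ^ M * (σ ^ 2 * (a * c) / ρ) = D10 at *
  generalize 1 + q * q ^ M * (σ * c / a) = D11 at *
  generalize 1 + q * q ^ M * (σ * a / c) = Y10 at *
  generalize 1 - ρ * q ^ M / (a * c) = Y11 at *
  generalize 1 - q ^ 3 * q ^ n * (q ^ M) ^ 2 * σ ^ 2 = D12 at *
  generalize 1 - q ^ (n + 1) = D13 at *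
  generalize q ^ n = T at *
  generalize q ^ M = Q at *
  generalize 1 - q * Q * σ ^ 2 = Y3 at *
  generalize 1 + q * Q * σ = Y5 at *
  generalize expWeight ρ a c q σ M n = W at *
  subst hZT
  field_simp

/-- The recursion for `expWeight` off the corner `M = n = 0`. -/
theorem expWeight_eq_step {a c ρ q σ : ℂ} (ha : a ≠ 0) (hc : c ≠ 0) (hρ : ρ ≠ 0)
    (hq1 : ‖q‖ < 1) (hσ : ∀ j : ℕ, 1 - q ^ j * σ ^ 2 ≠ 0)
    (hca : ∀ j : ℕ, 1 + q ^ j * (σ * c / a) ≠ 0)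
    (hne : ∀ j : ℕ, 1 - q ^ j * (σ ^ 2 * (a * c) / ρ) ≠ 0) {M n N : ℕ} (hN : M + n = N + 1) :
    expWeight ρ a c q σ M n
      = stepMid ρ a c q σ M n + stepUp ρ a c q σ M n + stepDown ρ a c q σ M n := by
  have n1 : 1 - q * (q ^ M) ^ 2 * σ ^ 2 ≠ 0 := by
    intro h; apply hσ (2 * M + 1); linear_combination h
  have n2 : 1 - q * σ * q ^ M ≠ 0 := by
    intro h; apply hσ (2 * M + 2); linear_combination (1 + q * σ * q ^ M) * h
  have n4 : 1 - σ * q ^ M ≠ 0 := by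
    intro h; apply hσ (2 * M); linear_combination (1 + σ * q ^ M) * h
  have hD : expDen ρ a c q σ (q ^ M * q ^ n) ≠ 0 := by
    have e1 := one_sub_pow_succ_ne_zero hq1 N
    have e2 := hne (N + 2)
    have e3 := hca (N + 1)
    have e4 : 1 + q ^ (N + 1) * σ ≠ 0 := by
      intro h; apply hσ (2 * (N + 1)); linear_combination (1 - q ^ (N + 1) * σ) * h
    rw [pow_succ'] at e2
    rw [expDen, ← pow_add, hN]
    exact mul_ne_zero (mul_ne_zero (mul_ne_zero e1 e2) e3) e4
  have key := expansion_identity (R := q ^ n) ha hc hρ n1 n2 n4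
  rw [stepMid, stepUp, stepDown, ← add_mul, ← add_mul, ← add_div, ← add_div, ← key]
  rw [show q ^ n * q ^ M = q ^ M * q ^ n by ring]
  change _ = expDen ρ a c q σ (q ^ M * q ^ n) / expDen ρ a c q σ (q ^ M * q ^ n) * _
  rw [div_self hD, one_mul]

/-- The coefficients of the eigenseries over the bidiagonal basis, expanded in the coefficients
for the parameters `a, -a, c, -c`. For fixed `bd` both sides are polynomials in `b + d`, the
right-hand side being a sum over the Askey-Wilson polynomials `oddConv`. -/
theorem sum_oddConv_mul_expWeight {a b c d q σ : ℂ} (ha : a ≠ 0) (hb : b ≠ 0) (hc : c ≠ 0)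
    (hd : d ≠ 0) (hq0 : q ≠ 0) (hq1 : ‖q‖ < 1) (hσ0 : σ ≠ 0)
    (hσ : ∀ j : ℕ, 1 - q ^ j * σ ^ 2 ≠ 0)
    (hs1 : ∀ j : ℕ, 1 - q ^ j * (σ * (a * c)) ≠ 0)
    (hca : ∀ j : ℕ, 1 + q ^ j * (σ * c / a) ≠ 0)
    (hne : ∀ j : ℕ, 1 - q ^ j * (σ ^ 2 * (a * c) / (b * d)) ≠ 0) (N : ℕ) :
    ∑ p ∈ Finset.HasAntidiagonal.antidiagonal N,
        oddConv a b c d q σ p.1 * expWeight (b * d) a c q σ p.1 p.2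
      = basisCoeff a b c d q (σ * (a * c)) N := by
  have hρ : b * d ≠ 0 := mul_ne_zero hb hd
  induction N with
  | zero => simp [oddConv_zero, expWeight, oddWeight]
  | succ N ih =>
    have e0 : ∀ p ∈ Finset.HasAntidiagonal.antidiagonal (N + 1),
        oddConv a b c d q σ p.1 * expWeight (b * d) a c q σ p.1 p.2
          = oddConv a b c d q σ p.1 * stepMid (b * d) a c q σ p.1 p.2
            + oddConv a b c d q σ p.1 * stepUp (b * d) a c q σ p.1 p.2
            + oddConv a b c d q σ p.1 * stepDown (b * d) a c q σ p.1 p.2 := fun p hp => by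
      rw [expWeight_eq_step ha hc hρ hq1 hσ hca hne
        (Finset.HasAntidiagonal.mem_antidiagonal.mp hp)]
      ring
    rw [Finset.sum_congr rfl e0, Finset.sum_add_distrib, Finset.sum_add_distrib]
    set t : ℂ := q * q ^ N * (σ * c / (b * d)) with ht
    set r : ℂ := stepRatio (b * d) a c q σ (q ^ N) with hr
    -- After a shift of indices, the three parts of the recursion turn the sum at `N + 1` into the
    -- sum at `N` with `oddConv` replaced by the right-hand side of its three-term recurrence.
    have s1 : ∑ p ∈ Finset.HasAntidiagonal.antidiagonal (N + 1),
          oddConv a b c d q σ p.1 * stepMid (b * d) a c q σ p.1 p.2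
        = ∑ p ∈ Finset.HasAntidiagonal.antidiagonal N, oddConv a b c d q σ p.1
          * (r * (1 + (q * q ^ N) ^ 2 * (σ ^ 2 * c ^ 2 / (b * d))
            - t * recMid a c (b * d) σ q (q ^ p.1)) * expWeight (b * d) a c q σ p.1 p.2) := by
      rw [Finset.Nat.sum_antidiagonal_succ', stepMid_zero, mul_zero, zero_add]
      refine Finset.sum_congr rfl fun p hp => ?_
      rw [stepMid_succ ha hc hq0 hq1 hσ0 hσ hca hne, Finset.HasAntidiagonal.mem_antidiagonal.mp hp]
    have s2 : ∑ p ∈ Finset.HasAntidiagonal.antidiagonal (N + 1),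
          oddConv a b c d q σ p.1 * stepUp (b * d) a c q σ p.1 p.2
        = ∑ p ∈ Finset.HasAntidiagonal.antidiagonal N, oddConv a b c d q σ (p.1 + 1)
          * (-(r * t * recUp (b * d) σ q (q ^ p.1) * expWeight (b * d) a c q σ p.1 p.2)) := by
      rw [Finset.Nat.sum_antidiagonal_succ, stepUp_zero, mul_zero, zero_add]
      refine Finset.sum_congr rfl fun p hp => ?_
      rw [stepUp_succ ha hc hρ hq0 hq1 hσ0 hσ hs1 hca hne,
        Finset.HasAntidiagonal.mem_antidiagonal.mp hp]
    have s3 : ∑ p ∈ Finset.HasAntidiagonal.antidiagonal (N + 1),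
          oddConv a b c d q σ p.1 * stepDown (b * d) a c q σ p.1 p.2
        = ∑ p ∈ Finset.HasAntidiagonal.antidiagonal N, oddConvPred a b c d q σ p.1
          * (-(r * t * recDown a c (b * d) σ q (q ^ p.1) * expWeight (b * d) a c q σ p.1 p.2)) := by
      rw [Finset.Nat.sum_antidiagonal_succ', stepDown_zero, mul_zero, zero_add]
      rcases N with _ | N
      · simp [stepDown_one, oddConvPred]
      rw [Finset.Nat.sum_antidiagonal_succ', Finset.Nat.sum_antidiagonal_succ]
      simp only [zero_add, stepDown_one, mul_zero, oddConvPred, zero_mul]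
      refine Finset.sum_congr rfl fun p hp => ?_
      rw [show p.2 + 1 + 1 = p.2 + 2 from rfl,
        stepDown_succ ha hc hρ hq0 hq1 hσ0 hσ hs1 hca hne,
        show p.1 + 1 + p.2 = N + 1 by have := Finset.HasAntidiagonal.mem_antidiagonal.mp hp; omega]
    rw [s1, s2, s3, ← Finset.sum_add_distrib, ← Finset.sum_add_distrib, basisCoeff_succ,
      basisRatio_eq_stepRatio ha hb hc hd hq0 hq1 hσ0 hne, ← ih, Finset.sum_mul]
    refine Finset.sum_congr rfl fun p _ => ?_
    have h3 := oddConv_three_term ha hb hc hd hq0 hq1 hσ0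
      (fun j h => hσ j (by rw [h, sub_self])) p.1
    rw [← ht, ← hr]
    linear_combination (r * t * expWeight (b * d) a c q σ p.1 p.2) * h3

/-! ### Summation over the even coefficients -/

/-- The part of the even coefficient `cEven a c q k l s` that does not involve `k`. -/
noncomputable def evenWeight (a c q s : ℂ) (l : ℕ) : ℂ :=
  ((qPoch (c ^ 2 / q) (q ^ 2) l * qPoch (s ^ 2 / a ^ 2) (q ^ 2) l)
    / (qPoch (q ^ 2) (q ^ 2) l * qPoch (q ^ 3 * s ^ 2 / (a ^ 2 * c ^ 2)) (q ^ 2) l))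
  * ((qPoch s q (2 * l) * qPoch (q ^ 2 * s ^ 2 / a ^ 4) (q ^ 2) (2 * l))
    / (qPoch (q * s / a ^ 2) q (2 * l) * qPoch (s ^ 2 / a ^ 2) (q ^ 2) (2 * l)))
    * (q ^ 2 / c ^ 2) ^ l

theorem cEven_eq (a c q s : ℂ) (k l : ℕ) :
    cEven a c q k l s = evenWeight a c q s l * rogersCoeff a q (q ^ (2 * l) * s) k := by
  have e1 : q ^ (4 * l) * s ^ 2 = (q ^ (2 * l) * s) ^ 2 := by ring
  have e2 : q ^ (4 * l) * q ^ 2 * s ^ 2 / a ^ 2 = q ^ 2 * (q ^ (2 * l) * s) ^ 2 / a ^ 2 := by ring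
  rw [cEven, evenWeight, rogersCoeff, e1, e2]
  ring

/-- The ratio of consecutive values of `evenWeight`, with `σ = s / ac`. -/
theorem evenWeight_succ {a c q σ : ℂ} (ha : a ≠ 0) (hc : c ≠ 0) (hq1 : ‖q‖ < 1)
    (hσ : ∀ j : ℕ, 1 - q ^ j * σ ^ 2 ≠ 0)
    (he : ∀ j : ℕ, 1 - q ^ j * (σ ^ 2 * c ^ 2) ≠ 0)
    (hca' : ∀ j : ℕ, 1 - q ^ j * (σ * c / a) ≠ 0) (l : ℕ) :
    evenWeight a c q (σ * (a * c)) (l + 1)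
      = evenWeight a c q (σ * (a * c)) l
        * ((1 - q ^ (2 * l) * (c ^ 2 / q)) * (1 - q ^ (2 * l) * (σ ^ 2 * c ^ 2))
          * (1 - q ^ (2 * l) * (σ * (a * c))) * (1 - q * q ^ (2 * l) * (σ * (a * c)))
          * (1 + q * q ^ (2 * l) * (σ * c / a)) * (1 + q ^ 2 * q ^ (2 * l) * (σ * c / a)) * q ^ 2)
        / ((1 - q ^ 2 * q ^ (2 * l)) * (1 - q ^ 3 * q ^ (2 * l) * σ ^ 2)
          * (1 - (q ^ (2 * l)) ^ 2 * (σ ^ 2 * c ^ 2))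
          * (1 - q ^ 2 * (q ^ (2 * l)) ^ 2 * (σ ^ 2 * c ^ 2)) * c ^ 2) := by
  have p1 (i : ℕ) : 1 - (q ^ 2) ^ i * q ^ 2 ≠ 0 := by
    have := one_sub_pow_succ_ne_zero hq1 (2 * i + 1)
    rwa [← pow_mul, ← pow_add]
  have p2 (i : ℕ) : 1 - (q ^ 2) ^ i * (q ^ 3 * σ ^ 2) ≠ 0 := by
    have := hσ (2 * i + 3); rwa [pow_add, pow_mul, mul_assoc] at this
  have p3 (i : ℕ) : 1 - q ^ i * (q * (σ * c / a)) ≠ 0 := by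
    have := hca' (i + 1); rwa [pow_succ, mul_assoc] at this
  have p4 (i : ℕ) : 1 - (q ^ 2) ^ i * (σ ^ 2 * c ^ 2) ≠ 0 := by
    have := he (2 * i); rwa [pow_mul] at this
  have a1 : (σ * (a * c)) ^ 2 / a ^ 2 = σ ^ 2 * c ^ 2 := by field_simp
  have a2 : q ^ 3 * (σ * (a * c)) ^ 2 / (a ^ 2 * c ^ 2) = q ^ 3 * σ ^ 2 := by field_simp
  have a3 : q ^ 2 * (σ * (a * c)) ^ 2 / a ^ 4 = q ^ 2 * (σ * c / a) ^ 2 := by field_simp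
  have a4 : q * (σ * (a * c)) / a ^ 2 = q * (σ * c / a) := by field_simp
  unfold evenWeight
  rw [a1, a2, a3, a4, show 2 * (l + 1) = 2 * l + 1 + 1 by ring]
  simp only [qPoch_succ]
  have m1 := qPoch_ne_zero p1 l
  have m2 := qPoch_ne_zero p2 l
  have m3 := qPoch_ne_zero p3 (2 * l)
  have m4 := qPoch_ne_zero p4 (2 * l)
  have t1 := p1 l
  have t2 := p2 l
  have t3 := p3 (2 * l)
  have t4 := p3 (2 * l + 1)
  have t5 := p4 (2 * l)
  have t6 := p4 (2 * l + 1)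
  rw [show (1 : ℂ) - (q ^ 2) ^ (2 * l) * (q ^ 2 * (σ * c / a) ^ 2)
      = (1 - q ^ (2 * l) * (q * (σ * c / a))) * (1 + q * q ^ (2 * l) * (σ * c / a)) by ring,
    show (1 : ℂ) - (q ^ 2) ^ (2 * l + 1) * (q ^ 2 * (σ * c / a) ^ 2)
      = (1 - q ^ (2 * l + 1) * (q * (σ * c / a))) * (1 + q ^ 2 * q ^ (2 * l) * (σ * c / a)) by ring,
    show 1 - q ^ 2 * q ^ (2 * l) = 1 - (q ^ 2) ^ l * q ^ 2 by ring,
    show 1 - q ^ 3 * q ^ (2 * l) * σ ^ 2 = 1 - (q ^ 2) ^ l * (q ^ 3 * σ ^ 2) by ring,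
    show 1 - (q ^ (2 * l)) ^ 2 * (σ ^ 2 * c ^ 2) = 1 - (q ^ 2) ^ (2 * l) * (σ ^ 2 * c ^ 2) by ring,
    show 1 - q ^ 2 * (q ^ (2 * l)) ^ 2 * (σ ^ 2 * c ^ 2)
      = 1 - (q ^ 2) ^ (2 * l + 1) * (σ ^ 2 * c ^ 2) by ring,
    show q ^ (2 * l + 1) * (σ * (a * c)) = q * q ^ (2 * l) * (σ * (a * c)) by ring,
    show (q ^ 2) ^ l * (c ^ 2 / q) = q ^ (2 * l) * (c ^ 2 / q) by ring,
    show (q ^ 2) ^ l * (σ ^ 2 * c ^ 2) = q ^ (2 * l) * (σ ^ 2 * c ^ 2) by ring,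
    pow_succ (q ^ 2 / c ^ 2)]
  clear p1 p2 p3 p4 hσ he hca' a1 a2 a3 a4
  generalize 1 - (q ^ 2) ^ l * q ^ 2 = D1 at *
  generalize 1 - (q ^ 2) ^ l * (q ^ 3 * σ ^ 2) = D2 at *
  generalize 1 - q ^ (2 * l) * (q * (σ * c / a)) = D3 at *
  generalize 1 - q ^ (2 * l + 1) * (q * (σ * c / a)) = D4 at *
  generalize 1 - (q ^ 2) ^ (2 * l) * (σ ^ 2 * c ^ 2) = D5 at *
  generalize 1 - (q ^ 2) ^ (2 * l + 1) * (σ ^ 2 * c ^ 2) = D6 at *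
  generalize 1 + q * q ^ (2 * l) * (σ * c / a) = Y1 at *
  generalize 1 + q ^ 2 * q ^ (2 * l) * (σ * c / a) = Y2 at *
  generalize 1 - q ^ (2 * l) * (c ^ 2 / q) = Y3 at *
  generalize 1 - q ^ (2 * l) * (σ ^ 2 * c ^ 2) = Y4 at *
  generalize 1 - q * q ^ (2 * l) * (σ * (a * c)) = Y5 at *
  generalize 1 - q ^ (2 * l) * (σ * (a * c)) = Y6 at *
  generalize (q ^ 2 / c ^ 2) ^ l = Y7 at *
  generalize qPoch (c ^ 2 / q) (q ^ 2) l = K1 at *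
  generalize qPoch (σ ^ 2 * c ^ 2) (q ^ 2) l = K2 at *
  generalize qPoch (q ^ 2) (q ^ 2) l = K3 at *
  generalize qPoch (q ^ 3 * σ ^ 2) (q ^ 2) l = K4 at *
  generalize qPoch (σ * (a * c)) q (2 * l) = K5 at *
  generalize qPoch (q ^ 2 * (σ * c / a) ^ 2) (q ^ 2) (2 * l) = K6 at *
  generalize qPoch (q * (σ * c / a)) q (2 * l) = K7 at *
  generalize qPoch (σ ^ 2 * c ^ 2) (q ^ 2) (2 * l) = K8 at *
  have h : K5 * Y6 * Y5 * (K6 * (D3 * Y1) * (D4 * Y2)) / (K7 * D3 * D4 * (K8 * D5 * D6))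
      = K5 * Y6 * Y5 * (K6 * Y1 * Y2) / (K7 * (K8 * D5 * D6)) := by
    rw [show K5 * Y6 * Y5 * (K6 * (D3 * Y1) * (D4 * Y2))
        = K5 * Y6 * Y5 * (K6 * Y1 * Y2) * (D3 * D4) by ring,
      show K7 * D3 * D4 * (K8 * D5 * D6) = K7 * (K8 * D5 * D6) * (D3 * D4) by ring,
      mul_div_mul_right _ _ (mul_ne_zero t3 t4)]
  rw [h]
  ring

theorem basisRatio_rogers {a c q r σ : ℂ} (ha : a ≠ 0) (hc : c ≠ 0) (hr : r ^ 2 = q)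
    (hq0 : q ≠ 0) (hq1 : ‖q‖ < 1) (hσ0 : σ ≠ 0)
    (he : ∀ j : ℕ, 1 - q ^ j * (σ ^ 2 * c ^ 2) ≠ 0) (M n : ℕ) :
    basisRatio a (-a) r (-r) q (q ^ M * (σ * (a * c))) n
      = -((1 - q ^ n * q ^ M * (σ * (a * c))) * (1 + q * q ^ n * q ^ M * (σ * c / a))
          * (1 - q * (q ^ n) ^ 2 * (q ^ M) ^ 2 * (σ ^ 2 * c ^ 2)))
        / (q ^ n * q ^ M * (σ * c) * (1 - q * q ^ n)
          * (1 - q * q ^ n * (q ^ M) ^ 2 * (σ ^ 2 * c ^ 2))) := by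
  have h1 := one_sub_pow_succ_ne_zero hq1 n
  have h2 := he (n + 1 + 2 * M)
  have e2 : q ^ (n + 2) * (q ^ M * (σ * (a * c))) ^ 2 - a * (-a) * r * (-r)
      = -(a ^ 2 * q) * (1 - q ^ (n + 1 + 2 * M) * (σ ^ 2 * c ^ 2)) := by
    linear_combination (-a ^ 2) * hr
  have e3 : 1 - q * q ^ n * (q ^ M) ^ 2 * (σ ^ 2 * c ^ 2)
      = 1 - q ^ (n + 1 + 2 * M) * (σ ^ 2 * c ^ 2) := by ring
  have e4 : q * q ^ n = q ^ (n + 1) := by ring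
  have e5 : (q ^ n * (q ^ M * (σ * (a * c))) - 1) * (q ^ (n + 1) * (q ^ M * (σ * (a * c))) - a * -a)
      * (q ^ (n + 1) * (q ^ M * (σ * (a * c))) - a * r)
      * (q ^ (n + 1) * (q ^ M * (σ * (a * c))) - a * -r)
      = (1 - q ^ n * q ^ M * (σ * (a * c))) * (a ^ 2 * (1 + q ^ (n + 1) * q ^ M * (σ * c / a)))
        * (a ^ 2 * q * (1 - q * (q ^ n) ^ 2 * (q ^ M) ^ 2 * (σ ^ 2 * c ^ 2))) := by
    rw [show a ^ 2 * (1 + q ^ (n + 1) * q ^ M * (σ * c / a))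
      = a ^ 2 + q ^ (n + 1) * q ^ M * (σ * (a * c)) by field_simp]
    linear_combination (-a ^ 2 * (q ^ n * (q ^ M * (σ * (a * c))) - 1)
      * (q ^ (n + 1) * (q ^ M * (σ * (a * c))) - a * -a)) * hr
  have hQ : q ^ n ≠ 0 := pow_ne_zero _ hq0
  have hQ' : q ^ M ≠ 0 := pow_ne_zero _ hq0
  unfold basisRatio
  rw [e5, e2, e3, e4]
  generalize 1 - q ^ (n + 1 + 2 * M) * (σ ^ 2 * c ^ 2) = D2 at *
  generalize 1 - q ^ (n + 1) = D1 at *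
  generalize 1 - q ^ n * q ^ M * (σ * (a * c)) = Y1 at *
  generalize 1 + q ^ (n + 1) * q ^ M * (σ * c / a) = Y2 at *
  generalize 1 - q * (q ^ n) ^ 2 * (q ^ M) ^ 2 * (σ ^ 2 * c ^ 2) = Y3 at *
  generalize q ^ n = Z at *
  generalize q ^ M = Z' at *
  clear e5 e2 e3 e4 he
  field_simp

/-- Raising `s` to `q s` in `basisCoeff a (-a) √q (-√q)`. -/
theorem basisCoeff_rogers_mul_q {a c q r σ : ℂ} (ha : a ≠ 0) (hc : c ≠ 0) (hr : r ^ 2 = q)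
    (hq0 : q ≠ 0) (hq1 : ‖q‖ < 1) (hσ0 : σ ≠ 0)
    (he : ∀ j : ℕ, 1 - q ^ j * (σ ^ 2 * c ^ 2) ≠ 0)
    (hs1 : ∀ j : ℕ, 1 - q ^ j * (σ * (a * c)) ≠ 0)
    (hca : ∀ j : ℕ, 1 + q ^ j * (σ * c / a) ≠ 0) (M n : ℕ) :
    basisCoeff a (-a) r (-r) q (q * q ^ M * (σ * (a * c))) n
      = basisCoeff a (-a) r (-r) q (q ^ M * (σ * (a * c))) n
        * ((1 - q ^ n * q ^ M * (σ * (a * c))) * (1 + q * q ^ n * q ^ M * (σ * c / a))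
          * (1 - q * (q ^ n) ^ 2 * (q ^ M) ^ 2 * (σ ^ 2 * c ^ 2))
          * (1 - q ^ 2 * (q ^ M) ^ 2 * (σ ^ 2 * c ^ 2)))
        / ((1 - q ^ M * (σ * (a * c))) * (1 + q * q ^ M * (σ * c / a))
          * (1 - q * q ^ n * (q ^ M) ^ 2 * (σ ^ 2 * c ^ 2))
          * (1 - q ^ 2 * q ^ n * (q ^ M) ^ 2 * (σ ^ 2 * c ^ 2)) * q ^ n) := by
  have hQ : q ^ n ≠ 0 := pow_ne_zero _ hq0
  have hQ' : q ^ M ≠ 0 := pow_ne_zero _ hq0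
  have d2 (j : ℕ) : q ^ (j + 2) * (q ^ M * (σ * (a * c))) ^ 2 - a * -a * r * -r
      = -(a ^ 2 * q) * (1 - q ^ (j + 1 + 2 * M) * (σ ^ 2 * c ^ 2)) := by
    linear_combination (-a ^ 2) * hr
  have hne (j : ℕ) : q ^ (j + 2) * (q ^ M * (σ * (a * c))) ^ 2 ≠ a * -a * r * -r := by
    rw [← sub_ne_zero, d2]
    exact mul_ne_zero (neg_ne_zero.mpr (mul_ne_zero (pow_ne_zero 2 ha) hq0)) (he _)
  have h := basisCoeff_mul_q (b := -a) (c := r) (d := -r) ha hq0 hq1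
    (s := q ^ M * (σ * (a * c))) (mul_ne_zero hQ' (mul_ne_zero hσ0 (mul_ne_zero ha hc))) hne n
  have fac (Z : ℂ) : (Z * (q ^ M * (σ * (a * c))) - a * -a)
        * (Z * (q ^ M * (σ * (a * c))) - a * r) * (Z * (q ^ M * (σ * (a * c))) - a * -r)
      = a ^ 2 * (1 + Z * q ^ M * (σ * c / a))
        * (a ^ 2 * (Z ^ 2 * (q ^ M) ^ 2 * (σ ^ 2 * c ^ 2) - q)) := by
    rw [show a ^ 2 * (1 + Z * q ^ M * (σ * c / a))
      = a ^ 2 + Z * q ^ M * (σ * (a * c)) by field_simp]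
    linear_combination (-a ^ 2 * (Z * (q ^ M * (σ * (a * c))) - a * -a)) * hr
  have fac' (Z Y : ℂ) : Y * (Z * (q ^ M * (σ * (a * c))) - a * -a)
        * (Z * (q ^ M * (σ * (a * c))) - a * r) * (Z * (q ^ M * (σ * (a * c))) - a * -r)
      = Y * (a ^ 2 * (1 + Z * q ^ M * (σ * c / a))
        * (a ^ 2 * (Z ^ 2 * (q ^ M) ^ 2 * (σ ^ 2 * c ^ 2) - q))) := by
    rw [← fac]; ring
  have n0 := hs1 M
  have n1 : 1 + q * q ^ M * (σ * c / a) ≠ 0 := by rw [← pow_succ']; exact hca (M + 1)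
  have n2 : 1 - q * q ^ n * (q ^ M) ^ 2 * (σ ^ 2 * c ^ 2) ≠ 0 := by
    have := he (1 + n + 2 * M); rwa [pow_add, pow_add, mul_comm 2 M, pow_mul, pow_one] at this
  have n3 : 1 - q ^ 2 * q ^ n * (q ^ M) ^ 2 * (σ ^ 2 * c ^ 2) ≠ 0 := by
    have := he (2 + n + 2 * M); rwa [pow_add, pow_add, mul_comm 2 M, pow_mul] at this
  have n4 : 1 - q * (q ^ M) ^ 2 * (σ ^ 2 * c ^ 2) ≠ 0 := by
    have := he (1 + 2 * M); rwa [pow_add, mul_comm 2 M, pow_mul, pow_one] at this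
  have d2' := d2 (n + 1)
  have d0 := d2 0
  have d1 := d2 1
  rw [show n + 1 + 2 = n + 3 by ring] at d2'
  rw [show 1 + 2 = 3 by ring] at d1
  rw [zero_add] at d0
  rw [d2 n, d2', d0, d1, fac', fac', pow_succ' q n, ← mul_assoc q (q ^ M)] at h
  rw [eq_div_iff (mul_ne_zero (mul_ne_zero (mul_ne_zero (mul_ne_zero n0 n1) n2) n3) hQ)]
  generalize basisCoeff a (-a) r (-r) q (q * q ^ M * (σ * (a * c))) n = B1 at *
  generalize basisCoeff a (-a) r (-r) q (q ^ M * (σ * (a * c))) n = B0 at *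
  generalize 1 + q * q ^ M * (σ * c / a) = Y0 at *
  generalize 1 + q * q ^ n * q ^ M * (σ * c / a) = Y1 at *
  refine mul_left_cancel₀ (mul_ne_zero (mul_ne_zero (pow_ne_zero 8 ha) (pow_ne_zero 3 hq0)) n4) ?_
  linear_combination h

/-- The rational identity that certifies the summation over `l`, with `Q = q^N`, `P = q^(2 l)`,
`e = s^2 / a^2` and `u = e / c^2`. -/
theorem even_certificate {c q P Q u : ℂ} (hq0 : q ≠ 0) (hP : P ≠ 0)
    (n1 : 1 - P ^ 2 * (u * c ^ 2) ≠ 0) (n2 : 1 - q * Q ^ 2 * (u * c ^ 2) ≠ 0)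
    (n3 : 1 - q * Q ≠ 0) (n4 : 1 - q ^ 2 * Q * u ≠ 0) (n5 : 1 - q ^ 2 * P ≠ 0)
    (n6 : 1 - q ^ 3 * P * u ≠ 0) (n7 : 1 - q ^ 4 * P ^ 2 * (u * c ^ 2) ≠ 0)
    (n8 : 1 - q ^ 2 * Q * P * (u * c ^ 2) ≠ 0) (n9 : 1 - q ^ 3 * Q * P * (u * c ^ 2) ≠ 0) :
    1 - (1 - q ^ 2 * Q ^ 2 * u) * (1 - q * Q / P) * (1 - q * Q * P * (u * c ^ 2))
        / ((1 - q * Q) * (1 - q ^ 2 * Q * u) * (1 - q * Q ^ 2 * (u * c ^ 2)))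
      = -(Q / (q * P)) * (1 - q ^ 2 * P) * (1 - q ^ 3 * P * u)
          * (1 - q ^ 2 * Q * P * (u * c ^ 2)) * (1 - q ^ 3 * Q * P * (u * c ^ 2))
          / ((1 - q ^ 4 * P ^ 2 * (u * c ^ 2)) * (1 - q * Q ^ 2 * (u * c ^ 2)) * (1 - q * Q)
            * (1 - q ^ 2 * Q * u))
          * (q ^ 3 * P ^ 2 * u * (1 - P * (c ^ 2 / q)) * (1 - P * (u * c ^ 2))
            * (1 - q ^ 4 * P ^ 2 * (u * c ^ 2)) * (1 - q * Q / P) * (1 - Q / P)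
            / ((1 - q ^ 2 * P) * (1 - q ^ 3 * P * u) * (1 - P ^ 2 * (u * c ^ 2))
              * (1 - q ^ 2 * Q * P * (u * c ^ 2)) * (1 - q ^ 3 * Q * P * (u * c ^ 2))))
        - -(q * Q / P) * (1 - P) * (1 - q * P * u) * (1 - Q * P * (u * c ^ 2))
          * (1 - q * Q * P * (u * c ^ 2))
          / ((1 - P ^ 2 * (u * c ^ 2)) * (1 - q * Q ^ 2 * (u * c ^ 2)) * (1 - q * Q)
            * (1 - q ^ 2 * Q * u)) := by
  generalize e1 : 1 - P ^ 2 * (u * c ^ 2) = D1 at *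
  generalize e2 : 1 - q * Q ^ 2 * (u * c ^ 2) = D2 at *
  generalize e3 : 1 - q * Q = D3 at *
  generalize e4 : 1 - q ^ 2 * Q * u = D4 at *
  generalize 1 - q ^ 2 * P = D5 at *
  generalize 1 - q ^ 3 * P * u = D6 at *
  generalize 1 - q ^ 4 * P ^ 2 * (u * c ^ 2) = D7 at *
  generalize 1 - q ^ 2 * Q * P * (u * c ^ 2) = D8 at *
  generalize 1 - q ^ 3 * Q * P * (u * c ^ 2) = D9 at *
  field_simp
  subst e1 e2 e3 e4
  ring

/-- The summand of the expansion over `l` at total index `N`. -/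
noncomputable def evenTerm (a c r q σ : ℂ) (N l : ℕ) : ℂ :=
  if 2 * l ≤ N then evenWeight a c q (σ * (a * c)) l
    * basisCoeff a (-a) r (-r) q (q ^ (2 * l) * (σ * (a * c))) (N - 2 * l) else 0

theorem evenTerm_two_mul_add (a c r q σ : ℂ) (l n : ℕ) :
    evenTerm a c r q σ (2 * l + n) l = evenWeight a c q (σ * (a * c)) l
      * basisCoeff a (-a) r (-r) q (q ^ (2 * l) * (σ * (a * c))) n := by
  rw [evenTerm, if_pos (by omega), Nat.add_sub_cancel_left]

theorem evenTerm_of_lt {a c r q σ : ℂ} {N l : ℕ} (h : N < 2 * l) : evenTerm a c r q σ N l = 0 := by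
  rw [evenTerm, if_neg (by omega)]

/-- The ratio of consecutive summands in `l`. -/
theorem evenTerm_next {a c q r σ : ℂ} (ha : a ≠ 0) (hc : c ≠ 0) (hr : r ^ 2 = q)
    (hq0 : q ≠ 0) (hq1 : ‖q‖ < 1) (hσ0 : σ ≠ 0)
    (hσ : ∀ j : ℕ, 1 - q ^ j * σ ^ 2 ≠ 0)
    (he : ∀ j : ℕ, 1 - q ^ j * (σ ^ 2 * c ^ 2) ≠ 0)
    (hs1 : ∀ j : ℕ, 1 - q ^ j * (σ * (a * c)) ≠ 0)
    (hca : ∀ j : ℕ, 1 + q ^ j * (σ * c / a) ≠ 0)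
    (hca' : ∀ j : ℕ, 1 - q ^ j * (σ * c / a) ≠ 0) (l n : ℕ) :
    evenTerm a c r q σ (2 * l + (n + 2)) (l + 1)
      = evenTerm a c r q σ (2 * l + (n + 2)) l
        * (q ^ 3 * (q ^ (2 * l)) ^ 2 * σ ^ 2 * (1 - q ^ (2 * l) * (c ^ 2 / q))
            * (1 - q ^ (2 * l) * (σ ^ 2 * c ^ 2))
            * (1 - q ^ 4 * (q ^ (2 * l)) ^ 2 * (σ ^ 2 * c ^ 2)) * (1 - q ^ 2 * q ^ n)
            * (1 - q * q ^ n)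
          / ((1 - q ^ 2 * q ^ (2 * l)) * (1 - q ^ 3 * q ^ (2 * l) * σ ^ 2)
            * (1 - (q ^ (2 * l)) ^ 2 * (σ ^ 2 * c ^ 2))
            * (1 - q ^ 3 * q ^ n * (q ^ (2 * l)) ^ 2 * (σ ^ 2 * c ^ 2))
            * (1 - q ^ 4 * q ^ n * (q ^ (2 * l)) ^ 2 * (σ ^ 2 * c ^ 2)))) := by
  rw [show 2 * l + (n + 2) = 2 * (l + 1) + n by ring, evenTerm_two_mul_add,
    show 2 * (l + 1) + n = 2 * l + (n + 2) by ring, evenTerm_two_mul_add, basisCoeff_succ,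
    basisCoeff_succ, basisRatio_rogers ha hc hr hq0 hq1 hσ0 he,
    basisRatio_rogers ha hc hr hq0 hq1 hσ0 he, evenWeight_succ ha hc hq1 hσ he hca',
    show q ^ (2 * (l + 1)) = q * q ^ (2 * l + 1) by ring,
    basisCoeff_rogers_mul_q ha hc hr hq0 hq1 hσ0 he hs1 hca,
    show q ^ (2 * l + 1) = q * q ^ (2 * l) by ring,
    basisCoeff_rogers_mul_q ha hc hr hq0 hq1 hσ0 he hs1 hca]
  have hQ : q ^ n ≠ 0 := pow_ne_zero _ hq0
  have hQ' : q ^ (2 * l) ≠ 0 := pow_ne_zero _ hq0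
  have n1 := one_sub_pow_succ_ne_zero hq1 n
  have n2 := one_sub_pow_succ_ne_zero hq1 (n + 1)
  have n3 := one_sub_pow_succ_ne_zero hq1 (2 * l + 1)
  have n4 := hσ (2 * l + 3)
  have n5 := he (4 * l)
  have n6 := he (4 * l + 2)
  have n7 := he (4 * l + n + 1)
  have n8 := he (4 * l + n + 2)
  have n9 := he (4 * l + n + 3)
  have n10 := he (4 * l + n + 4)
  have n11 := hs1 (2 * l)
  have n12 := hs1 (2 * l + 1)
  have n13 := hca (2 * l + 1)
  have n14 := hca (2 * l + 2)
  rw [show 1 - q ^ (n + 1) = 1 - q * q ^ n by ring] at n1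
  rw [show 1 - q ^ (n + 1 + 1) = 1 - q ^ 2 * q ^ n by ring] at n2
  rw [show 1 - q ^ (2 * l + 1 + 1) = 1 - q ^ 2 * q ^ (2 * l) by ring] at n3
  rw [show 1 - q ^ (2 * l + 3) * σ ^ 2 = 1 - q ^ 3 * q ^ (2 * l) * σ ^ 2 by ring] at n4
  rw [show 1 - q ^ (4 * l) * (σ ^ 2 * c ^ 2)
    = 1 - (q ^ (2 * l)) ^ 2 * (σ ^ 2 * c ^ 2) by ring] at n5
  rw [show 1 - q ^ (4 * l + 2) * (σ ^ 2 * c ^ 2)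
    = 1 - q ^ 2 * (q ^ (2 * l)) ^ 2 * (σ ^ 2 * c ^ 2) by ring] at n6
  rw [show 1 - q ^ (4 * l + n + 1) * (σ ^ 2 * c ^ 2)
    = 1 - q * q ^ n * (q ^ (2 * l)) ^ 2 * (σ ^ 2 * c ^ 2) by ring] at n7
  rw [show 1 - q ^ (4 * l + n + 2) * (σ ^ 2 * c ^ 2)
    = 1 - q ^ 2 * q ^ n * (q ^ (2 * l)) ^ 2 * (σ ^ 2 * c ^ 2) by ring] at n8
  rw [show 1 - q ^ (4 * l + n + 3) * (σ ^ 2 * c ^ 2)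
    = 1 - q ^ 3 * q ^ n * (q ^ (2 * l)) ^ 2 * (σ ^ 2 * c ^ 2) by ring] at n9
  rw [show 1 - q ^ (4 * l + n + 4) * (σ ^ 2 * c ^ 2)
    = 1 - q ^ 4 * q ^ n * (q ^ (2 * l)) ^ 2 * (σ ^ 2 * c ^ 2) by ring] at n10
  rw [show 1 - q ^ (2 * l + 1) * (σ * (a * c)) = 1 - q * q ^ (2 * l) * (σ * (a * c)) by ring] at n12
  rw [show 1 + q ^ (2 * l + 1) * (σ * c / a) = 1 + q * q ^ (2 * l) * (σ * c / a) by ring] at n13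
  rw [show 1 + q ^ (2 * l + 2) * (σ * c / a) = 1 + q ^ 2 * q ^ (2 * l) * (σ * c / a) by ring] at n14
  rw [show q * q ^ (n + 1) = q ^ 2 * q ^ n by ring, show q ^ (n + 1) = q * q ^ n by ring,
    show q * (q * q ^ (2 * l)) = q ^ 2 * q ^ (2 * l) by ring,
    show q * q ^ n * (q * q ^ (2 * l)) = q ^ 2 * q ^ n * q ^ (2 * l) by ring,
    show q ^ n * (q * q ^ (2 * l)) = q * q ^ n * q ^ (2 * l) by ring,
    show q * (q ^ n) ^ 2 * (q * q ^ (2 * l)) ^ 2 = q ^ 3 * (q ^ n) ^ 2 * (q ^ (2 * l)) ^ 2 by ring,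
    show q * (q * q ^ n) ^ 2 * (q ^ (2 * l)) ^ 2 = q ^ 3 * (q ^ n) ^ 2 * (q ^ (2 * l)) ^ 2 by ring,
    show q ^ 2 * (q * q ^ (2 * l)) ^ 2 = q ^ 4 * (q ^ (2 * l)) ^ 2 by ring,
    show q * q ^ n * (q * q ^ (2 * l)) ^ 2 = q ^ 3 * q ^ n * (q ^ (2 * l)) ^ 2 by ring,
    show q ^ 2 * q ^ n * (q * q ^ (2 * l)) ^ 2 = q ^ 4 * q ^ n * (q ^ (2 * l)) ^ 2 by ring]
  clear he hs1 hca hca' hσ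
  generalize 1 - q * q ^ n = D1 at *
  generalize 1 - q ^ 2 * q ^ n = D2 at *
  generalize 1 - q ^ 2 * q ^ (2 * l) = D3 at *
  generalize 1 - q ^ 3 * q ^ (2 * l) * σ ^ 2 = D4 at *
  generalize 1 - (q ^ (2 * l)) ^ 2 * (σ ^ 2 * c ^ 2) = D5 at *
  generalize 1 - q ^ 2 * (q ^ (2 * l)) ^ 2 * (σ ^ 2 * c ^ 2) = D6 at *
  generalize 1 - q * q ^ n * (q ^ (2 * l)) ^ 2 * (σ ^ 2 * c ^ 2) = D7 at *
  generalize 1 - q ^ 2 * q ^ n * (q ^ (2 * l)) ^ 2 * (σ ^ 2 * c ^ 2) = D8 at *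
  generalize 1 - q ^ 3 * q ^ n * (q ^ (2 * l)) ^ 2 * (σ ^ 2 * c ^ 2) = D9 at *
  generalize 1 - q ^ 4 * q ^ n * (q ^ (2 * l)) ^ 2 * (σ ^ 2 * c ^ 2) = D10 at *
  generalize 1 - q * q ^ (2 * l) * (σ * (a * c)) = D12 at *
  generalize 1 + q * q ^ (2 * l) * (σ * c / a) = D13 at *
  generalize 1 + q ^ 2 * q ^ (2 * l) * (σ * c / a) = D14 at *
  generalize 1 - q ^ 4 * (q ^ (2 * l)) ^ 2 * (σ ^ 2 * c ^ 2) = Y1 at *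
  generalize 1 - q ^ 3 * (q ^ n) ^ 2 * (q ^ (2 * l)) ^ 2 * (σ ^ 2 * c ^ 2) = Y2 at *
  generalize 1 - q * (q ^ n) ^ 2 * (q ^ (2 * l)) ^ 2 * (σ ^ 2 * c ^ 2) = Y3 at *
  generalize 1 + q ^ 2 * q ^ n * q ^ (2 * l) * (σ * c / a) = Y4 at *
  generalize 1 + q * q ^ n * q ^ (2 * l) * (σ * c / a) = Y5 at *
  generalize 1 - q * q ^ n * q ^ (2 * l) * (σ * (a * c)) = Y6 at *
  generalize 1 - q ^ n * q ^ (2 * l) * (σ * (a * c)) = Y7 at *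
  generalize 1 - q ^ (2 * l) * (c ^ 2 / q) = Y8 at *
  generalize 1 - q ^ (2 * l) * (σ ^ 2 * c ^ 2) = Y9 at *
  generalize evenWeight a c q (σ * (a * c)) l = E at *
  generalize basisCoeff a (-a) r (-r) q (q ^ (2 * l) * (σ * (a * c))) n = B at *
  generalize 1 - q ^ (2 * l) * (σ * (a * c)) = D11 at *
  generalize q ^ n = T at *
  generalize q ^ (2 * l) = P at *
  -- common factors are split off by hand, as the fractions have too many atoms for `field_simp`
  calc _ = E * B * Y7 * Y5 * Y3 * Y6 * Y4 * Y2 * Y8 * Y9 * Y1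
          / (D3 * D4 * D5 * D7 * D8 * D9 * D10) * (q ^ 2 / (c ^ 2 * T ^ 2))
          * ((D6 / D6) * (D11 / D11) * (D12 / D12) * (D13 / D13) * (D14 / D14)) := by ring
    _ = E * B * Y7 * Y5 * Y3 * Y6 * Y4 * Y2 * Y8 * Y9 * Y1
          / (D3 * D4 * D5 * D7 * D8 * D9 * D10) * (q ^ 2 / (c ^ 2 * T ^ 2)) := by
      rw [div_self n6, div_self n11, div_self n12, div_self n13, div_self n14]; ring
    _ = E * B * Y7 * Y5 * Y3 * Y6 * Y4 * Y2 * Y8 * Y9 * Y1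
          / (D3 * D4 * D5 * D7 * D8 * D9 * D10)
          * (1 / (T * P * (σ * c)) * (1 / (q * T * P * (σ * c))) * (q ^ 3 * P ^ 2 * σ ^ 2))
          * ((D1 / D1) * (D2 / D2)) := by
      rw [div_self n1, div_self n2, mul_one, mul_one]
      congr 1
      field_simp
    _ = _ := by ring

/-- The factor of the telescoping certificate for the summation over `l`. -/
noncomputable def evenCert (c q u Q P : ℂ) : ℂ :=
  -(q * Q / P) * (1 - P) * (1 - q * P * u) * (1 - Q * P * (u * c ^ 2))
    * (1 - q * Q * P * (u * c ^ 2))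
    / ((1 - P ^ 2 * (u * c ^ 2)) * (1 - q * Q ^ 2 * (u * c ^ 2)) * (1 - q * Q)
      * (1 - q ^ 2 * Q * u))

/-- The telescoping relation behind the summation over `l`. -/
theorem evenTerm_telescope {a c q r σ : ℂ} (ha : a ≠ 0) (hc : c ≠ 0) (hr : r ^ 2 = q)
    (hq0 : q ≠ 0) (hq1 : ‖q‖ < 1) (hσ0 : σ ≠ 0)
    (hσ : ∀ j : ℕ, 1 - q ^ j * σ ^ 2 ≠ 0)
    (he : ∀ j : ℕ, 1 - q ^ j * (σ ^ 2 * c ^ 2) ≠ 0)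
    (hs1 : ∀ j : ℕ, 1 - q ^ j * (σ * (a * c)) ≠ 0)
    (hca : ∀ j : ℕ, 1 + q ^ j * (σ * c / a) ≠ 0)
    (hca' : ∀ j : ℕ, 1 - q ^ j * (σ * c / a) ≠ 0) (N l : ℕ) :
    evenTerm a c r q σ (N + 1) l
        - basisRatio a (-a) c (-c) q (σ * (a * c)) N * evenTerm a c r q σ N l
      = evenCert c q (σ ^ 2) (q ^ N) (q ^ (2 * (l + 1))) * evenTerm a c r q σ (N + 1) (l + 1)
        - evenCert c q (σ ^ 2) (q ^ N) (q ^ (2 * l)) * evenTerm a c r q σ (N + 1) l := by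
  have hQ : q ^ N ≠ 0 := pow_ne_zero _ hq0
  have hP : q ^ (2 * l) ≠ 0 := pow_ne_zero _ hq0
  by_cases hl : N + 1 < 2 * l
  · rw [evenTerm_of_lt hl, evenTerm_of_lt (by omega : N < 2 * l),
      evenTerm_of_lt (by omega : N + 1 < 2 * (l + 1))]
    ring
  -- the previous summand in `N`, expressed through the present one
  have H1 : basisRatio a (-a) c (-c) q (σ * (a * c)) N * evenTerm a c r q σ N l
      = evenTerm a c r q σ (N + 1) l * ((1 - q ^ 2 * (q ^ N) ^ 2 * σ ^ 2)
        * (1 - q * q ^ N / q ^ (2 * l)) * (1 - q * q ^ N * q ^ (2 * l) * (σ ^ 2 * c ^ 2))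
        / ((1 - q * q ^ N) * (1 - q ^ 2 * q ^ N * σ ^ 2)
          * (1 - q * (q ^ N) ^ 2 * (σ ^ 2 * c ^ 2)))) := by
    obtain ⟨n, hn⟩ : ∃ n, N + 1 = 2 * l + n := Nat.exists_eq_add_of_le (by omega)
    rcases n with _ | n
    · rw [evenTerm_of_lt (by omega : N < 2 * l), show q * q ^ N = q ^ (2 * l) by
        rw [← pow_succ', hn, add_zero], div_self hP]
      ring
    · have hN : N = 2 * l + n := by omega
      have hb := basisRatio_even ha hc hq0 hq1 hσ0 hσ 0 N
      rw [pow_zero, one_mul] at hb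
      rw [hb, hn, hN, evenTerm_two_mul_add, evenTerm_two_mul_add, basisCoeff_succ,
        basisRatio_rogers ha hc hr hq0 hq1 hσ0 he]
      have hT : q ^ n ≠ 0 := pow_ne_zero _ hq0
      have n1 := one_sub_pow_succ_ne_zero hq1 n
      have n2 := one_sub_pow_succ_ne_zero hq1 (2 * l + n)
      have n3 := hσ (2 * l + n + 2)
      have n4 := he (4 * l + 2 * n + 1)
      have n5 := he (4 * l + n + 1)
      rw [show 1 - q ^ (n + 1) = 1 - q * q ^ n by ring] at n1
      rw [show 1 - q ^ (2 * l + n + 1) = 1 - q * (q ^ (2 * l) * q ^ n) by ring] at n2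
      rw [show 1 - q ^ (2 * l + n + 2) * σ ^ 2
        = 1 - q ^ 2 * (q ^ (2 * l) * q ^ n) * σ ^ 2 by ring] at n3
      rw [show 1 - q ^ (4 * l + 2 * n + 1) * (σ ^ 2 * c ^ 2)
        = 1 - q * (q ^ (2 * l) * q ^ n) ^ 2 * (σ ^ 2 * c ^ 2) by ring] at n4
      rw [show 1 - q ^ (4 * l + n + 1) * (σ ^ 2 * c ^ 2)
        = 1 - q * q ^ n * (q ^ (2 * l)) ^ 2 * (σ ^ 2 * c ^ 2) by ring] at n5
      rw [pow_add q (2 * l) n, show q * (q ^ (2 * l) * q ^ n) / q ^ (2 * l) = q * q ^ n by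
        field_simp,
        show 1 - q * (q ^ n) ^ 2 * (q ^ (2 * l)) ^ 2 * (σ ^ 2 * c ^ 2)
          = 1 - q * (q ^ (2 * l) * q ^ n) ^ 2 * (σ ^ 2 * c ^ 2) by ring,
        show q ^ n * q ^ (2 * l) = q ^ (2 * l) * q ^ n by ring,
        show q * q ^ n * q ^ (2 * l) = q * (q ^ (2 * l) * q ^ n) by ring,
        show q * (q ^ (2 * l) * q ^ n) * q ^ (2 * l) * (σ ^ 2 * c ^ 2)
          = q * q ^ n * (q ^ (2 * l)) ^ 2 * (σ ^ 2 * c ^ 2) by ring,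
        show q ^ 2 * (q ^ (2 * l) * q ^ n) * (1 : ℂ) ^ 2 = q ^ 2 * (q ^ (2 * l) * q ^ n) by ring,
        show q * (q ^ (2 * l) * q ^ n) * 1 = q * (q ^ (2 * l) * q ^ n) by ring, mul_one,
        show q ^ 2 * (q ^ (2 * l) * q ^ n) ^ 2 * σ ^ 2
          = (q * (q ^ (2 * l) * q ^ n) * σ) ^ 2 by ring]
      clear he hs1 hca hca' hσ
      have hZ : q ^ (2 * l) * q ^ n ≠ 0 := mul_ne_zero hP hT
      generalize basisCoeff a (-a) r (-r) q (q ^ (2 * l) * (σ * (a * c))) n = B at *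
      generalize evenWeight a c q (σ * (a * c)) l = E at *
      generalize 1 - q * q ^ n * (q ^ (2 * l)) ^ 2 * (σ ^ 2 * c ^ 2) = D5 at *
      generalize q ^ (2 * l) * q ^ n = Z at *
      generalize 1 - q * q ^ n = D1 at *
      generalize 1 - q * Z = D2 at *
      generalize 1 - q ^ 2 * Z * σ ^ 2 = D3 at *
      generalize 1 - q * Z ^ 2 * (σ ^ 2 * c ^ 2) = D4 at *
      generalize 1 - Z * (σ * (a * c)) = Y1 at *
      generalize 1 + q * Z * (σ * c / a) = Y2 at *
      generalize 1 - (q * Z * σ) ^ 2 = Y3 at *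
      field_simp
  -- the next summand in `l`, expressed through the present one
  have H2 : evenTerm a c r q σ (N + 1) (l + 1) = evenTerm a c r q σ (N + 1) l
      * (q ^ 3 * (q ^ (2 * l)) ^ 2 * σ ^ 2 * (1 - q ^ (2 * l) * (c ^ 2 / q))
          * (1 - q ^ (2 * l) * (σ ^ 2 * c ^ 2))
          * (1 - q ^ 4 * (q ^ (2 * l)) ^ 2 * (σ ^ 2 * c ^ 2)) * (1 - q * q ^ N / q ^ (2 * l))
          * (1 - q ^ N / q ^ (2 * l))
        / ((1 - q ^ 2 * q ^ (2 * l)) * (1 - q ^ 3 * q ^ (2 * l) * σ ^ 2)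
          * (1 - (q ^ (2 * l)) ^ 2 * (σ ^ 2 * c ^ 2))
          * (1 - q ^ 2 * q ^ N * q ^ (2 * l) * (σ ^ 2 * c ^ 2))
          * (1 - q ^ 3 * q ^ N * q ^ (2 * l) * (σ ^ 2 * c ^ 2)))) := by
    obtain ⟨n, hn⟩ : ∃ n, N + 1 = 2 * l + n := Nat.exists_eq_add_of_le (by omega)
    rcases n with _ | _ | n
    · rw [evenTerm_of_lt (by omega : N + 1 < 2 * (l + 1)), show q * q ^ N = q ^ (2 * l) by
        rw [← pow_succ', hn, add_zero], div_self hP]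
      ring
    · rw [evenTerm_of_lt (by omega : N + 1 < 2 * (l + 1)), show N = 2 * l by omega, div_self hP]
      ring
    · rw [hn, show n + 1 + 1 = n + 2 from rfl,
        evenTerm_next ha hc hr hq0 hq1 hσ0 hσ he hs1 hca hca']
      have e1 : q ^ N = q ^ (2 * l) * (q * q ^ n) := by
        rw [show N = 2 * l + (n + 1) by omega]; ring
      rw [e1, mul_div_cancel_left₀ _ hP, show q * (q ^ (2 * l) * (q * q ^ n)) / q ^ (2 * l)
          = q ^ 2 * q ^ n by field_simp,
        show q ^ 2 * (q ^ (2 * l) * (q * q ^ n)) * q ^ (2 * l)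
          = q ^ 3 * q ^ n * (q ^ (2 * l)) ^ 2 by ring,
        show q ^ 3 * (q ^ (2 * l) * (q * q ^ n)) * q ^ (2 * l)
          = q ^ 4 * q ^ n * (q ^ (2 * l)) ^ 2 by ring]
  have n1 : 1 - (q ^ (2 * l)) ^ 2 * (σ ^ 2 * c ^ 2) ≠ 0 := by
    have := he (2 * l * 2); rwa [pow_mul] at this
  have n2 : 1 - q * (q ^ N) ^ 2 * (σ ^ 2 * c ^ 2) ≠ 0 := by
    have := he (N * 2 + 1); rwa [pow_succ', pow_mul] at this
  have n3 : 1 - q * q ^ N ≠ 0 := by rw [← pow_succ']; exact one_sub_pow_succ_ne_zero hq1 N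
  have n4 : 1 - q ^ 2 * q ^ N * σ ^ 2 ≠ 0 := by
    rw [← pow_add]; exact hσ _
  have n5 : 1 - q ^ 2 * q ^ (2 * l) ≠ 0 := by
    rw [← pow_add, add_comm]; exact one_sub_pow_succ_ne_zero hq1 (2 * l + 1)
  have n6 : 1 - q ^ 3 * q ^ (2 * l) * σ ^ 2 ≠ 0 := by rw [← pow_add]; exact hσ _
  have n7 : 1 - q ^ 4 * (q ^ (2 * l)) ^ 2 * (σ ^ 2 * c ^ 2) ≠ 0 := by
    rw [← pow_mul, ← pow_add]; exact he _
  have n8 : 1 - q ^ 2 * q ^ N * q ^ (2 * l) * (σ ^ 2 * c ^ 2) ≠ 0 := by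
    rw [← pow_add, ← pow_add]; exact he _
  have n9 : 1 - q ^ 3 * q ^ N * q ^ (2 * l) * (σ ^ 2 * c ^ 2) ≠ 0 := by
    rw [← pow_add, ← pow_add]; exact he _
  have key := even_certificate hq0 hP n1 n2 n3 n4 n5 n6 n7 n8 n9
  have hcert : evenCert c q (σ ^ 2) (q ^ N) (q ^ (2 * (l + 1)))
      = -(q ^ N / (q * q ^ (2 * l))) * (1 - q ^ 2 * q ^ (2 * l))
          * (1 - q ^ 3 * q ^ (2 * l) * σ ^ 2)
          * (1 - q ^ 2 * q ^ N * q ^ (2 * l) * (σ ^ 2 * c ^ 2))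
          * (1 - q ^ 3 * q ^ N * q ^ (2 * l) * (σ ^ 2 * c ^ 2))
          / ((1 - q ^ 4 * (q ^ (2 * l)) ^ 2 * (σ ^ 2 * c ^ 2))
            * (1 - q * (q ^ N) ^ 2 * (σ ^ 2 * c ^ 2)) * (1 - q * q ^ N)
            * (1 - q ^ 2 * q ^ N * σ ^ 2)) := by
    rw [evenCert, show q ^ (2 * (l + 1)) = q ^ 2 * q ^ (2 * l) by ring,
      show q * q ^ N / (q ^ 2 * q ^ (2 * l)) = q ^ N / (q * q ^ (2 * l)) by field_simp]
    ring
  rw [H1, H2, hcert, evenCert]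
  linear_combination (evenTerm a c r q σ (N + 1) l) * key

/-- The coefficients of the eigenseries for `a, -a, c, -c` over the bidiagonal basis, expanded in
the coefficients for `a, -a, √q, -√q`. -/
theorem sum_evenTerm {a c q r σ : ℂ} (ha : a ≠ 0) (hc : c ≠ 0) (hr : r ^ 2 = q)
    (hq0 : q ≠ 0) (hq1 : ‖q‖ < 1) (hσ0 : σ ≠ 0)
    (hσ : ∀ j : ℕ, 1 - q ^ j * σ ^ 2 ≠ 0)
    (he : ∀ j : ℕ, 1 - q ^ j * (σ ^ 2 * c ^ 2) ≠ 0)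
    (hs1 : ∀ j : ℕ, 1 - q ^ j * (σ * (a * c)) ≠ 0)
    (hca : ∀ j : ℕ, 1 + q ^ j * (σ * c / a) ≠ 0)
    (hca' : ∀ j : ℕ, 1 - q ^ j * (σ * c / a) ≠ 0) (N : ℕ) :
    ∑ l ∈ Finset.range (N + 1), evenTerm a c r q σ N l
      = basisCoeff a (-a) c (-c) q (σ * (a * c)) N := by
  induction N with
  | zero => simp [evenTerm, evenWeight]
  | succ N ih =>
    have h1 : ∑ l ∈ Finset.range (N + 2), evenTerm a c r q σ N l
        = basisCoeff a (-a) c (-c) q (σ * (a * c)) N := by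
      rw [Finset.sum_range_succ, ih, evenTerm_of_lt (by omega), add_zero]
    have h2 := Finset.sum_range_sub (fun l => evenCert c q (σ ^ 2) (q ^ N) (q ^ (2 * l))
      * evenTerm a c r q σ (N + 1) l) (N + 2)
    rw [← Finset.sum_congr rfl fun l _ =>
        evenTerm_telescope ha hc hr hq0 hq1 hσ0 hσ he hs1 hca hca' N l,
      Finset.sum_sub_distrib, ← Finset.mul_sum, h1, evenTerm_of_lt (by omega)] at h2
    have h3 : evenCert c q (σ ^ 2) (q ^ N) (q ^ (2 * 0)) = 0 := by simp [evenCert]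
    rw [h3] at h2
    rw [basisCoeff_succ]
    linear_combination h2

/-! ### The fourfold series over the bidiagonal basis -/

/-- Genericity of `s` strong enough for all expansions over the bidiagonal basis. It fails for
countably many `s` only. -/
structure IsStronglyGeneric (a b c d q s : ℂ) : Prop where
  ne_zero : s ≠ 0
  ne_one : ∀ j : ℕ, q ^ j * s ^ 2 ≠ 1
  ne_a : ∀ j : ℕ, q ^ j * s ^ 2 ≠ a ^ 2
  ne_aa : ∀ j : ℕ, q ^ j * s ^ 2 ≠ a ^ 4
  ne_aacc : ∀ j : ℕ, q ^ j * s ^ 2 ≠ a ^ 2 * c ^ 2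
  ne_abcd : ∀ j : ℕ, q ^ j * s ^ 2 ≠ a * b * c * d

theorem IsStronglyGeneric.pow_mul {a b c d q s : ℂ} (h : IsStronglyGeneric a b c d q s)
    (hq0 : q ≠ 0) (M : ℕ) : IsStronglyGeneric a b c d q (q ^ M * s) := by
  have e (j : ℕ) : q ^ j * (q ^ M * s) ^ 2 = q ^ (j + 2 * M) * s ^ 2 := by ring
  exact ⟨mul_ne_zero (pow_ne_zero _ hq0) h.ne_zero, fun j => e j ▸ h.ne_one _,
    fun j => e j ▸ h.ne_a _, fun j => e j ▸ h.ne_aa _, fun j => e j ▸ h.ne_aacc _,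
    fun j => e j ▸ h.ne_abcd _⟩

theorem IsStronglyGeneric.one_sub_mul_sq_sigma {a b c d q σ : ℂ}
    (h : IsStronglyGeneric a b c d q (σ * (a * c))) (j : ℕ) : 1 - q ^ j * σ ^ 2 ≠ 0 := by
  intro h0
  apply h.ne_aacc j
  linear_combination (-a ^ 2 * c ^ 2) * h0

theorem IsStronglyGeneric.one_sub_mul_sq {a b c d q σ : ℂ}
    (h : IsStronglyGeneric a b c d q (σ * (a * c))) (j : ℕ) :
    1 - q ^ j * (σ ^ 2 * c ^ 2) ≠ 0 := by
  intro h0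
  apply h.ne_a j
  linear_combination (-a ^ 2) * h0

theorem IsStronglyGeneric.one_sub_mul {a b c d q s : ℂ}
    (h : IsStronglyGeneric a b c d q s) (j : ℕ) : 1 - q ^ j * s ≠ 0 := by
  intro h0
  apply h.ne_one (2 * j)
  linear_combination (-(1 + q ^ j * s)) * h0

theorem IsStronglyGeneric.one_add_mul_div {a b c d q σ : ℂ} (ha : a ≠ 0)
    (h : IsStronglyGeneric a b c d q (σ * (a * c))) (j : ℕ) :
    1 + q ^ j * (σ * c / a) ≠ 0 := by
  intro h0
  apply h.ne_aa (2 * j)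
  have h1 : a ^ 2 + q ^ j * (σ * (a * c)) = 0 := by
    have : a ^ 2 + q ^ j * (σ * (a * c)) = a ^ 2 * (1 + q ^ j * (σ * c / a)) := by field_simp
    rw [this, h0, mul_zero]
  linear_combination (q ^ j * (σ * (a * c)) - a ^ 2) * h1

theorem IsStronglyGeneric.one_sub_mul_div {a b c d q σ : ℂ} (ha : a ≠ 0)
    (h : IsStronglyGeneric a b c d q (σ * (a * c))) (j : ℕ) :
    1 - q ^ j * (σ * c / a) ≠ 0 := by
  intro h0
  apply h.ne_aa (2 * j)
  have h1 : a ^ 2 - q ^ j * (σ * (a * c)) = 0 := by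
    have : a ^ 2 - q ^ j * (σ * (a * c)) = a ^ 2 * (1 - q ^ j * (σ * c / a)) := by field_simp
    rw [this, h0, mul_zero]
  linear_combination (-(q ^ j * (σ * (a * c)) + a ^ 2)) * h1

theorem IsStronglyGeneric.one_sub_mul_sq_div {a b c d q σ : ℂ} (hb : b ≠ 0) (hd : d ≠ 0)
    (h : IsStronglyGeneric a b c d q (σ * (a * c))) (j : ℕ) :
    1 - q ^ j * (σ ^ 2 * (a * c) / (b * d)) ≠ 0 := by
  intro h0
  apply h.ne_abcd j
  have h1 : b * d - q ^ j * (σ ^ 2 * (a * c)) = 0 := by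
    have : b * d - q ^ j * (σ ^ 2 * (a * c))
      = b * d * (1 - q ^ j * (σ ^ 2 * (a * c) / (b * d))) := by field_simp
    rw [this, h0, mul_zero]
  linear_combination (-(a * c)) * h1

theorem sum_range_ite_le {A : Type*} [AddCommMonoid A] (g : ℕ → A) (e i : ℕ) :
    (∑ N ∈ Finset.range (i + 1), if e ≤ N then g N else 0)
      = if e ≤ i then ∑ n ∈ Finset.range (i - e + 1), g (e + n) else 0 := by
  split_ifs with h
  · obtain ⟨j, rfl⟩ := Nat.exists_eq_add_of_le h
    rw [Nat.add_sub_cancel_left, add_assoc, Finset.sum_range_add, Finset.sum_eq_zero, zero_add]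
    · simp
    · intro N hN
      rw [if_neg (by simpa using hN)]
  · refine Finset.sum_eq_zero fun N hN => if_neg ?_
    have := Finset.mem_range.mp hN
    omega

theorem sum_range_ite_add_le {A : Type*} [AddCommMonoid A] (g : ℕ → A) {m N : ℕ} (h : m ≤ N) :
    (∑ n ∈ Finset.range (N + 1), if m + n ≤ N then g n else 0)
      = ∑ M ∈ Finset.range (N + 1), if m ≤ M then g (M - m) else 0 := by
  rw [sum_range_ite_le, if_pos h, ← Finset.sum_subset (s₁ := Finset.range (N - m + 1))]
  · refine Finset.sum_congr rfl fun n hn => ?_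
    have := Finset.mem_range.mp hn
    rw [if_pos (by omega), Nat.add_sub_cancel_left]
  · exact Finset.range_subset_range.mpr (by omega)
  · intro n _ hn
    exact if_neg fun hk => hn (Finset.mem_range.mpr (by omega))

theorem sum_sum_comm_sum_sum {A : Type*} [AddCommMonoid A] (S : Finset ℕ)
    (f : ℕ → ℕ → ℕ → ℕ → A) :
    ∑ k ∈ S, ∑ l ∈ S, ∑ m ∈ S, ∑ n ∈ S, f k l m n
      = ∑ m ∈ S, ∑ n ∈ S, ∑ k ∈ S, ∑ l ∈ S, f k l m n := by
  calc _ = ∑ k ∈ S, ∑ m ∈ S, ∑ l ∈ S, ∑ n ∈ S, f k l m n :=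
        Finset.sum_congr rfl fun _ _ => Finset.sum_comm
    _ = ∑ m ∈ S, ∑ k ∈ S, ∑ n ∈ S, ∑ l ∈ S, f k l m n := by
        rw [Finset.sum_comm]
        exact Finset.sum_congr rfl fun _ _ => Finset.sum_congr rfl fun _ _ => Finset.sum_comm
    _ = _ := Finset.sum_congr rfl fun _ _ => Finset.sum_comm

/-- An expansion of coefficients `φ` in shifted sequences `φ' l` carries over to the series with
these coefficients. -/
theorem coeff_shiftedSum_of_expansion {φ w : ℕ → ℂ} {φ' : ℕ → ℕ → ℂ} {e : ℕ → ℕ}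
    (he : ∀ l, l ≤ e l) (Y : ℕ → PowerSeries ℂ)
    (h : ∀ N, φ N = ∑ l ∈ Finset.range (N + 1), if e l ≤ N then w l * φ' l (N - e l) else 0)
    (i : ℕ) :
    coeff i (shiftedSum φ Y) = ∑ l ∈ Finset.range (i + 1), if e l ≤ i then
      w l * coeff (i - e l) (shiftedSum (φ' l) fun n => Y (e l + n)) else 0 := by
  have h1 : ∀ N ∈ Finset.range (i + 1), φ N * coeff (i - N) (Y N)
      = ∑ l ∈ Finset.range (i + 1),
        if e l ≤ N then w l * φ' l (N - e l) * coeff (i - N) (Y N) else 0 := by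
    intro N hN
    rw [h N, Finset.sum_mul, ← Finset.sum_subset (Finset.range_subset_range.mpr
      (Nat.succ_le_of_lt (Finset.mem_range.mp hN)))]
    · refine Finset.sum_congr rfl fun l _ => ?_
      rw [ite_mul, zero_mul]
    · intro l _ hl
      refine if_neg fun h2 => hl (Finset.mem_range.mpr ?_)
      have := he l
      omega
  rw [shiftedSum, coeff_mk, Finset.sum_congr rfl h1, Finset.sum_comm]
  refine Finset.sum_congr rfl fun l _ => ?_
  rw [sum_range_ite_le]
  refine if_congr Iff.rfl ?_ rfl
  rw [shiftedSum, coeff_mk, Finset.mul_sum]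
  refine Finset.sum_congr rfl fun n _ => ?_
  rw [Nat.add_sub_cancel_left, Nat.sub_add_eq, mul_assoc]

/-- The double series over the even coefficients is the eigenseries with parameters
`a, -a, c, -c`. -/
theorem coeff_basisSeries_even {a b c d q σ : ℂ} (ha : a ≠ 0) (hc : c ≠ 0) (hq0 : q ≠ 0)
    (hq1 : ‖q‖ < 1) (h : IsStronglyGeneric a b c d q (σ * (a * c))) (i : ℕ) :
    coeff i (basisSeries a (-a) c (-c) q (σ * (a * c)))
      = ∑ l ∈ Finset.range (i + 1), if 2 * l ≤ i then evenWeight a c q (σ * (a * c)) l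
          * coeff (i - 2 * l) (rogersSeries a q (q ^ (2 * l) * (σ * (a * c)))) else 0 := by
  obtain ⟨r, hr⟩ := IsAlgClosed.exists_pow_nat_eq q two_pos
  have e1 := fun N => (sum_evenTerm ha hc hr hq0 hq1 (left_ne_zero_of_mul h.ne_zero)
    h.one_sub_mul_sq_sigma h.one_sub_mul_sq h.one_sub_mul (h.one_add_mul_div ha)
    (h.one_sub_mul_div ha) N).symm
  simp only [evenTerm] at e1
  rw [basisSeries, coeff_shiftedSum_of_expansion (fun l => by omega) _ e1]
  refine Finset.sum_congr rfl fun l _ => if_congr Iff.rfl ?_ rfl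
  have h2 := h.pow_mul hq0 (2 * l)
  rw [rogersSeries_eq_basisSeries ha hq0 hq1 h2.ne_zero hr h2.ne_a, basisSeries]
  simp only [pow_add, mul_assoc, mul_left_comm]

theorem sum_cEven {a b c d q s : ℂ} (ha : a ≠ 0) (hc : c ≠ 0) (hq0 : q ≠ 0)
    (hq1 : ‖q‖ < 1) (h : IsStronglyGeneric a b c d q s) {i N : ℕ} (hi : i ≤ N) :
    (∑ k ∈ Finset.range (N + 1), ∑ l ∈ Finset.range (N + 1),
        if 2 * k + 2 * l = i then cEven a c q k l s else 0)
      = coeff i (basisSeries a (-a) c (-c) q s) := by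
  obtain ⟨σ, rfl⟩ : ∃ σ, s = σ * (a * c) := ⟨s / (a * c), by field_simp⟩
  rw [coeff_basisSeries_even ha hc hq0 hq1 h, Finset.sum_comm,
    ← Finset.sum_subset (Finset.range_subset_range.mpr (Nat.succ_le_succ hi))]
  · refine Finset.sum_congr rfl fun l _ => ?_
    split_ifs with hl
    · rw [rogersSeries, coeff_mk]
      split_ifs with he
      · have hk := Nat.two_mul_div_two_of_even he
        rw [Finset.sum_eq_single ((i - 2 * l) / 2), if_pos (by omega), cEven_eq]
        · intro k _ hk'
          exact if_neg (by omega)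
        · intro hk'
          exact absurd (Finset.mem_range.mpr (by omega)) hk'
      · rw [mul_zero]
        refine Finset.sum_eq_zero fun k _ => if_neg fun hk => he ⟨k, by omega⟩
    · exact Finset.sum_eq_zero fun k _ => if_neg (by omega)
  · intro l _ hl
    exact Finset.sum_eq_zero fun k _ => if_neg fun hk => hl (Finset.mem_range.mpr (by omega))

/-- The odd coefficients split into a factor that depends on `m + n` and two `₂φ₁` terms. -/
theorem cOdd_eq {a b c d q σ : ℂ} (ha : a ≠ 0) (hb : b ≠ 0) (hc : c ≠ 0) (hd : d ≠ 0)
    (hσ : ∀ j : ℕ, 1 - q ^ j * -(q * σ) ≠ 0) (m n : ℕ) :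
    cOdd a b c d q m n (σ * (a * c)) = oddWeight (b * d) a c q σ (m + n)
      * (phiTerm (-b / a) (q * σ * a / d) (-(q * σ)) (q / b) q m
        * phiTerm (-d / c) (q * σ * c / b) (-(q * σ)) (q / d) q n) := by
  have e1 : q * (σ * (a * c)) / (c * d) = q * σ * a / d := by field_simp
  have e2 : q * (σ * (a * c)) / (a * b) = q * σ * c / b := by field_simp
  have e3 : q * (σ * (a * c)) ^ 2 / (a ^ 2 * c ^ 2) = q * σ ^ 2 := by field_simp
  have e4 : q ^ 2 * (σ * (a * c)) ^ 2 / (a * b * c * d)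
    = q ^ 2 * (σ ^ 2 * (a * c) / (b * d)) := by field_simp
  have e5 : -(q ^ m * q * (σ * (a * c))) / (a * c) = q ^ m * -(q * σ) := by field_simp
  have e6 : q ^ m * q * (σ * (a * c)) ^ 2 / (a ^ 2 * c ^ 2) = q ^ m * (q * σ ^ 2) := by
    field_simp
  have e7 : q ^ m * q ^ 2 * (σ * (a * c)) ^ 2 / (a * b * c * d)
    = q ^ m * (q ^ 2 * (σ ^ 2 * (a * c) / (b * d))) := by field_simp
  have e8 : -(q * (σ * (a * c))) / (a * c) = -(q * σ) := by field_simp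
  have e9 : q ^ (2 * m) * q * (σ * (a * c)) ^ 2 / (a ^ 2 * c ^ 2)
    = (q ^ 2) ^ m * (q * σ ^ 2) := by rw [pow_mul]; field_simp
  rw [cOdd, oddWeight, phiTerm, phiTerm, e1, e2, e3, e4, e5, e6, e7, e8, e9]
  simp only [qPoch_add]
  have h1 := qPoch_ne_zero hσ m
  have h2 := qPoch_ne_zero hσ n
  generalize qPoch (-(q * σ)) q m = K1 at *
  generalize qPoch (-(q * σ)) q n = K2 at *
  generalize qPoch (σ * (a * c)) q m = K3 at *
  generalize qPoch (q ^ m * (σ * (a * c))) q n = K4 at *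
  generalize qPoch (q ^ m * -(q * σ)) q n = K5 at *
  generalize qPoch (q * σ ^ 2) q m = K6 at *
  generalize qPoch (q ^ m * (q * σ ^ 2)) q n = K7 at *
  generalize qPoch (q ^ 2 * (σ ^ 2 * (a * c) / (b * d))) q m = K8 at *
  generalize qPoch (q ^ m * (q ^ 2 * (σ ^ 2 * (a * c) / (b * d)))) q n = K9 at *
  generalize qPoch (q * σ ^ 2) (q ^ 2) m = L1 at *
  generalize qPoch ((q ^ 2) ^ m * (q * σ ^ 2)) (q ^ 2) n = L2 at *
  generalize qPoch q q m = L3 at *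
  generalize qPoch q q n = L4 at *
  generalize qPoch (-b / a) q m = L5 at *
  generalize qPoch (-d / c) q n = L6 at *
  generalize qPoch (q * σ * a / d) q m = L7 at *
  generalize qPoch (q * σ * c / b) q n = L8 at *
  generalize (q / b) ^ m = L9 at *
  generalize (q / d) ^ n = M1 at *
  simp only [div_eq_mul_inv, mul_inv]
  linear_combination (-(L5 * K3 * L7 * K6 * L3⁻¹ * K8⁻¹ * L1⁻¹ * L9 * L6 * K4 * L8 * K5 * K7
    * L4⁻¹ * K9⁻¹ * L2⁻¹ * M1 * K2⁻¹)) * mul_inv_cancel₀ h1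

/-- For strongly generic `s`, the fourfold series is the sum over the bidiagonal basis. -/
theorem fourfoldSeries_eq_basisSeries {a b c d q s : ℂ} (ha : a ≠ 0) (hb : b ≠ 0) (hc : c ≠ 0)
    (hd : d ≠ 0) (hq0 : q ≠ 0) (hq1 : ‖q‖ < 1) (h : IsStronglyGeneric a b c d q s) :
    fourfoldSeries a b c d q s = basisSeries a b c d q s := by
  ext N
  rw [fourfoldSeries, coeff_mk]
  obtain ⟨σ, rfl⟩ : ∃ σ, s = σ * (a * c) := ⟨s / (a * c), by field_simp⟩
  have hσ (j : ℕ) : 1 - q ^ j * -(q * σ) ≠ 0 := by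
    intro h0
    apply h.one_sub_mul_sq_sigma (2 * (j + 1))
    linear_combination (1 - q ^ (j + 1) * σ) * h0
  -- the even coefficients sum to the eigenseries with parameters `a, -a, c, -c`
  have e1 (m n : ℕ) : (∑ k ∈ Finset.range (N + 1), ∑ l ∈ Finset.range (N + 1),
        if 2 * k + 2 * l + m + n = N then
          cEven a c q k l (q ^ (m + n) * (σ * (a * c))) * cOdd a b c d q m n (σ * (a * c))
        else 0)
      = if m + n ≤ N then
        coeff (N - (m + n)) (basisSeries a (-a) c (-c) q (q ^ (m + n) * (σ * (a * c))))
          * (oddWeight (b * d) a c q σ (m + n)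
            * (phiTerm (-b / a) (q * σ * a / d) (-(q * σ)) (q / b) q m
              * phiTerm (-d / c) (q * σ * c / b) (-(q * σ)) (q / d) q n)) else 0 := by
    split_ifs with hmn
    · rw [← sum_cEven ha hc hq0 hq1 (h.pow_mul hq0 (m + n)) (Nat.sub_le N (m + n)),
        ← cOdd_eq ha hb hc hd hσ, Finset.sum_mul]
      refine Finset.sum_congr rfl fun k _ => ?_
      rw [Finset.sum_mul]
      refine Finset.sum_congr rfl fun l _ => ?_
      rw [ite_mul, zero_mul]
      exact if_congr (by omega) rfl rfl
    · exact Finset.sum_eq_zero fun k _ => Finset.sum_eq_zero fun l _ => if_neg (by omega)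
  -- the sum over `m` and `n` with `m + n = M`
  have e2 : ∀ m ∈ Finset.range (N + 1), (∑ n ∈ Finset.range (N + 1), if m + n ≤ N then
        coeff (N - (m + n)) (basisSeries a (-a) c (-c) q (q ^ (m + n) * (σ * (a * c))))
          * (oddWeight (b * d) a c q σ (m + n)
            * (phiTerm (-b / a) (q * σ * a / d) (-(q * σ)) (q / b) q m
              * phiTerm (-d / c) (q * σ * c / b) (-(q * σ)) (q / d) q n)) else 0)
      = ∑ M ∈ Finset.range (N + 1), if m ≤ M then
        coeff (N - M) (basisSeries a (-a) c (-c) q (q ^ M * (σ * (a * c))))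
          * (oddWeight (b * d) a c q σ M
            * (phiTerm (-b / a) (q * σ * a / d) (-(q * σ)) (q / b) q m
              * phiTerm (-d / c) (q * σ * c / b) (-(q * σ)) (q / d) q (M - m))) else 0 := by
    intro m hm
    rw [sum_range_ite_add_le _ (Nat.lt_succ_iff.mp (Finset.mem_range.mp hm))]
    refine Finset.sum_congr rfl fun M _ => ?_
    split_ifs with hM
    · rw [Nat.add_sub_cancel' hM]
    · rfl
  have e3 : ∀ M ∈ Finset.range (N + 1), (∑ m ∈ Finset.range (N + 1), if m ≤ M then
        coeff (N - M) (basisSeries a (-a) c (-c) q (q ^ M * (σ * (a * c))))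
          * (oddWeight (b * d) a c q σ M
            * (phiTerm (-b / a) (q * σ * a / d) (-(q * σ)) (q / b) q m
              * phiTerm (-d / c) (q * σ * c / b) (-(q * σ)) (q / d) q (M - m))) else 0)
      = if M ≤ N then oddConv a b c d q σ M * oddWeight (b * d) a c q σ M
        * coeff (N - M) (basisSeries a (-a) c (-c) q (q ^ M * (σ * (a * c)))) else 0 := by
    intro M hM
    have hM' := Nat.lt_succ_iff.mp (Finset.mem_range.mp hM)
    rw [if_pos hM', ← Finset.sum_subset (Finset.range_subset_range.mpr (Nat.succ_le_succ hM')),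
      oddConv, Finset.sum_mul, Finset.sum_mul]
    · refine Finset.sum_congr rfl fun m hm => ?_
      rw [if_pos (Nat.lt_succ_iff.mp (Finset.mem_range.mp hm))]
      ring
    · intro m _ hm
      exact if_neg fun hk => hm (Finset.mem_range.mpr (by omega))
  -- the expansion of the coefficients over the bidiagonal basis
  have e4 (N : ℕ) : basisCoeff a b c d q (σ * (a * c)) N = ∑ M ∈ Finset.range (N + 1),
      if M ≤ N then oddConv a b c d q σ M * oddWeight (b * d) a c q σ M
        * basisCoeff a (-a) c (-c) q (q ^ M * (σ * (a * c))) (N - M) else 0 := by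
    rw [← sum_oddConv_mul_expWeight ha hb hc hd hq0 hq1 (left_ne_zero_of_mul h.ne_zero)
      h.one_sub_mul_sq_sigma h.one_sub_mul (h.one_add_mul_div ha) (h.one_sub_mul_sq_div hb hd) N,
      Finset.Nat.sum_antidiagonal_eq_sum_range_succ_mk]
    refine Finset.sum_congr rfl fun M hM => ?_
    rw [if_pos (Nat.lt_succ_iff.mp (Finset.mem_range.mp hM)), expWeight, mul_assoc]
  rw [sum_sum_comm_sum_sum]
  simp_rw [e1]
  rw [Finset.sum_congr rfl e2, Finset.sum_comm, Finset.sum_congr rfl e3, basisSeries,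
    coeff_shiftedSum_of_expansion (fun M => le_rfl) _ e4]
  refine Finset.sum_congr rfl fun M _ => if_congr Iff.rfl ?_ rfl
  rw [basisSeries]
  simp only [pow_add, mul_assoc, mul_left_comm]

/-! ### Extension to all generic `s` by continuity -/

theorem _root_.ContinuousAt.qPoch {f : ℂ → ℂ} {s₀ : ℂ} (hf : ContinuousAt f s₀) (q : ℂ) (n : ℕ) :
    ContinuousAt (fun s => AskeyWilson.qPoch (f s) q n) s₀ := by
  unfold AskeyWilson.qPoch
  fun_prop

theorem IsGeneric.pow_mul {a b c d q s : ℂ} (h : IsGeneric a b c d q s)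
    (hq0 : q ≠ 0) (M : ℕ) : IsGeneric a b c d q (q ^ M * s) where
  ne_zero := mul_ne_zero (pow_ne_zero _ hq0) h.ne_zero
  ne_a j := by convert h.ne_a (j + M) using 1; ring
  ne_aa j := by convert h.ne_aa (j + M) using 1; ring
  ne_ac j := by convert h.ne_ac (j + M) using 1; ring
  ne_aacc j := by convert h.ne_aacc (j + M) using 1; ring
  ne_abcd j := by convert h.ne_abcd (j + 2 * M) using 1; ring

theorem continuousAt_cEven {a b c d q s₀ : ℂ} (ha : a ≠ 0) (hc : c ≠ 0) (hq1 : ‖q‖ < 1)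
    (h : IsGeneric a b c d q s₀) (k l : ℕ) : ContinuousAt (fun s => cEven a c q k l s) s₀ := by
  have hp (n : ℕ) : qPoch (q ^ 2) (q ^ 2) n ≠ 0 :=
    qPoch_self_ne_zero (by rw [norm_pow]; exact pow_lt_one₀ (norm_nonneg q) hq1 two_ne_zero) n
  have h1 : qPoch (q ^ (4 * l) * q ^ 2 * s₀ ^ 2 / a ^ 2) (q ^ 2) k ≠ 0 := by
    refine qPoch_ne_zero (fun i h0 => h.ne_a (i + 2 * l + 1) ?_) k
    field_simp at h0
    linear_combination -h0
  have h2 : qPoch (q ^ 3 * s₀ ^ 2 / (a ^ 2 * c ^ 2)) (q ^ 2) l ≠ 0 := by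
    refine qPoch_ne_zero (fun i h0 => h.ne_aacc (i + 1) ?_) l
    field_simp at h0
    linear_combination -h0
  have h3 : qPoch (q * s₀ / a ^ 2) q (2 * l) ≠ 0 := by
    refine qPoch_ne_zero (fun i h0 => h.ne_aa i ?_) _
    field_simp at h0
    linear_combination -h0
  have h4 : qPoch (s₀ ^ 2 / a ^ 2) (q ^ 2) (2 * l) ≠ 0 := by
    refine qPoch_ne_zero (fun i h0 => h.ne_a i ?_) _
    field_simp at h0
    linear_combination -h0
  unfold cEven
  refine .mul (.mul (.mul (.mul
    (.div (.mul ?_ ?_) (.mul ?_ ?_) (mul_ne_zero (hp k) h1)) continuousAt_const)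
    (.div (.mul ?_ ?_) (.mul ?_ ?_) (mul_ne_zero (hp l) h2)))
    (.div (.mul ?_ ?_) (.mul ?_ ?_) (mul_ne_zero h3 h4))) continuousAt_const
  all_goals exact ContinuousAt.qPoch (by fun_prop) _ _

theorem continuousAt_cOdd {a b c d q s₀ : ℂ} (ha : a ≠ 0) (hb : b ≠ 0) (hc : c ≠ 0) (hd : d ≠ 0)
    (hq1 : ‖q‖ < 1) (h : IsGeneric a b c d q s₀) (m n : ℕ) :
    ContinuousAt (fun s => cOdd a b c d q m n s) s₀ := by
  have hp (n : ℕ) : qPoch q q n ≠ 0 := qPoch_self_ne_zero hq1 n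
  have h1 : qPoch (q ^ 2 * s₀ ^ 2 / (a * b * c * d)) q m ≠ 0 := by
    refine qPoch_ne_zero (fun i h0 => h.ne_abcd i ?_) m
    field_simp at h0
    linear_combination -h0
  have h2 : qPoch (q * s₀ ^ 2 / (a ^ 2 * c ^ 2)) (q ^ 2) m ≠ 0 := by
    refine qPoch_ne_zero (fun i h0 => h.ne_aacc i ?_) m
    field_simp at h0
    linear_combination -h0
  have h3 : qPoch (q ^ m * q ^ 2 * s₀ ^ 2 / (a * b * c * d)) q n ≠ 0 := by
    refine qPoch_ne_zero (fun i h0 => h.ne_abcd (i + m) ?_) n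
    field_simp at h0
    linear_combination -h0
  have h4 : qPoch (-(q * s₀) / (a * c)) q n ≠ 0 := by
    refine qPoch_ne_zero (fun i h0 => h.ne_ac i ?_) n
    field_simp at h0
    linear_combination h0
  have h5 : qPoch (q ^ (2 * m) * q * s₀ ^ 2 / (a ^ 2 * c ^ 2)) (q ^ 2) n ≠ 0 := by
    refine qPoch_ne_zero (fun i h0 => h.ne_aacc (i + m) ?_) n
    field_simp at h0
    linear_combination -h0
  unfold cOdd
  refine .mul (.mul (.mul (.div (.mul (.mul (.mul ?_ ?_) ?_) ?_) (.mul (.mul ?_ ?_) ?_)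
    (mul_ne_zero (mul_ne_zero (hp m) h1) h2)) continuousAt_const)
    (.div (.mul (.mul (.mul (.mul ?_ ?_) ?_) ?_) ?_) (.mul (.mul (.mul ?_ ?_) ?_) ?_)
    (mul_ne_zero (mul_ne_zero (mul_ne_zero (hp n) h3) h4) h5))) continuousAt_const
  all_goals exact ContinuousAt.qPoch (by fun_prop) _ _

theorem continuousAt_coeff_fourfoldSeries {a b c d q s₀ : ℂ} (ha : a ≠ 0) (hb : b ≠ 0)
    (hc : c ≠ 0) (hd : d ≠ 0) (hq0 : q ≠ 0) (hq1 : ‖q‖ < 1) (h : IsGeneric a b c d q s₀) (N : ℕ) :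
    ContinuousAt (fun s => coeff N (fourfoldSeries a b c d q s)) s₀ := by
  simp only [fourfoldSeries, coeff_mk]
  refine tendsto_finsetSum _ fun k _ => tendsto_finsetSum _ fun l _ =>
    tendsto_finsetSum _ fun m _ => tendsto_finsetSum _ fun n _ => ?_
  split_ifs
  · refine ContinuousAt.mul (ContinuousAt.comp
      (continuousAt_cEven ha hc hq1 (h.pow_mul hq0 (m + n)) k l) ?_)
      (continuousAt_cOdd ha hb hc hd hq1 h m n)
    fun_prop
  · exact continuousAt_const

theorem continuousAt_coeff_awDefect {q s₀ : ℂ} (hs : s₀ ≠ 0) (hq0 : q ≠ 0) (a b c d : ℂ)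
    {F : ℂ → PowerSeries ℂ} (hF : ∀ n, ContinuousAt (fun s => coeff n (F s)) s₀) (n : ℕ) :
    ContinuousAt (fun s => coeff n (awDefect a b c d q s (F s))) s₀ := by
  have hmul (P : PowerSeries ℂ) {G : ℂ → PowerSeries ℂ}
      (hG : ∀ n, ContinuousAt (fun s => coeff n (G s)) s₀) (n : ℕ) :
      ContinuousAt (fun s => coeff n (P * G s)) s₀ := by
    simp only [coeff_mul]
    exact tendsto_finsetSum _ fun p _ => (hG p.2).const_mul _
  have hinv : ContinuousAt (fun s : ℂ => s⁻¹) s₀ := continuousAt_inv₀ hs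
  have heig : ContinuousAt (fun s => awEig a b c d q s) s₀ := by
    unfold awEig
    exact ((continuousAt_id.add (continuousAt_const.div (by fun_prop)
      (mul_ne_zero hq0 hs))).sub continuousAt_const).sub continuousAt_const
  simp only [awDefect, awOp, map_sub, map_add]
  refine ((hmul _ fun m => ?_) n |>.add ((hmul _ fun m => ?_) n)).sub ?_
  · simp only [map_sub, coeff_C_mul, coeff_rescale]
    exact (continuousAt_id.mul ((hF m).const_mul _)).sub (hF m)
  · simp only [map_sub, coeff_C_mul, coeff_rescale]
    exact (hinv.mul ((hF m).const_mul _)).sub (hF m)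
  · simp only [mul_assoc, coeff_C_mul]
    exact heig.mul (hmul _ hF n)

theorem countable_setOf_mul_sq_eq {t : ℂ} (ht : t ≠ 0) (v : ℂ) :
    {s : ℂ | t * s ^ 2 = v}.Countable := by
  rcases Set.eq_empty_or_nonempty {s : ℂ | t * s ^ 2 = v} with h | ⟨s₁, h₁⟩
  · rw [h]
    exact Set.countable_empty
  · refine (Set.toFinite {s₁, -s₁}).countable.mono fun s hs => ?_
    have h2 : s ^ 2 = s₁ ^ 2 :=
      mul_left_cancel₀ ht ((show t * s ^ 2 = v from hs).trans (Eq.symm h₁))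
    simpa using sq_eq_sq_iff_eq_or_eq_neg.mp h2

/-- Strong genericity fails for countably many `s` only. -/
theorem dense_setOf_isStronglyGeneric {q : ℂ} (hq0 : q ≠ 0) (a b c d : ℂ) :
    Dense {s : ℂ | IsStronglyGeneric a b c d q s} := by
  have hv (v : ℂ) : (⋃ j : ℕ, {s : ℂ | q ^ j * s ^ 2 = v}).Countable :=
    Set.countable_iUnion fun j => countable_setOf_mul_sq_eq (pow_ne_zero j hq0) v
  have hc := (Set.countable_singleton (0 : ℂ)).union <| (hv 1).union <| (hv (a ^ 2)).union <|
    (hv (a ^ 4)).union <| (hv (a ^ 2 * c ^ 2)).union (hv (a * b * c * d))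
  refine (hc.dense_compl ℂ).mono fun s hs => ?_
  simp only [Set.mem_compl_iff, Set.mem_union, Set.mem_singleton_iff, Set.mem_iUnion,
    Set.mem_ofPred_eq, not_or, not_exists] at hs
  exact ⟨hs.1, hs.2.1, hs.2.2.1, hs.2.2.2.1, hs.2.2.2.2.1, hs.2.2.2.2.2⟩

/-- The fourfold series solves the eigenvalue equation for every generic `s`, by continuity from
the strongly generic values. -/
theorem awDefect_fourfoldSeries {a b c d q s₀ : ℂ} (ha : a ≠ 0) (hb : b ≠ 0) (hc : c ≠ 0)
    (hd : d ≠ 0) (hq0 : q ≠ 0) (hq1 : ‖q‖ < 1) (h : IsGeneric a b c d q s₀) :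
    awDefect a b c d q s₀ (fourfoldSeries a b c d q s₀) = 0 := by
  ext n
  have hcont := continuousAt_coeff_awDefect h.ne_zero hq0 a b c d
    (continuousAt_coeff_fourfoldSeries ha hb hc hd hq0 hq1 h) n
  have hne : (nhdsWithin s₀ {s : ℂ | IsStronglyGeneric a b c d q s}).NeBot :=
    mem_closure_iff_nhdsWithin_neBot.mp (dense_setOf_isStronglyGeneric hq0 a b c d s₀)
  refine tendsto_nhds_unique (hcont.mono_left nhdsWithin_le_nhds)
    (tendsto_const_nhds.congr' ?_ :
      Filter.Tendsto _ (nhdsWithin s₀ {s : ℂ | IsStronglyGeneric a b c d q s}) _)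
  filter_upwards [self_mem_nhdsWithin] with s hs
  have hs : IsStronglyGeneric a b c d q s := hs
  rw [fourfoldSeries_eq_basisSeries ha hb hc hd hq0 hq1 hs,
    awDefect_basisSeries ha hq0 hq1 hs.ne_zero b c d fun j => hs.ne_abcd (j + 2)]

theorem constantCoeff_fourfoldSeries (a b c d q s : ℂ) :
    constantCoeff (fourfoldSeries a b c d q s) = 1 := by
  rw [← coeff_zero_eq_constantCoeff_apply, fourfoldSeries, coeff_mk]
  simp [cEven, cOdd]

/-! ### The operator on formal Laurent series -/

theorem qShift_one_coe {q lam : ℂ} (hq0 : q ≠ 0) (F : PowerSeries ℂ) :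
    qShift q lam 1 (F : LaurentSeries ℂ)
      = ((C (q ^ (-lam)) * rescale q F : PowerSeries ℂ) : LaurentSeries ℂ) := by
  ext n
  change q ^ (((1 : ℤ) : ℂ) * ((n : ℂ) - lam)) * (F : LaurentSeries ℂ).coeff n = _
  rw [PowerSeries.coeff_coe, PowerSeries.coeff_coe]
  split_ifs with hn
  · rw [mul_zero]
  · obtain ⟨m, rfl⟩ := Int.eq_ofNat_of_zero_le (not_lt.mp hn)
    rw [coeff_C_mul, coeff_rescale, Int.natAbs_natCast, Int.cast_one, one_mul, Int.cast_natCast,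
      sub_eq_add_neg, Complex.cpow_add _ _ hq0, Complex.cpow_natCast]
    ring

theorem qShift_neg_one_coe {q lam : ℂ} (hq0 : q ≠ 0) (F : PowerSeries ℂ) :
    qShift q lam (-1) (F : LaurentSeries ℂ)
      = ((C (q ^ (-lam))⁻¹ * rescale q⁻¹ F : PowerSeries ℂ) : LaurentSeries ℂ) := by
  ext n
  change q ^ (((-1 : ℤ) : ℂ) * ((n : ℂ) - lam)) * (F : LaurentSeries ℂ).coeff n = _
  rw [PowerSeries.coeff_coe, PowerSeries.coeff_coe]
  split_ifs with hn
  · rw [mul_zero]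
  · obtain ⟨m, rfl⟩ := Int.eq_ofNat_of_zero_le (not_lt.mp hn)
    rw [coeff_C_mul, coeff_rescale, Int.natAbs_natCast,
      show ((-1 : ℤ) : ℂ) * (((m : ℤ) : ℂ) - lam) = -((m : ℂ) + -lam) by push_cast; ring,
      Complex.cpow_neg, Complex.cpow_add _ _ hq0, Complex.cpow_natCast, mul_inv, inv_pow]
    ring

/-- The eigenvalue equation of the Askey-Wilson operator in an arbitrary field, multiplied by
`(1 - y^2) (1 - Q y^2) (Q - y^2)`. -/
theorem clear_denominators_iff {K : Type*} [Field K] {A B C D Q E y F G H : K} (hy : y ≠ 0)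
    (h1 : 1 - y ^ 2 ≠ 0) (h2 : 1 - Q * y ^ 2 ≠ 0) (h3 : Q - y ^ 2 ≠ 0) :
    (1 - A * y) * (1 - B * y) * (1 - C * y) * (1 - D * y)
          / ((1 - y ^ 2) * (1 - Q * y ^ 2)) * (G - F)
        + (1 - A / y) * (1 - B / y) * (1 - C / y) * (1 - D / y)
          / ((1 - 1 / y ^ 2) * (1 - Q / y ^ 2)) * (H - F) = E * F
      ↔ (1 - A * y) * (1 - B * y) * (1 - C * y) * (1 - D * y) * (Q - y ^ 2) * (G - F)
        + (1 - Q * y ^ 2) * ((y - A) * (y - B) * (y - C) * (y - D)) * (H - F)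
        - E * ((1 - y ^ 2) * (1 - Q * y ^ 2) * (Q - y ^ 2)) * F = 0 := by
  have e1 : (1 - A / y) * (1 - B / y) * (1 - C / y) * (1 - D / y)
      / ((1 - 1 / y ^ 2) * (1 - Q / y ^ 2))
      = (y - A) * (y - B) * (y - C) * (y - D) / ((1 - y ^ 2) * (Q - y ^ 2)) := by
    rw [show (1 - A / y) * (1 - B / y) * (1 - C / y) * (1 - D / y)
        = (y - A) * (y - B) * (y - C) * (y - D) / y ^ 4 by field_simp,
      show (1 - 1 / y ^ 2) * (1 - Q / y ^ 2) = (1 - y ^ 2) * (Q - y ^ 2) / y ^ 4 by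
        field_simp; ring,
      div_div_div_cancel_right₀ (pow_ne_zero 4 hy)]
  rw [e1, sub_eq_zero]
  generalize (1 - A * y) * (1 - B * y) * (1 - C * y) * (1 - D * y) = P1
  generalize (y - A) * (y - B) * (y - C) * (y - D) = P2
  generalize 1 - y ^ 2 = D1 at *
  generalize 1 - Q * y ^ 2 = D2 at *
  generalize Q - y ^ 2 = D3 at *
  have e2 : P1 / (D1 * D2) * (G - F) + P2 / (D1 * D3) * (H - F)
      = (P1 * D3 * (G - F) + D2 * P2 * (H - F)) / (D1 * D2 * D3) := by
    field_simp
  rw [e2, div_eq_iff (mul_ne_zero (mul_ne_zero h1 h2) h3)]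
  constructor <;> intro h <;> linear_combination h

/-- The eigenvalue equation on `x^(-lam) * ℂ⟦x⟧`, with its denominators cleared. -/
theorem isNormalizedEigenseries_iff {q lam : ℂ} (hq0 : q ≠ 0) (a b c d : ℂ) (F : PowerSeries ℂ) :
    IsNormalizedEigenseries a b c d q (q ^ (-lam)) lam F
      ↔ constantCoeff F = 1 ∧ awDefect a b c d q (q ^ (-lam)) F = 0 := by
  have hx : (x : LaurentSeries ℂ) = ((X : PowerSeries ℂ) : LaurentSeries ℂ) :=
    (PowerSeries.coe_X).symm
  have hconst (u : ℂ) : const u = ((C u : PowerSeries ℂ) : LaurentSeries ℂ) :=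
    (PowerSeries.coe_C u).symm
  have hinj (P : PowerSeries ℂ) : (P : LaurentSeries ℂ) = 0 ↔ P = 0 :=
    map_eq_zero_iff (HahnSeries.ofPowerSeries ℤ ℂ) HahnSeries.ofPowerSeries_injective
  have hne {P : PowerSeries ℂ} (hP : constantCoeff P ≠ 0) : (P : LaurentSeries ℂ) ≠ 0 := by
    rw [Ne, hinj]
    rintro rfl
    exact hP (map_zero _)
  have h1 : 1 - x ^ 2 ≠ 0 := by
    have := hne (P := 1 - X ^ 2) (by simp)
    simpa [hx] using this
  have h2 : 1 - const q * x ^ 2 ≠ 0 := by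
    have := hne (P := 1 - C q * X ^ 2) (by simp)
    simpa [hx, hconst] using this
  have h3 : const q - x ^ 2 ≠ 0 := by
    have := hne (P := C q - X ^ 2) (by simpa using hq0)
    simpa [hx, hconst] using this
  have h0 : x ≠ 0 := by
    rw [hx, Ne, hinj]
    exact X_ne_zero
  rw [IsNormalizedEigenseries, awOperator, clear_denominators_iff h0 h1 h2 h3,
    qShift_one_coe hq0, qShift_neg_one_coe hq0, coeff_zero_eq_constantCoeff_apply,
    ← hinj (awDefect _ _ _ _ _ _ _)]
  refine and_congr Iff.rfl (Eq.congr_left ?_)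
  simp only [awDefect, awOp, awDen, awEig, hx, hconst, map_sub, map_add, map_mul, map_pow, map_one]

end AskeyWilson

/-- For generic `s = q^(-lam)`, the formal series `x^(-lam) * F(x)` with `F(0) = 1` is an
eigenseries of the Askey-Wilson operator exactly when `F` is the fourfold series: the normalised
eigenseries exists, is unique, and is given by the fourfold sum. -/
theorem mainTheorem1 (a b c d q s lam : ℂ)
    (ha : a ≠ 0) (hb : b ≠ 0) (hc : c ≠ 0) (hd : d ≠ 0)
    (hq0 : q ≠ 0) (hq1 : ‖q‖ < 1)
    (hs : s = q ^ (-lam))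
    (hgen : AskeyWilson.IsGeneric a b c d q s) :
    ∀ F : PowerSeries ℂ,
      AskeyWilson.IsNormalizedEigenseries a b c d q s lam F ↔
        F = AskeyWilson.fourfoldSeries a b c d q s := by
  intro F
  subst hs
  rw [AskeyWilson.isNormalizedEigenseries_iff hq0]
  have h0 := AskeyWilson.constantCoeff_fourfoldSeries a b c d q (q ^ (-lam))
  have h1 := AskeyWilson.awDefect_fourfoldSeries ha hb hc hd hq0 hq1 hgen
  constructor
  · rintro ⟨hF0, hF⟩
    exact AskeyWilson.eq_of_awDefect_eq_zero hq0 hq1 hgen.ne_zero hgen.ne_abcd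
      (hF0.trans h0.symm) hF h1
  · rintro rfl
    exact ⟨h0, h1⟩
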